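/- **Setting.** Let $\mathcal U\neq\emptyset$, $h_1,h_2:\mathcal U\to\mathbb R$, and consider $\min_{u\in\mathcal U}(h_1(u),h_2(u))$. Assume: 1. (Hidden strong convexity) There are a bijection $g:\mathcal U\to\mathcal X\subset\mathbb R^d$ and functions $f_1,f_2$, twice continuously differentiable on an open set containing $\mathcal X$ and $\mu$-strongly convex on $\mathcal X$ ($\mu>0$), with $h_m=f_m\circ g$; the image under $g$ of the Pareto set lies in a compact $\mathcal K\subset\mathcal X$ on which $\nabla f_1,\nabla f_2$ are Lipschitz. 2. (LICQ with fixed active set) $\mathcal X=\{x: c_1(x)\le 0,\ c_2(x)=0\}$ with $c_1$ (componentwise) convex, twice differentiable and Lipschitz-smooth, and $c_2$ affine. With $x^*_w$ the minimizer over $\mathcal X$ of $w f_1+(1-w)f_2$, the set of constraints active at $x_w^*$ is the same for all $w\in[0,1]$, their gradients at $x_w^*$ are linearly independent, and the Hessian of the Lagrangian at $x_w^*$ (at its multiplier) is Lipschitz along the path $w\in[0,1]$. 3. (Nonzero tangent trade-off) There is $c>0$ with $\|\mathrm{Proj}_{\ker J_w}(\nabla f_1(x_w^*)-\nabla f_2(x_w^*))\|\ge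 c$ for all $w\in[0,1]$, where $J_w$ is the Jacobian of the active constraints at $x^*_w$. Put $f_{\rm PF}(w)=(f_1(x_w^*),f_2(x_w^*))$, $v(w)=\|f_{\rm PF}'(w)\|$, $s(w)=\int_0^w v$, $\Phi=s/s(1)$, $v_{\min}=\min_{[0,1]}v$, $v_{\max}=\max_{[0,1]}v$. A function on $[0,1]$ is called $l$-Lipschitz-smooth if it is differentiable with $l$-Lipschitz derivative. **Algorithm (SURF).** Given $N\ge1$, $\alpha\in(0,1]$, an inner solver $S(w;u)\in\mathcal U$ and starting points $u_0^{(-1)},\dots,u_N^{(-1)}\in\mathcal U$, set $\Phi_0(w)=w$ and, for $t=0,1,2,\dots$: $w_n^{(t)}=\Phi_t^{-1}(n/N)$; $u_n^{(t)}=S(w_n^{(t)};u_n^{(t-1)})$; $\tilde s^{(t)}$ is the PCHIP (monotone piecewise cubic Hermite, weighted-harmonic-mean slopes, clipped three-point end slopes) interpolant on $[0,1]$ of the cumulative chord lengths $\sum_{k<n}\|h(u^{(t)}_{k+1})-h(u^{(t)}_k)\|$ at the knots $w_n^{(t)}$, $0\le n\le N$; $\tilde\Phi_t=\tilde s^{(t)}/\tilde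 s^{(t)}(1)$; $\Phi_{t+1}=\alpha\tilde\Phi_t+(1-\alpha)\Phi_t$. Write $x_n^{(t)}=g(u_n^{(t)})$ and $\|\phi\|_\infty=\sup_{[0,1]}|\phi|$. The solver is exact if $g(S(w;u))=x_w^*$ always. A $K$-step solver $S_K$ has contraction factors $\eta_K\downarrow0$ if $\|g(S_K(w;u))-x_w^*\|\le\eta_K\|g(u)-x_w^*\|$ for all $K$, $w\in[0,1]$, $u\in\mathcal U$. **Theorem.** For $w\in[0,1]$ the minimizer $x_w^*$ exists and is unique; $f_{\rm PF}$ is differentiable on $[0,1]$, $v$ is continuous and $v_{\min}>0$; and $\Phi$ is a strictly increasing CDF on $[0,1]$ that is $l_\Phi$-Lipschitz-smooth for some $l_\Phi\ge 0$. There are constants $l_{\rm iter},c_N,c_\eta,a>0$, $b\in\mathbb R$, $B\ge0$ and numbers $C(N)$ with $aN\le C(N)\le bN$ for all $N\ge1$ (so $C(N)=\Theta(N)$), all depending only on the problem, such that, with $\kappa=\frac{4\sqrt2\,v_{\max}}{v_{\min}}\sqrt{l_{\rm iter}+l_\Phi}$: (a) With an exact solver, for all $N\ge1$, $\alpha\in(0,1]$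 and $t\ge0$, $\Phi_t$ and $\tilde\Phi_t$ are strictly increasing CDFs on $[0,1]$ and are $l_{\rm iter}$-Lipschitz-smooth. (b) Consider a $K$-step solver with contraction factors $\eta_K$, $N\ge c_N\kappa^{1.5}$, $D\ge1$ with $\max_n\|g(u_n^{(-1)})-x^*_{n/N}\|\le D$, $\alpha\in(0,1]$, and $K$ with $D\,\eta_K\le c_\eta\, s(1)/N$. Then for all $t\ge0$, $\Phi_t$ and $\tilde\Phi_t$ are strictly increasing CDFs on $[0,1]$ and are $l_{\rm iter}\max\{1,N^2D\eta_K\}$-Lipschitz-smooth (so $l_{\rm iter}$-Lipschitz-smooth when $\eta_K\le 1/(DN^2)$). If moreover $\alpha\le\frac12$, then for all $t\ge0$ $$\|\Phi_t-\Phi\|_\infty+C(N)\max_{0\le n\le N}\|x_n^{(t)}-x^*_{w_n^{(t)}}\|\le\Big(1-\frac\alpha4\Big)^t\Big(\|\Phi_0-\Phi\|_\infty+C(N)\max_{0\le n\le N}\|x_n^{(0)}-x^*_{w_n^{(0)}}\|\Big)+\frac{B}{N^2}.$$ (c) For $N\ge c_N\kappa^{1.5}$, the budget $D\,\eta_K\le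 c_\eta\,s(1)/N$ in (b) is met: if $\eta_K\le A\rho^K$ with $A>0$, $0<\rho<1$, whenever $K\ge c_K\log(Nv_{\max}v_{\min}^{-2})$, with $c_K>0$ depending only on the problem and $A,\rho,D$; if $\eta_K\le AK^{-r}$ for $K\ge1$ with $A,r>0$, whenever $K\ge c_K(N/s(1))^{1/r}$, with $c_K>0$ depending only on the problem and $A,r,D$. -/

import Mathlib

open Set Filter Topology

noncomputable section

namespace SURF

/-- `ℝ^d` with the Euclidean norm. -/
abbrev Vec (d : ℕ) : Type := EuclideanSpace ℝ (Fin d)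

/-- The data of a bi-objective problem `min (h 0 u, h 1 u)` over the feasible set `U`, of its hidden
representation `f` on `X` through `g`, and of the inequality and equality constraints `c₁`, `c₂`.
The relations between these data are the assumptions `HiddenRegular`, `ConstraintRegular`,
`NonzeroTradeoff` below. -/
structure Problem (U : Type*) (d p q : ℕ) where
  h : Fin 2 → U → ℝ
  g : U → Vec d
  f : Fin 2 → Vec d → ℝ
  X : Set (Vec d)
  c₁ : Fin p → Vec d → ℝ
  c₂ : Fin q → Vec d → ℝ

section Geometry

variable {U : Type*} {d p q : ℕ} (P : Problem U d p q)

/-- The objective vector `h(u)` in the Euclidean plane. -/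
def hvec (u : U) : Vec 2 := WithLp.toLp 2 (fun m => P.h m u)

/-- The objective vector `f(x)` in the Euclidean plane. -/
def fvec (x : Vec d) : Vec 2 := WithLp.toLp 2 (fun m => P.f m x)

/-- The Pareto set in the original space. -/
def paretoSet : Set U :=
  {u | ¬ ∃ u', (∀ m, P.h m u' ≤ P.h m u) ∧ ∃ m, P.h m u' < P.h m u}

/-- Linear scalarization in the hidden space. -/
def LS (w : ℝ) (x : Vec d) : ℝ := w * P.f 0 x + (1 - w) * P.f 1 x

/-- `x` minimizes the scalarized objective with weight `w` over `X`. -/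
def IsLSMin (w : ℝ) (x : Vec d) : Prop := x ∈ P.X ∧ ∀ y ∈ P.X, LS P w x ≤ LS P w y

/-- The scalarized solution `x*_w`. -/
def xstar (w : ℝ) : Vec d := Classical.epsilon (IsLSMin P w)

/-- Hidden-space regularity. -/
def HiddenRegular : Prop :=
  BijOn P.g univ P.X ∧
  (∀ m u, P.h m u = P.f m (P.g u)) ∧
  (∃ O : Set (Vec d), IsOpen O ∧ P.X ⊆ O ∧ ∀ m, ContDiffOn ℝ 2 (P.f m) O) ∧
  (∃ μ : ℝ, 0 < μ ∧ ∀ m, StrongConvexOn P.X μ (P.f m)) ∧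
  ∃ (𝒦 : Set (Vec d)) (l : NNReal), IsCompact 𝒦 ∧ 𝒦 ⊆ P.X ∧ P.g '' paretoSet P ⊆ 𝒦 ∧
    ∀ m, LipschitzOnWith l (gradient (P.f m)) 𝒦

/-- Indices of the inequality constraints that are active at `x*_w`. -/
def activeSet (w : ℝ) : Set (Fin p) := {i | P.c₁ i (xstar P w) = 0}

/-- Indices of all active constraints at `x*_w`: active inequalities and all equalities. -/
abbrev ActiveIdx (w : ℝ) : Type := activeSet P w ⊕ Fin q

/-- The active constraint functions at `x*_w`. -/
def activeConstraint (w : ℝ) : ActiveIdx P w → Vec d → ℝ :=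
  Sum.elim (fun i => P.c₁ i) P.c₂

/-- The Jacobian `J_w` of the active constraints at `x*_w`, as a linear map. -/
def jacobian (w : ℝ) : Vec d →ₗ[ℝ] (ActiveIdx P w → ℝ) :=
  LinearMap.pi (fun k => (fderiv ℝ (activeConstraint P w k) (xstar P w)).toLinearMap)

/-- The Lagrangian of the scalarized problem with the active constraints. -/
def lagrangian (w : ℝ) (ν : ActiveIdx P w → ℝ) (x : Vec d) : ℝ :=
  letI : Fintype (activeSet P w) := Fintype.ofFinite _
  LS P w x + ∑ k, ν k * activeConstraint P w k x

/-- `ν` is an optimal Lagrange multiplier for the scalarized problem with weight `w`. -/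
def IsMultiplier (w : ℝ) (ν : ActiveIdx P w → ℝ) : Prop :=
  gradient (lagrangian P w ν) (xstar P w) = 0 ∧ ∀ i : activeSet P w, 0 ≤ ν (Sum.inl i)

/-- The Hessian in `x` of the Lagrangian at `x*_w`, as a bilinear form with its operator norm. -/
def lagrangianHessian (w : ℝ) (ν : ActiveIdx P w → ℝ) : Vec d →L[ℝ] Vec d →L[ℝ] ℝ :=
  fderiv ℝ (fderiv ℝ (lagrangian P w ν)) (xstar P w)

/-- Constraint regularity: `X = {c₁ ≤ 0, c₂ = 0}` with `c₁` convex, twice differentiable and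
Lipschitz-smooth and `c₂` affine; the active set is fixed along the solution path and satisfies LICQ;
and the Lagrangian Hessian is Lipschitz along the solution path. -/
def ConstraintRegular : Prop :=
  P.X = {x | (∀ i, P.c₁ i x ≤ 0) ∧ ∀ j, P.c₂ j x = 0} ∧
  (∀ i, ConvexOn ℝ univ (P.c₁ i) ∧ Differentiable ℝ (P.c₁ i) ∧
    Differentiable ℝ (fderiv ℝ (P.c₁ i)) ∧ ∃ l : NNReal, LipschitzWith l (gradient (P.c₁ i))) ∧
  (∀ j, ∃ (a : Vec d →L[ℝ] ℝ) (b : ℝ), ∀ x, P.c₂ j x = a x + b) ∧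
  (∀ w ∈ Icc (0 : ℝ) 1, ∀ w' ∈ Icc (0 : ℝ) 1, activeSet P w = activeSet P w') ∧
  (∀ w ∈ Icc (0 : ℝ) 1,
    LinearIndependent ℝ (fun k => gradient (activeConstraint P w k) (xstar P w))) ∧
  ∃ L : ℝ, ∀ w ∈ Icc (0 : ℝ) 1, ∀ w' ∈ Icc (0 : ℝ) 1, ∀ ν ν',
    IsMultiplier P w ν → IsMultiplier P w' ν' →
      ‖lagrangianHessian P w ν - lagrangianHessian P w' ν'‖ ≤ L * |w - w'|

/-- Nonzero trade-off along the tangent space of the active constraints. -/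
def NonzeroTradeoff : Prop :=
  ∃ c : ℝ, 0 < c ∧ ∀ w ∈ Icc (0 : ℝ) 1,
    c ≤ ‖(LinearMap.ker (jacobian P w)).starProjection
          (gradient (P.f 0) (xstar P w) - gradient (P.f 1) (xstar P w))‖

/-- The Pareto-front path `w ↦ f(x*_w)`. -/
def fPF (w : ℝ) : Vec 2 := fvec P (xstar P w)

/-- The traversal speed (one-sided derivatives at `w = 0` and `w = 1`). -/
def speed (w : ℝ) : ℝ := ‖derivWithin (fPF P) (Icc 0 1) w‖

/-- The Pareto-front arc length up to weight `w`. -/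
def arcLength (w : ℝ) : ℝ := ∫ r in (0 : ℝ)..w, speed P r

/-- The normalized arc-length CDF `Φ`. -/
def cdf (w : ℝ) : ℝ := arcLength P w / arcLength P 1

/-- The smallest traversal speed. -/
def vMin : ℝ := sInf (speed P '' Icc 0 1)

/-- The largest traversal speed. -/
def vMax : ℝ := sSup (speed P '' Icc 0 1)

end Geometry

/-- `φ` is `l`-Lipschitz-smooth on `[0,1]`: differentiable with `l`-Lipschitz derivative. -/
def LipschitzSmooth (l : ℝ) (φ : ℝ → ℝ) : Prop :=
  DifferentiableOn ℝ φ (Icc 0 1) ∧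
  ∀ x ∈ Icc (0 : ℝ) 1, ∀ y ∈ Icc (0 : ℝ) 1,
    |derivWithin φ (Icc 0 1) x - derivWithin φ (Icc 0 1) y| ≤ l * |x - y|

/-- `φ` restricts to a continuous strictly increasing distribution function on `[0,1]`. -/
def IsCDF (φ : ℝ → ℝ) : Prop :=
  ContinuousOn φ (Icc 0 1) ∧ StrictMonoOn φ (Icc 0 1) ∧ φ 0 = 0 ∧ φ 1 = 1

/-- The sup norm of `φ - ψ` on `[0,1]`. -/
def supDist (φ ψ : ℝ → ℝ) : ℝ := ⨆ w : Icc (0 : ℝ) 1, |φ w - ψ w|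

section Interpolation

/-- Mesh widths. -/
def mesh (w : ℕ → ℝ) (n : ℕ) : ℝ := w (n + 1) - w n

/-- Secant slopes. -/
def secant (w y : ℕ → ℝ) (n : ℕ) : ℝ := (y (n + 1) - y n) / mesh w n

/-- The three-point endpoint slope with monotonicity clipping. -/
def endSlope (h₀ h₁ δ₀ δ₁ : ℝ) : ℝ :=
  let m := ((2 * h₀ + h₁) * δ₀ - h₀ * δ₁) / (h₀ + h₁)
  if m * δ₀ ≤ 0 then 0 else if 3 * |δ₀| < |m| then 3 * δ₀ else m

/-- The PCHIP slope at the knot `w n`, `0 ≤ n ≤ N`: weighted harmonic mean at the interior knots. -/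
def pchipSlope (N : ℕ) (w y : ℕ → ℝ) (n : ℕ) : ℝ :=
  if N = 1 then secant w y 0
  else if n = 0 then endSlope (mesh w 0) (mesh w 1) (secant w y 0) (secant w y 1)
  else if n = N then
    endSlope (mesh w (N - 1)) (mesh w (N - 2)) (secant w y (N - 1)) (secant w y (N - 2))
  else if secant w y (n - 1) * secant w y n ≤ 0 then 0
  else
    let ω₁ := 2 * mesh w n + mesh w (n - 1)
    let ω₂ := mesh w n + 2 * mesh w (n - 1)
    (ω₁ + ω₂) / (ω₁ / secant w y (n - 1) + ω₂ / secant w y n)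

/-- For increasing knots `w 0 < ⋯ < w N` and `x ∈ [w 0, w N]`, the index `n < N` of a knot interval
`[w n, w (n+1)]` that contains `x`: the number of interior knots that are at most `x`. -/
def pieceIndex (N : ℕ) (w : ℕ → ℝ) (x : ℝ) : ℕ := ((Finset.Ico 1 N).filter (fun k => w k ≤ x)).card

/-- The cubic Hermite piece on `[w n, w (n+1)]`. -/
def hermitePiece (N : ℕ) (w y : ℕ → ℝ) (n : ℕ) (x : ℝ) : ℝ :=
  let θ := (x - w n) / mesh w n
  (2 * θ ^ 3 - 3 * θ ^ 2 + 1) * y n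
    + (θ ^ 3 - 2 * θ ^ 2 + θ) * mesh w n * pchipSlope N w y n
    + (-2 * θ ^ 3 + 3 * θ ^ 2) * y (n + 1)
    + (θ ^ 3 - θ ^ 2) * mesh w n * pchipSlope N w y (n + 1)

/-- The piecewise cubic Hermite interpolating polynomial (PCHIP) of `(w n, y n)`, `0 ≤ n ≤ N`. -/
def pchip (N : ℕ) (w y : ℕ → ℝ) (x : ℝ) : ℝ := hermitePiece N w y (pieceIndex N w x) x

end Interpolation

section Algorithm

variable {U : Type*} {d p q : ℕ} (P : Problem U d p q)

/-- The sampled weights `w n = φ⁻¹(n/N)`. -/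
def weights (N : ℕ) (φ : ℝ → ℝ) (n : ℕ) : ℝ := Function.invFunOn φ (Icc 0 1) ((n : ℝ) / N)

/-- Cumulative chord length of the sampled objective vectors. -/
def chordLength (u : ℕ → U) (n : ℕ) : ℝ :=
  ∑ k ∈ Finset.range n, ‖hvec P (u (k + 1)) - hvec P (u k)‖

/-- The rebuilt CDF `s̃(x) / s̃(1)`, where `s̃` interpolates the chord lengths at the weights. -/
def rebuilt (N : ℕ) (w : ℕ → ℝ) (u : ℕ → U) (x : ℝ) : ℝ :=
  pchip N w (chordLength P u) x / pchip N w (chordLength P u) 1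

/-- Warm-started calls `u n ↦ InnerSolver(w n; u n)` at the weights given by `φ`. -/
def solveAll (S : ℝ → U → U) (N : ℕ) (φ : ℝ → ℝ) (u : ℕ → U) (n : ℕ) : U :=
  S (weights N φ n) (u n)

/-- The state `(Φ_t, u^(t-1))` of SURF at the start of outer iteration `t`, for the inner solver
`S w u_start`, damping factor `α`, `N` segments and starting points `u₀ = u^(-1)`. -/
def surf (S : ℝ → U → U) (N : ℕ) (α : ℝ) (u₀ : ℕ → U) : ℕ → (ℝ → ℝ) × (ℕ → U)
  | 0 => (fun w => w, u₀)
  | t + 1 =>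
    let φ := (surf S N α u₀ t).1
    let u := solveAll S N φ (surf S N α u₀ t).2
    (fun x => α * rebuilt P N (weights N φ) u x + (1 - α) * φ x, u)

/-- The CDF iterate `Φ_t`. -/
def surfCDF (S : ℝ → U → U) (N : ℕ) (α : ℝ) (u₀ : ℕ → U) (t : ℕ) : ℝ → ℝ :=
  (surf P S N α u₀ t).1

/-- The weights `w_n^(t)`. -/
def surfWeight (S : ℝ → U → U) (N : ℕ) (α : ℝ) (u₀ : ℕ → U) (t : ℕ) : ℕ → ℝ :=
  weights N (surfCDF P S N α u₀ t)

/-- The solver outputs `u_n^(t)`. -/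
def surfPoint (S : ℝ → U → U) (N : ℕ) (α : ℝ) (u₀ : ℕ → U) (t : ℕ) : ℕ → U :=
  (surf P S N α u₀ (t + 1)).2

/-- The rebuilt CDF `Φ̃_t`. -/
def surfRebuilt (S : ℝ → U → U) (N : ℕ) (α : ℝ) (u₀ : ℕ → U) (t : ℕ) : ℝ → ℝ :=
  rebuilt P N (surfWeight P S N α u₀ t) (surfPoint P S N α u₀ t)

/-- The inner optimization error `max_{0 ≤ n ≤ N} ‖x_n^(t) - x*_{w_n^(t)}‖`, `x_n^(t) = g(u_n^(t))`. -/
def innerError (S : ℝ → U → U) (N : ℕ) (α : ℝ) (u₀ : ℕ → U) (t : ℕ) : ℝ :=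
  (Finset.range (N + 1)).sup' Finset.nonempty_range_add_one
    (fun n => ‖P.g (surfPoint P S N α u₀ t n) - xstar P (surfWeight P S N α u₀ t n)‖)

/-- The combined error, with weight `C` on the inner optimization error. -/
def combinedError (C : ℝ) (S : ℝ → U → U) (N : ℕ) (α : ℝ) (u₀ : ℕ → U) (t : ℕ) : ℝ :=
  supDist (surfCDF P S N α u₀ t) (cdf P) + C * innerError P S N α u₀ t

/-- The solver returns exact scalarized solutions. -/
def IsExactSolver (S : ℝ → U → U) : Prop :=
  ∀ w ∈ Icc (0 : ℝ) 1, ∀ u, P.g (S w u) = xstar P w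

/-- `S K w u` is the output of `K` solver steps for weight `w` from `u`, with `K`-step contraction
factors `η K ↓ 0` in the hidden space. -/
def IsKStepSolver (S : ℕ → ℝ → U → U) (η : ℕ → ℝ) : Prop :=
  (∀ K, ∀ w ∈ Icc (0 : ℝ) 1, ∀ u,
    ‖P.g (S K w u) - xstar P w‖ ≤ η K * ‖P.g u - xstar P w‖) ∧
  Antitone η ∧ Tendsto η atTop (𝓝 0)

/-- `κ = 4√2 (v_max / v_min) √(l_iter + l_Φ)`. -/
def kappa (lIter lPhi : ℝ) : ℝ :=
  4 * Real.sqrt 2 * vMax P / vMin P * Real.sqrt (lIter + lPhi)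

end Algorithm

end SURF

end

open SURF

/-! The proof separates the optimization problem from the numerical scheme. The interface is
`PathRegular`: the Pareto front is a planar curve with Lipschitz velocity, speed in `[c, V]` and
chords of length at least `c * (b - a)`; the path `xstar` is Lipschitz; the objectives are Lipschitz
near it.

Geometry (`RegularProblem.exists_pathRegular`). The KKT operator, the Lagrangian Hessian bordered by
the active constraint gradients, is injective along the path: strong convexity makes the Hessian
positive definite on the tangent space, and LICQ handles the multipliers. Being continuous in `w`,
the operators are bounded below uniformly on `[0,1]`. This bound makes the multipliers Lipschitz,
identifies the derivative of the path as the solution of the linearized KKT system, and makes that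
derivative Lipschitz (`SaddlePath.exists_deriv`). Pairing the system with `x'` shows that `f 1 - f
0` grows along the path at rate `H x' x'`. This vanishes only if `x' = 0`, and then the difference
of the objective gradients is a combination of active constraint gradients, which the trade-off
assumption excludes. By compactness the rate has a positive minimum, which bounds both speed and
chords from below.

Numerics. PCHIP slopes lie in `[0, 3δ]` for each adjacent secant `δ`, so the interpolant is strictly
increasing on every mesh (`strictMonoOn_pchip`). With mesh widths of order `1/N` and data error `ε`,
the secants differ from the speed by at most `ρ`, of order `1/N + N ε`, and the derivative of the
interpolant by at most `5ρ` (`RegularCurve.rebuild_fine`). For small `ρ` the rebuilt CDF has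
difference quotients in a fixed interval `[m, M]`, so the mesh condition reproduces itself from one
iterate to the next. The Lipschitz constant of its derivative is of order `N ρ`, hence `1 + N² ε`.
Its error is of order `1/N² + N ε`, because arc length minus chord is cubic in the step. For small
`N` with an exact solver, `RegularCurve.rebuild_coarse` gives a cruder constant that grows with `N`.

Contraction. With CDF error `E` and inner error `e`, one outer step gives at most `α R + (1 - α) E`
and `η (e + Lx |Δw|)`, where `R ≤ b + (C/2) e` bounds the rebuilding error and `Δw`, the movement of
the weights, is of order `α (R + E)`. If `C` is proportional to `N` and `N η` is small, then `E + C
e` contracts by `1 - α/4` up to a multiple of `α b` (`coupled_contraction`,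
`PathRegular.combinedError_le`). -/

namespace SURF

/-! ### Knot sequences on `[0,1]`. -/

/-- `w 0 = 0 < w 1 < ⋯ < w N = 1`. -/
structure IsKnots (N : ℕ) (w : ℕ → ℝ) : Prop where
  pos : 1 ≤ N
  zero : w 0 = 0
  one : w N = 1
  lt : ∀ n < N, w n < w (n + 1)

namespace IsKnots

variable {N : ℕ} {w : ℕ → ℝ}

lemma mono (hw : IsKnots N w) {i j : ℕ} (hij : i ≤ j) (hj : j ≤ N) : w i ≤ w j := by
  induction j, hij using Nat.le_induction with
  | base => exact le_rfl
  | succ k hk ih => exact (ih (by omega)).trans (hw.lt k (by omega)).le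

lemma mem_Icc (hw : IsKnots N w) {n : ℕ} (hn : n ≤ N) : w n ∈ Icc (0 : ℝ) 1 :=
  ⟨hw.zero ▸ hw.mono (Nat.zero_le n) hn, hw.one ▸ hw.mono hn le_rfl⟩

lemma mesh_pos (hw : IsKnots N w) {n : ℕ} (hn : n < N) : 0 < mesh w n :=
  sub_pos.2 (hw.lt n hn)

lemma pieceIndex_eq (hw : IsKnots N w) {n : ℕ} (hn : n < N) {x : ℝ} (h1 : w n ≤ x)
    (h2 : x < w (n + 1) ∨ n + 1 = N) : pieceIndex N w x = n := by
  have : (Finset.Ico 1 N).filter (fun k => w k ≤ x) = Finset.Ico 1 (n + 1) := by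
    ext k
    simp only [Finset.mem_filter, Finset.mem_Ico]
    constructor
    · rintro ⟨⟨hk1, hk2⟩, hk⟩
      refine ⟨hk1, ?_⟩
      rcases h2 with h2 | h2
      · by_contra hcon
        exact absurd (h2.trans_le ((hw.mono (by omega) hk2.le).trans hk)) (lt_irrefl _)
      · omega
    · rintro ⟨hk1, hk2⟩
      exact ⟨⟨hk1, by omega⟩, (hw.mono (by omega) hn.le).trans h1⟩
  rw [pieceIndex, this]; simp

/-- Every point of `[0,1]` lies on a piece; the pieces are found from left to right. -/
lemma exists_piece (hw : IsKnots N w) {x : ℝ} (hx : x ∈ Icc (0 : ℝ) 1) :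
    ∃ n < N, x ∈ Icc (w n) (w (n + 1)) := by
  have key : ∀ k ≤ N, x ≤ w k → 1 ≤ k → ∃ n < N, x ∈ Icc (w n) (w (n + 1)) := by
    intro k
    induction k with
    | zero => intro _ _ h; omega
    | succ k ih =>
      intro hk hxk _
      by_cases h : w k ≤ x
      · exact ⟨k, by omega, h, hxk⟩
      · rcases Nat.eq_zero_or_pos k with rfl | hk0
        · exact absurd (hw.zero ▸ hx.1) h
        · exact ih (by omega) (not_le.1 h).le hk0
  exact key N le_rfl (hw.one ▸ hx.2) hw.pos

end IsKnots

/-! ### From the knot intervals to `[0,1]`. -/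

section Gluing

variable {N : ℕ} {w : ℕ → ℝ}

/-- At a shared knot the two one-sided derivatives are the same number, so they combine to a
derivative on the union. A point outside a closed piece imposes no condition there. -/
lemma hasDerivWithinAt_glue {F F' : ℝ → ℝ} (hw : IsKnots N w)
    (h : ∀ n < N, ∀ x ∈ Icc (w n) (w (n + 1)),
      HasDerivWithinAt F (F' x) (Icc (w n) (w (n + 1))) x) :
    ∀ x ∈ Icc (0 : ℝ) 1, HasDerivWithinAt F (F' x) (Icc 0 1) x := by
  have key : ∀ k ≤ N, 1 ≤ k →
      ∀ x ∈ Icc (w 0) (w k), HasDerivWithinAt F (F' x) (Icc (w 0) (w k)) x := by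
    intro k
    induction k with
    | zero => intro _ h; omega
    | succ k ih =>
      intro hk _
      rcases Nat.eq_zero_or_pos k with rfl | hk0
      · exact h 0 (by omega)
      intro x hx
      have h0k : w 0 ≤ w k := hw.mono (Nat.zero_le _) (by omega)
      have hkk : w k ≤ w (k + 1) := (hw.lt k (by omega)).le
      rw [← Icc_union_Icc_eq_Icc h0k hkk]
      refine HasDerivWithinAt.union ?_ ?_
      · by_cases hx' : x ∈ Icc (w 0) (w k)
        · exact ih (by omega) hk0 x hx'
        · exact HasFDerivWithinAt.of_notMem_closure (by rwa [isClosed_Icc.closure_eq])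
      · by_cases hx' : x ∈ Icc (w k) (w (k + 1))
        · exact h k (by omega) x hx'
        · exact HasFDerivWithinAt.of_notMem_closure (by rwa [isClosed_Icc.closure_eq])
  have := key N le_rfl hw.pos
  rwa [hw.zero, hw.one] at this

/-- An estimate `G a b` on ordered pairs that is transitive holds on `[0,1]` when it holds on the
pieces. -/
lemma glue_of_trans {G : ℝ → ℝ → Prop} (hw : IsKnots N w)
    (htrans : ∀ a b c, a ≤ b → b ≤ c → G a b → G b c → G a c)
    (h : ∀ n < N, ∀ a ∈ Icc (w n) (w (n + 1)), ∀ b ∈ Icc (w n) (w (n + 1)), a ≤ b → G a b) :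
    ∀ a ∈ Icc (0 : ℝ) 1, ∀ b ∈ Icc (0 : ℝ) 1, a ≤ b → G a b := by
  have key : ∀ k ≤ N, 1 ≤ k →
      ∀ a ∈ Icc (w 0) (w k), ∀ b ∈ Icc (w 0) (w k), a ≤ b → G a b := by
    intro k
    induction k with
    | zero => intro _ h; omega
    | succ k ih =>
      intro hk _
      rcases Nat.eq_zero_or_pos k with rfl | hk0
      · exact h 0 (by omega)
      intro a ha b hb hab
      have h0k : w 0 ≤ w k := hw.mono (Nat.zero_le _) (by omega)
      have hkk : w k ≤ w (k + 1) := (hw.lt k (by omega)).le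
      rcases le_total b (w k) with hbk | hbk
      · exact ih (by omega) hk0 a ⟨ha.1, hab.trans hbk⟩ b ⟨hb.1, hbk⟩ hab
      rcases le_total a (w k) with hak | hak
      · exact htrans a (w k) b hak hbk (ih (by omega) hk0 a ⟨ha.1, hak⟩ _ ⟨h0k, le_rfl⟩ hak)
          (h k (by omega) _ ⟨le_rfl, hkk⟩ b ⟨hbk, hb.2⟩ hbk)
      · exact h k (by omega) a ⟨hak, ha.2⟩ b ⟨hbk, hb.2⟩ hab
  have := key N le_rfl hw.pos
  rwa [hw.zero, hw.one] at this

end Gluing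

/-! ### One cubic Hermite piece. -/

section Hermite

/-- The derivative of the cubic Hermite piece. -/
noncomputable def hermiteSlope (N : ℕ) (w y : ℕ → ℝ) (n : ℕ) (x : ℝ) : ℝ :=
  let θ := (x - w n) / mesh w n
  6 * θ * (1 - θ) * secant w y n + (1 - θ) * (1 - 3 * θ) * pchipSlope N w y n
    + θ * (3 * θ - 2) * pchipSlope N w y (n + 1)

/-- The derivative of the PCHIP interpolant. -/
noncomputable def pchipDeriv (N : ℕ) (w y : ℕ → ℝ) (x : ℝ) : ℝ :=
  hermiteSlope N w y (pieceIndex N w x) x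

variable {N : ℕ} {w y : ℕ → ℝ} {n : ℕ}

lemma hasDerivAt_hermitePiece (h : mesh w n ≠ 0) (x : ℝ) :
    HasDerivAt (hermitePiece N w y n) (hermiteSlope N w y n x) x := by
  have hθ : HasDerivAt (fun x => (x - w n) / mesh w n) (1 / mesh w n) x :=
    ((hasDerivAt_id x).sub_const _).div_const _
  have h1 := ((((hθ.pow 3).const_mul 2).sub ((hθ.pow 2).const_mul 3)).add_const 1).mul_const (y n)
  have h2 := ((((hθ.pow 3).sub ((hθ.pow 2).const_mul 2)).add hθ).mul_const (mesh w n)).mul_const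
    (pchipSlope N w y n)
  have h3 := (((hθ.pow 3).const_mul (-2)).add ((hθ.pow 2).const_mul 3)).mul_const (y (n + 1))
  have h4 := (((hθ.pow 3).sub (hθ.pow 2)).mul_const (mesh w n)).mul_const
    (pchipSlope N w y (n + 1))
  have h5 := ((h1.add h2).add h3).add h4
  refine HasDerivAt.congr_deriv (f := hermitePiece N w y n) (h5.congr_of_eventuallyEq ?_) ?_
  · exact Eventually.of_forall fun x => rfl
  · simp only [hermiteSlope, secant]
    generalize (x - w n) / mesh w n = θ
    field_simp
    ring

lemma hermitePiece_left : hermitePiece N w y n (w n) = y n := by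
  simp [hermitePiece]

lemma hermitePiece_right (h : mesh w n ≠ 0) : hermitePiece N w y n (w (n + 1)) = y (n + 1) := by
  have : (w (n + 1) - w n) / mesh w n = 1 := div_self h
  simp only [hermitePiece, this]; ring

lemma hermiteSlope_left :
    hermiteSlope N w y n (w n) = pchipSlope N w y n := by
  simp [hermiteSlope]

lemma hermiteSlope_right (h : mesh w n ≠ 0) :
    hermiteSlope N w y n (w (n + 1)) = pchipSlope N w y (n + 1) := by
  have : (w (n + 1) - w n) / mesh w n = 1 := div_self h
  simp only [hermiteSlope, this]; ring

lemma param_mem (h : 0 < mesh w n) {x : ℝ} (hx : x ∈ Icc (w n) (w (n + 1))) :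
    (x - w n) / mesh w n ∈ Icc (0 : ℝ) 1 :=
  ⟨div_nonneg (sub_nonneg.2 hx.1) h.le, (div_le_one h).2 (by simp only [mesh]; linarith [hx.2])⟩

/-- The three coefficients of the derivative sum to one, so the secant cancels. What remains is a
combination of the two end-slope deviations with coefficients in `[-1, 1]`. -/
lemma abs_hermiteSlope_sub_secant_le (h : 0 < mesh w n) {x : ℝ}
    (hx : x ∈ Icc (w n) (w (n + 1))) :
    |hermiteSlope N w y n x - secant w y n| ≤
      |pchipSlope N w y n - secant w y n| + |pchipSlope N w y (n + 1) - secant w y n| := by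
  obtain ⟨h0, h1⟩ := param_mem h hx
  simp only [hermiteSlope]
  generalize (x - w n) / mesh w n = θ at h0 h1 ⊢
  have e : 6 * θ * (1 - θ) * secant w y n + (1 - θ) * (1 - 3 * θ) * pchipSlope N w y n
      + θ * (3 * θ - 2) * pchipSlope N w y (n + 1) - secant w y n
      = (1 - θ) * (1 - 3 * θ) * (pchipSlope N w y n - secant w y n)
        + θ * (3 * θ - 2) * (pchipSlope N w y (n + 1) - secant w y n) := by ring
  rw [e]
  refine (abs_add_le _ _).trans (add_le_add ?_ ?_)
  · rw [abs_mul]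
    refine mul_le_of_le_one_left (abs_nonneg _) (abs_le.2 ⟨?_, ?_⟩) <;> nlinarith
  · rw [abs_mul]
    refine mul_le_of_le_one_left (abs_nonneg _) (abs_le.2 ⟨?_, ?_⟩) <;> nlinarith

/-- The derivative is quadratic in the local parameter. Factoring out `θ - τ` leaves coefficients of
size at most 4 on the end-slope deviations; the mesh width enters when `θ` is expressed through `x`.
-/
lemma abs_hermiteSlope_sub_le (h : 0 < mesh w n) {a b : ℝ}
    (ha : a ∈ Icc (w n) (w (n + 1))) (hb : b ∈ Icc (w n) (w (n + 1))) :
    |hermiteSlope N w y n a - hermiteSlope N w y n b| ≤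
      4 * (|pchipSlope N w y n - secant w y n| + |pchipSlope N w y (n + 1) - secant w y n|)
        / mesh w n * |a - b| := by
  obtain ⟨ha0, ha1⟩ := param_mem h ha
  obtain ⟨hb0, hb1⟩ := param_mem h hb
  have hab : a - b = ((a - w n) / mesh w n - (b - w n) / mesh w n) * mesh w n := by
    field_simp; ring
  simp only [hermiteSlope]
  rw [hab, abs_mul, abs_of_pos h]
  generalize (a - w n) / mesh w n = θ at ha0 ha1 ⊢
  generalize (b - w n) / mesh w n = τ at hb0 hb1 ⊢
  generalize hd₀ : pchipSlope N w y n - secant w y n = d₀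
  generalize hd₁ : pchipSlope N w y (n + 1) - secant w y n = d₁
  have e : 6 * θ * (1 - θ) * secant w y n + (1 - θ) * (1 - 3 * θ) * pchipSlope N w y n
      + θ * (3 * θ - 2) * pchipSlope N w y (n + 1)
      - (6 * τ * (1 - τ) * secant w y n + (1 - τ) * (1 - 3 * τ) * pchipSlope N w y n
      + τ * (3 * τ - 2) * pchipSlope N w y (n + 1))
      = ((3 * (θ + τ) - 4) * d₀ + (3 * (θ + τ) - 2) * d₁) * (θ - τ) := by
    rw [← hd₀, ← hd₁]; ring
  have e2 : 4 * (|d₀| + |d₁|) / mesh w n * (|θ - τ| * mesh w n) = 4 * (|d₀| + |d₁|) * |θ - τ| := by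
    field_simp
  rw [e, e2, abs_mul]
  refine mul_le_mul_of_nonneg_right ((abs_add_le _ _).trans ?_) (abs_nonneg _)
  rw [abs_mul, abs_mul, mul_add (4 : ℝ)]
  refine add_le_add ?_ ?_ <;> refine mul_le_mul_of_nonneg_right (abs_le.2 ⟨?_, ?_⟩) (abs_nonneg _)
    <;> linarith

/-- The derivative is affine in each end slope, so it suffices to look at slopes `0` and `3δ`. The
four corner values `6θ(1-θ)δ`, `3(1-θ)²δ`, `3θ²δ`, `3(2θ-1)²δ` all lie in `[0, 3δ]`. -/
lemma hermiteSlope_nonneg_le (h : 0 < mesh w n) {x : ℝ} (hx : x ∈ Icc (w n) (w (n + 1)))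
    (hδ : 0 < secant w y n)
    (h₀ : pchipSlope N w y n ∈ Icc 0 (3 * secant w y n))
    (h₁ : pchipSlope N w y (n + 1) ∈ Icc 0 (3 * secant w y n)) :
    hermiteSlope N w y n x ∈ Icc 0 (3 * secant w y n) := by
  obtain ⟨h0, h1⟩ := param_mem h hx
  simp only [hermiteSlope]
  generalize (x - w n) / mesh w n = θ at h0 h1 ⊢
  generalize secant w y n = δ at hδ h₀ h₁ ⊢
  obtain ⟨a0, a1⟩ := h₀
  obtain ⟨b0, b1⟩ := h₁
  generalize pchipSlope N w y n = a at a0 a1 ⊢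
  generalize pchipSlope N w y (n + 1) = b at b0 b1 ⊢
  -- bilinear interpolation between the four extreme slope pairs
  have e : 9 * δ ^ 2 * (6 * θ * (1 - θ) * δ + (1 - θ) * (1 - 3 * θ) * a + θ * (3 * θ - 2) * b)
      = δ * ((3 * δ - a) * (3 * δ - b) * (6 * θ * (1 - θ)) + a * (3 * δ - b) * (3 * (1 - θ) ^ 2)
        + (3 * δ - a) * b * (3 * θ ^ 2) + a * b * (3 * (2 * θ - 1) ^ 2)) := by ring
  have e' : 9 * δ ^ 2 * (3 * δ - (6 * θ * (1 - θ) * δ + (1 - θ) * (1 - 3 * θ) * a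
        + θ * (3 * θ - 2) * b))
      = δ * ((3 * δ - a) * (3 * δ - b) * (3 - 6 * θ * (1 - θ))
        + a * (3 * δ - b) * (3 * (1 - (1 - θ) ^ 2))
        + (3 * δ - a) * b * (3 * (1 - θ ^ 2)) + a * b * (3 * (1 - (2 * θ - 1) ^ 2))) := by ring
  have hp : 0 < 9 * δ ^ 2 := by positivity
  constructor
  · refine nonneg_of_mul_nonneg_right (a := 9 * δ ^ 2) ?_ hp
    rw [e]; positivity
  · refine le_of_sub_nonneg (α := ℝ) (nonneg_of_mul_nonneg_right (a := 9 * δ ^ 2) ?_ hp)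
    rw [e']
    have t1 : 0 ≤ 3 - 6 * θ * (1 - θ) := by nlinarith [sq_nonneg (2 * θ - 1)]
    have t2 : 0 ≤ 1 - (1 - θ) ^ 2 := by nlinarith
    have t3 : 0 ≤ 1 - θ ^ 2 := by nlinarith
    have t4 : 0 ≤ 1 - (2 * θ - 1) ^ 2 := by nlinarith
    positivity

/-- The derivative may vanish, as it does at the midpoint when both end slopes are `3δ`, so
strictness is not read off its sign. Instead the divided difference is expanded bilinearly in the
end slopes; its four corner values are strictly positive for `s < t`. -/
lemma hermitePiece_lt (h : 0 < mesh w n) {x x' : ℝ} (hx : x ∈ Icc (w n) (w (n + 1)))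
    (hx' : x' ∈ Icc (w n) (w (n + 1))) (hlt : x < x') (hδ : 0 < secant w y n)
    (h₀ : pchipSlope N w y n ∈ Icc 0 (3 * secant w y n))
    (h₁ : pchipSlope N w y (n + 1) ∈ Icc 0 (3 * secant w y n)) :
    hermitePiece N w y n x < hermitePiece N w y n x' := by
  obtain ⟨s0, s1⟩ := param_mem h hx
  obtain ⟨t0, t1⟩ := param_mem h hx'
  have hst : (x - w n) / mesh w n < (x' - w n) / mesh w n := by gcongr
  have hy : y (n + 1) = y n + secant w y n * mesh w n := by
    simp only [secant]; field_simp; ring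
  simp only [hermitePiece, hy]
  generalize (x - w n) / mesh w n = s at s0 s1 hst ⊢
  generalize (x' - w n) / mesh w n = t at t0 t1 hst ⊢
  generalize secant w y n = δ at hδ h₀ h₁ ⊢
  obtain ⟨a0, a1⟩ := h₀
  obtain ⟨b0, b1⟩ := h₁
  generalize pchipSlope N w y n = a at a0 a1 ⊢
  generalize pchipSlope N w y (n + 1) = b at b0 b1 ⊢
  have hA : 0 ≤ 3 * δ - a := by linarith
  have hB : 0 ≤ 3 * δ - b := by linarith
  have c00 : 0 < 3 * (s + t) - 2 * (s ^ 2 + s * t + t ^ 2) := by nlinarith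
  have c10 : 0 < 3 - 3 * (s + t) + (s ^ 2 + s * t + t ^ 2) := by
    nlinarith [mul_nonneg (sub_nonneg.2 s1) (sub_nonneg.2 t1), sq_nonneg (1 - t)]
  have c01 : 0 < s ^ 2 + s * t + t ^ 2 := by nlinarith
  have c11 : 0 < 3 - 6 * (s + t) + 4 * (s ^ 2 + s * t + t ^ 2) := by
    nlinarith [sq_nonneg (s + t - 1), mul_pos (sub_pos.2 hst) (sub_pos.2 hst)]
  have key : 0 < (3 * δ - a) * (3 * δ - b) * (3 * (s + t) - 2 * (s ^ 2 + s * t + t ^ 2))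
      + a * (3 * δ - b) * (3 - 3 * (s + t) + (s ^ 2 + s * t + t ^ 2))
      + (3 * δ - a) * b * (s ^ 2 + s * t + t ^ 2)
      + a * b * (3 - 6 * (s + t) + 4 * (s ^ 2 + s * t + t ^ 2)) := by
    -- Some bilinear weight must be positive: if `a = 3δ` then `a > 0`, and likewise for `b`.
    rcases hA.eq_or_lt with hA' | hA' <;> rcases hB.eq_or_lt with hB' | hB'
    · have : 0 < a := by linarith
      have : 0 < b := by linarith
      rw [← hA', ← hB']; simp only [zero_mul, mul_zero, zero_add]; positivity
    · have : 0 < a := by linarith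
      have : 0 < a * (3 * δ - b) * (3 - 3 * (s + t) + (s ^ 2 + s * t + t ^ 2)) := by positivity
      have : 0 ≤ a * b * (3 - 6 * (s + t) + 4 * (s ^ 2 + s * t + t ^ 2)) := by positivity
      rw [← hA']; simp only [zero_mul, zero_add, add_zero]; linarith
    · have : 0 < b := by linarith
      have : 0 < (3 * δ - a) * b * (s ^ 2 + s * t + t ^ 2) := by positivity
      have : 0 ≤ a * b * (3 - 6 * (s + t) + 4 * (s ^ 2 + s * t + t ^ 2)) := by positivity
      rw [← hB']; simp only [zero_mul, mul_zero, zero_add, add_zero]; linarith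
    · positivity
  have e : ((2 * t ^ 3 - 3 * t ^ 2 + 1) * y n + (t ^ 3 - 2 * t ^ 2 + t) * mesh w n * a
      + (-2 * t ^ 3 + 3 * t ^ 2) * (y n + δ * mesh w n) + (t ^ 3 - t ^ 2) * mesh w n * b)
      - ((2 * s ^ 3 - 3 * s ^ 2 + 1) * y n + (s ^ 3 - 2 * s ^ 2 + s) * mesh w n * a
      + (-2 * s ^ 3 + 3 * s ^ 2) * (y n + δ * mesh w n) + (s ^ 3 - s ^ 2) * mesh w n * b)
      = mesh w n * (t - s) / (9 * δ) *
      ((3 * δ - a) * (3 * δ - b) * (3 * (s + t) - 2 * (s ^ 2 + s * t + t ^ 2))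
      + a * (3 * δ - b) * (3 - 3 * (s + t) + (s ^ 2 + s * t + t ^ 2))
      + (3 * δ - a) * b * (s ^ 2 + s * t + t ^ 2)
      + a * b * (3 - 6 * (s + t) + 4 * (s ^ 2 + s * t + t ^ 2))) := by
    field_simp; ring
  rw [← sub_pos, e]
  have : 0 < t - s := sub_pos.2 hst
  positivity

end Hermite

/-! ### PCHIP: differentiability, monotonicity, closeness of slopes to secants. -/

section Pchip

variable {N : ℕ} {w y : ℕ → ℝ}

/-- `pieceIndex` assigns an interior knot to the piece on its right. Value and slope of the left
piece agree there, so each formula is valid on its whole closed interval. -/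
lemma pchip_eq_on_piece (hw : IsKnots N w) {n : ℕ} (hn : n < N) {x : ℝ}
    (hx : x ∈ Icc (w n) (w (n + 1))) :
    pchip N w y x = hermitePiece N w y n x ∧ pchipDeriv N w y x = hermiteSlope N w y n x := by
  by_cases h : x < w (n + 1) ∨ n + 1 = N
  · simp only [pchip, pchipDeriv, hw.pieceIndex_eq hn hx.1 h, and_self]
  · push Not at h
    have hx' : x = w (n + 1) := le_antisymm hx.2 h.1
    have hn1 : n + 1 < N := by omega
    have hi : pieceIndex N w x = n + 1 :=
      hw.pieceIndex_eq hn1 h.1 (Or.inl (hx' ▸ hw.lt _ hn1))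
    simp only [pchip, pchipDeriv, hi]
    rw [hx', hermitePiece_left, hermitePiece_right (hw.mesh_pos hn).ne',
      hermiteSlope_left, hermiteSlope_right (hw.mesh_pos hn).ne']
    exact ⟨rfl, rfl⟩

lemma pchip_knot (hw : IsKnots N w) {n : ℕ} (hn : n ≤ N) : pchip N w y (w n) = y n := by
  rcases hn.eq_or_lt with rfl | hn
  · obtain ⟨k, rfl⟩ : ∃ k, n = k + 1 := ⟨n - 1, by have := hw.pos; omega⟩
    rw [(pchip_eq_on_piece hw (Nat.lt_succ_self k) ⟨(hw.lt k (by omega)).le, le_rfl⟩).1,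
      hermitePiece_right (hw.mesh_pos (by omega)).ne']
  · rw [(pchip_eq_on_piece hw hn ⟨le_rfl, (hw.lt n hn).le⟩).1,
      hermitePiece_left]

lemma hasDerivWithinAt_pchip (hw : IsKnots N w) :
    ∀ x ∈ Icc (0 : ℝ) 1, HasDerivWithinAt (pchip N w y) (pchipDeriv N w y x) (Icc 0 1) x := by
  refine hasDerivWithinAt_glue hw fun n hn x hx => ?_
  rw [(pchip_eq_on_piece hw hn hx).2]
  exact ((hasDerivAt_hermitePiece (hw.mesh_pos hn).ne' x).hasDerivWithinAt).congr
    (fun z hz => (pchip_eq_on_piece hw hn hz).1) (pchip_eq_on_piece hw hn hx).1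

lemma abs_pchipDeriv_sub_le (hw : IsKnots N w) {l : ℝ}
    (h : ∀ n < N, 4 * (|pchipSlope N w y n - secant w y n|
      + |pchipSlope N w y (n + 1) - secant w y n|) / mesh w n ≤ l) :
    ∀ a ∈ Icc (0 : ℝ) 1, ∀ b ∈ Icc (0 : ℝ) 1,
      |pchipDeriv N w y a - pchipDeriv N w y b| ≤ l * |a - b| := by
  have key := glue_of_trans (G := fun a b => |pchipDeriv N w y a - pchipDeriv N w y b| ≤ l * |a - b|)
    hw ?_ ?_
  · intro a ha b hb
    rcases le_total a b with hab | hab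
    · exact key a ha b hb hab
    · rw [abs_sub_comm, abs_sub_comm a b]; exact key b hb a ha hab
  · intro a b c hab hbc h1 h2
    have : |a - c| = |a - b| + |b - c| := by
      rw [abs_sub_comm a c, abs_sub_comm a b, abs_sub_comm b c, abs_of_nonneg (by linarith),
        abs_of_nonneg (by linarith), abs_of_nonneg (by linarith)]; ring
    show |pchipDeriv N w y a - pchipDeriv N w y c| ≤ l * |a - c|
    rw [this, mul_add]
    exact (abs_sub_le _ _ _).trans (add_le_add h1 h2)
  · intro n hn a ha b hb _
    show |pchipDeriv N w y a - pchipDeriv N w y b| ≤ l * |a - b|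
    rw [(pchip_eq_on_piece hw hn ha).2, (pchip_eq_on_piece hw hn hb).2]
    exact (abs_hermiteSlope_sub_le (hw.mesh_pos hn) ha hb).trans
      (mul_le_mul_of_nonneg_right (h n hn) (abs_nonneg _))

lemma endSlope_mem {h₀ h₁ δ₀ δ₁ : ℝ} (hδ : 0 < δ₀) : endSlope h₀ h₁ δ₀ δ₁ ∈ Icc 0 (3 * δ₀) := by
  simp only [endSlope]
  generalize ((2 * h₀ + h₁) * δ₀ - h₀ * δ₁) / (h₀ + h₁) = m
  split_ifs with h1 h2
  · exact ⟨le_rfl, by linarith⟩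
  · exact ⟨by linarith, le_rfl⟩
  · push Not at h1 h2
    have hm : 0 < m := pos_of_mul_pos_left h1 hδ.le
    rw [abs_of_pos hδ, abs_of_pos hm] at h2
    exact ⟨hm.le, h2⟩

/-- The unclipped slope is `δ₀ + λ (δ₀ - δ₁)` with `0 < λ < 1`. Since `ε ≤ δ₀`, it is at most `2
δ₀`, so the clip at `3 δ₀` never acts; the clip to `0` acts only when `δ₀ ≤ ε`. -/
lemma abs_endSlope_sub_le {h₀ h₁ δ₀ δ₁ ε : ℝ} (hh₀ : 0 < h₀) (hh₁ : 0 < h₁) (hδ : 0 < δ₀)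
    (hε : |δ₀ - δ₁| ≤ ε) (hεδ : ε ≤ δ₀) : |endSlope h₀ h₁ δ₀ δ₁ - δ₀| ≤ ε := by
  have hm : ((2 * h₀ + h₁) * δ₀ - h₀ * δ₁) / (h₀ + h₁) = δ₀ + h₀ / (h₀ + h₁) * (δ₀ - δ₁) := by
    field_simp; ring
  have hr0 : 0 < h₀ / (h₀ + h₁) := by positivity
  have hr1 : h₀ / (h₀ + h₁) < 1 := (div_lt_one (by positivity)).2 (by linarith)
  have habs : |h₀ / (h₀ + h₁) * (δ₀ - δ₁)| ≤ ε := by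
    rw [abs_mul, abs_of_pos hr0]; nlinarith [abs_nonneg (δ₀ - δ₁)]
  simp only [endSlope, hm]
  generalize h₀ / (h₀ + h₁) * (δ₀ - δ₁) = r at habs
  have hr := abs_le.1 habs
  split_ifs with h1 h2
  · have h3 : δ₀ + r ≤ 0 := by
      by_contra hc; push Not at hc; exact absurd (mul_pos hc hδ) (not_lt.2 h1)
    rw [zero_sub, abs_neg, abs_of_pos hδ]; linarith
  · rw [abs_of_pos hδ, abs_of_nonneg (by linarith)] at h2; linarith
  · rwa [add_sub_cancel_left]

/-- The last two bounds drop one term of the denominator. For the PCHIP weights, `p + q` is three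
times the sum of two mesh widths and `p`, `q` are each at least that sum, which gives the factor 3
of the monotonicity region. -/
lemma harmonic_bounds {a b p q : ℝ} (ha : 0 < a) (hb : 0 < b) (hp : 0 < p) (hq : 0 < q) :
    min a b ≤ (p + q) / (p / a + q / b) ∧ (p + q) / (p / a + q / b) ≤ max a b ∧
    (p + q) / (p / a + q / b) ≤ (p + q) / p * a ∧ (p + q) / (p / a + q / b) ≤ (p + q) / q * b := by
  have hd : 0 < p / a + q / b := by positivity
  refine ⟨?_, ?_, ?_, ?_⟩
  · rw [le_div_iff₀ hd, mul_add]
    have h1 : min a b * (p / a) ≤ a * (p / a) := by gcongr; exact min_le_left _ _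
    have h2 : min a b * (q / b) ≤ b * (q / b) := by gcongr; exact min_le_right _ _
    rw [mul_div_cancel₀ _ ha.ne'] at h1
    rw [mul_div_cancel₀ _ hb.ne'] at h2
    linarith
  · rw [div_le_iff₀ hd, mul_add]
    have h1 : a * (p / a) ≤ max a b * (p / a) := by gcongr; exact le_max_left _ _
    have h2 : b * (q / b) ≤ max a b * (q / b) := by gcongr; exact le_max_right _ _
    rw [mul_div_cancel₀ _ ha.ne'] at h1
    rw [mul_div_cancel₀ _ hb.ne'] at h2
    linarith
  · rw [div_le_iff₀ hd]
    have : (p + q) / p * a * (p / a + q / b) = (p + q) + (p + q) / p * a * (q / b) := by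
      field_simp
    rw [this]
    have : 0 < (p + q) / p * a * (q / b) := by positivity
    linarith
  · rw [div_le_iff₀ hd]
    have : (p + q) / q * b * (p / a + q / b) = (p + q) / q * b * (p / a) + (p + q) := by
      field_simp
    rw [this]
    have : 0 < (p + q) / q * b * (p / a) := by positivity
    linarith

/-- PCHIP slopes are in the monotonicity region of both adjacent secants. -/
lemma pchipSlope_mem (hw : IsKnots N w) (hδ : ∀ n < N, 0 < secant w y n) {n : ℕ} (hn : n < N) :
    pchipSlope N w y n ∈ Icc 0 (3 * secant w y n) ∧
    pchipSlope N w y (n + 1) ∈ Icc 0 (3 * secant w y n) := by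
  by_cases hN : N = 1
  · have : n = 0 := by omega
    subst this
    have := hδ 0 hn
    simp only [pchipSlope, hN, if_true]
    exact ⟨⟨this.le, by linarith⟩, ⟨this.le, by linarith⟩⟩
  have inner : ∀ k, k + 1 < N →
      0 ≤ pchipSlope N w y (k + 1) ∧ pchipSlope N w y (k + 1) ≤ 3 * secant w y k ∧
      pchipSlope N w y (k + 1) ≤ 3 * secant w y (k + 1) := by
    intro k hk
    have ha := hδ k (by omega)
    have hb := hδ (k + 1) hk
    have hm := hw.mesh_pos (n := k) (by omega)
    have hm' := hw.mesh_pos hk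
    have hab : ¬ secant w y k * secant w y (k + 1) ≤ 0 := not_le.2 (mul_pos ha hb)
    simp only [pchipSlope, hN, if_false, Nat.succ_ne_zero, hk.ne, Nat.add_sub_cancel, hab]
    have hp : 0 < 2 * mesh w (k + 1) + mesh w k := by positivity
    have hq : 0 < mesh w (k + 1) + 2 * mesh w k := by positivity
    obtain ⟨-, -, h3, h4⟩ := harmonic_bounds ha hb hp hq
    refine ⟨by positivity, h3.trans ?_, h4.trans ?_⟩
    · refine mul_le_mul_of_nonneg_right ?_ ha.le
      rw [div_le_iff₀ hp]; linarith
    · refine mul_le_mul_of_nonneg_right ?_ hb.le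
      rw [div_le_iff₀ hq]; linarith
  constructor
  · rcases Nat.eq_zero_or_pos n with rfl | h0
    · simp only [pchipSlope, hN, if_false, if_true]
      exact endSlope_mem (hδ 0 hn)
    · obtain ⟨k, rfl⟩ : ∃ k, n = k + 1 := ⟨n - 1, by omega⟩
      exact ⟨(inner k hn).1, (inner k hn).2.2⟩
  · rcases (Nat.succ_le_of_lt hn).eq_or_lt with h | h
    · have h' : n + 1 = N := h
      have hn' : n = N - 1 := by omega
      simp only [pchipSlope, hN, if_false, h', if_true, show N ≠ 0 by omega]
      rw [hn']
      exact endSlope_mem (hδ _ (by omega))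
    · exact ⟨(inner n h).1, (inner n h).2.1⟩

/-- PCHIP slopes are close to the adjacent secants if neighbouring secants are close. -/
lemma abs_pchipSlope_sub_le (hw : IsKnots N w) (hδ : ∀ n < N, 0 < secant w y n) {ε : ℝ}
    (hε0 : 0 ≤ ε) (hεδ : ∀ n < N, ε ≤ secant w y n)
    (hε : ∀ n, n + 1 < N → |secant w y n - secant w y (n + 1)| ≤ ε) {n : ℕ} (hn : n < N) :
    |pchipSlope N w y n - secant w y n| ≤ ε ∧ |pchipSlope N w y (n + 1) - secant w y n| ≤ ε := by
  by_cases hN : N = 1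
  · have : n = 0 := by omega
    subst this
    simp [pchipSlope, hN, hε0]
  have inner : ∀ k, k + 1 < N → |pchipSlope N w y (k + 1) - secant w y k| ≤ ε ∧
      |pchipSlope N w y (k + 1) - secant w y (k + 1)| ≤ ε := by
    intro k hk
    have ha := hδ k (by omega)
    have hb := hδ (k + 1) hk
    have hm := hw.mesh_pos (n := k) (by omega)
    have hm' := hw.mesh_pos hk
    have hab : ¬ secant w y k * secant w y (k + 1) ≤ 0 := not_le.2 (mul_pos ha hb)
    simp only [pchipSlope, hN, if_false, Nat.succ_ne_zero, hk.ne, Nat.add_sub_cancel, hab]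
    have hp : 0 < 2 * mesh w (k + 1) + mesh w k := by positivity
    have hq : 0 < mesh w (k + 1) + 2 * mesh w k := by positivity
    obtain ⟨h1, h2, -, -⟩ := harmonic_bounds ha hb hp hq
    have hd := abs_le.1 (hε k hk)
    constructor
    · refine abs_le.2 ⟨?_, ?_⟩
      · rcases min_choice (secant w y k) (secant w y (k + 1)) with h | h <;> rw [h] at h1 <;> linarith
      · rcases max_choice (secant w y k) (secant w y (k + 1)) with h | h <;> rw [h] at h2 <;> linarith
    · refine abs_le.2 ⟨?_, ?_⟩
      · rcases min_choice (secant w y k) (secant w y (k + 1)) with h | h <;> rw [h] at h1 <;> linarith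
      · rcases max_choice (secant w y k) (secant w y (k + 1)) with h | h <;> rw [h] at h2 <;> linarith
  constructor
  · rcases Nat.eq_zero_or_pos n with rfl | h0
    · simp only [pchipSlope, hN, if_false, if_true]
      exact abs_endSlope_sub_le (hw.mesh_pos (by omega)) (hw.mesh_pos (by omega)) (hδ 0 hn)
        (hε 0 (by omega)) (hεδ 0 hn)
    · obtain ⟨k, rfl⟩ : ∃ k, n = k + 1 := ⟨n - 1, by omega⟩
      exact (inner k hn).2
  · rcases (Nat.succ_le_of_lt hn).eq_or_lt with h | h
    · have h' : n + 1 = N := h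
      simp only [pchipSlope, hN, if_false, h', if_true, show N ≠ 0 by omega]
      obtain ⟨k, rfl⟩ : ∃ k, n = k + 1 := ⟨n - 1, by omega⟩
      have e1 : N - 1 = k + 1 := by omega
      have e2 : N - 2 = k := by omega
      rw [e1, e2]
      exact abs_endSlope_sub_le (hw.mesh_pos (by omega)) (hw.mesh_pos (by omega)) (hδ _ (by omega))
        (by rw [abs_sub_comm]; exact hε k (by omega)) (hεδ _ hn)
    · exact (inner n h).1

lemma strictMonoOn_pchip (hw : IsKnots N w) (hδ : ∀ n < N, 0 < secant w y n) :
    StrictMonoOn (pchip N w y) (Icc 0 1) := by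
  -- The implication form makes the relation trivial on the diagonal, as gluing over pairs `a ≤ b`
  -- requires.
  have key := glue_of_trans (G := fun a b => a < b → pchip N w y a < pchip N w y b) hw ?_ ?_
  · exact fun a ha b hb hab => key a ha b hb hab.le hab
  · intro a b c hab hbc h1 h2 hac
    rcases hab.eq_or_lt with rfl | hab
    · exact h2 hac
    rcases hbc.eq_or_lt with rfl | hbc
    · exact h1 hac
    · exact (h1 hab).trans (h2 hbc)
  · intro n hn a ha b hb _ hab
    rw [(pchip_eq_on_piece hw hn ha).1, (pchip_eq_on_piece hw hn hb).1]
    obtain ⟨h0, h1⟩ := pchipSlope_mem hw hδ hn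
    exact hermitePiece_lt (hw.mesh_pos hn) ha hb hab (hδ n hn) h0 h1

end Pchip

/-! ### Mean value estimates on `[0,1]` with one-sided end derivatives. -/

section MeanValue

variable {f f' : ℝ → ℝ}

lemma le_of_deriv_nonneg (h : ∀ x ∈ Icc (0 : ℝ) 1, HasDerivWithinAt f (f' x) (Icc 0 1) x)
    {a b : ℝ} (ha : a ∈ Icc (0 : ℝ) 1) (hb : b ∈ Icc (0 : ℝ) 1) (hab : a ≤ b)
    (h' : ∀ r ∈ Icc a b, 0 ≤ f' r) : f a ≤ f b := by
  have hsub : Icc a b ⊆ Icc 0 1 := Icc_subset_Icc ha.1 hb.2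
  refine monotoneOn_of_hasDerivWithinAt_nonneg (D := Icc a b) (f' := f') (convex_Icc a b)
    (fun x hx => ((h x (hsub hx)).mono hsub).continuousWithinAt)
    (fun x hx => (h x (hsub (interior_subset hx))).mono (interior_subset.trans hsub))
    (fun x hx => h' x (interior_subset hx)) ⟨le_rfl, hab⟩ ⟨hab, le_rfl⟩ hab

lemma sub_le_of_deriv_le (h : ∀ x ∈ Icc (0 : ℝ) 1, HasDerivWithinAt f (f' x) (Icc 0 1) x)
    {a b C : ℝ} (ha : a ∈ Icc (0 : ℝ) 1) (hb : b ∈ Icc (0 : ℝ) 1) (hab : a ≤ b)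
    (h' : ∀ r ∈ Icc a b, f' r ≤ C) : f b - f a ≤ C * (b - a) := by
  have := le_of_deriv_nonneg (f := fun x => C * x - f x) (f' := fun x => C * 1 - f' x)
    (fun x hx => ((hasDerivWithinAt_id x _).const_mul C).sub (h x hx)) ha hb hab
    (fun r hr => by have := h' r hr; linarith)
  linarith

lemma le_sub_of_le_deriv (h : ∀ x ∈ Icc (0 : ℝ) 1, HasDerivWithinAt f (f' x) (Icc 0 1) x)
    {a b C : ℝ} (ha : a ∈ Icc (0 : ℝ) 1) (hb : b ∈ Icc (0 : ℝ) 1) (hab : a ≤ b)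
    (h' : ∀ r ∈ Icc a b, C ≤ f' r) : C * (b - a) ≤ f b - f a := by
  have := le_of_deriv_nonneg (f := fun x => f x - C * x) (f' := fun x => f' x - C * 1)
    (fun x hx => (h x hx).sub ((hasDerivWithinAt_id x _).const_mul C)) ha hb hab
    (fun r hr => by have := h' r hr; linarith)
  linarith

lemma abs_sub_le_of_abs_deriv_le
    (h : ∀ x ∈ Icc (0 : ℝ) 1, HasDerivWithinAt f (f' x) (Icc 0 1) x)
    {a b C : ℝ} (ha : a ∈ Icc (0 : ℝ) 1) (hb : b ∈ Icc (0 : ℝ) 1) (hab : a ≤ b)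
    (h' : ∀ r ∈ Icc a b, |f' r| ≤ C) : |f b - f a| ≤ C * (b - a) := by
  refine abs_le.2 ⟨?_, sub_le_of_deriv_le h ha hb hab fun r hr => (abs_le.1 (h' r hr)).2⟩
  have := le_sub_of_le_deriv h ha hb hab fun r hr => (abs_le.1 (h' r hr)).1
  linarith

end MeanValue

/-! ### Distribution functions and their convex combinations. -/

section CDF

variable {φ ψ : ℝ → ℝ}

/-- All difference quotients of `φ` on `[0,1]` are in `[m, M]`. -/
def IncrBounds (m M : ℝ) (φ : ℝ → ℝ) : Prop :=
  ∀ a ∈ Icc (0 : ℝ) 1, ∀ b ∈ Icc (0 : ℝ) 1, a ≤ b →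
    m * (b - a) ≤ φ b - φ a ∧ φ b - φ a ≤ M * (b - a)

lemma IsCDF.id : IsCDF (fun w => w) :=
  ⟨continuousOn_id, strictMono_id.strictMonoOn _, rfl, rfl⟩

lemma IncrBounds.id {m M : ℝ} (hm : m ≤ 1) (hM : 1 ≤ M) : IncrBounds m M (fun w => w) :=
  fun a _ b _ hab => ⟨by nlinarith, by nlinarith⟩

lemma IsCDF.mix (hφ : IsCDF φ) (hψ : IsCDF ψ) {α : ℝ} (h0 : 0 < α) (h1 : α ≤ 1) :
    IsCDF (fun x => α * φ x + (1 - α) * ψ x) := by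
  refine ⟨(hφ.1.const_mul α).add (hψ.1.const_mul (1 - α)), ?_, ?_, ?_⟩
  · intro a ha b hb hab
    have e1 := mul_lt_mul_of_pos_left (hφ.2.1 ha hb hab) h0
    have e2 := mul_le_mul_of_nonneg_left (hψ.2.1 ha hb hab).le (sub_nonneg.2 h1)
    simp only; linarith
  · simp [hφ.2.2.1, hψ.2.2.1]
  · simp [hφ.2.2.2, hψ.2.2.2]

lemma IncrBounds.mix {m M : ℝ} (hφ : IncrBounds m M φ) (hψ : IncrBounds m M ψ) {α : ℝ}
    (h0 : 0 < α) (h1 : α ≤ 1) : IncrBounds m M (fun x => α * φ x + (1 - α) * ψ x) := by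
  intro a ha b hb hab
  obtain ⟨p1, p2⟩ := hφ a ha b hb hab
  obtain ⟨q1, q2⟩ := hψ a ha b hb hab
  have h1' : 0 ≤ 1 - α := sub_nonneg.2 h1
  constructor <;> simp only
  · nlinarith [mul_le_mul_of_nonneg_left p1 h0.le, mul_le_mul_of_nonneg_left q1 h1']
  · nlinarith [mul_le_mul_of_nonneg_left p2 h0.le, mul_le_mul_of_nonneg_left q2 h1']

lemma LipschitzSmooth.of_hasDerivWithinAt {φ' : ℝ → ℝ} {l : ℝ}
    (h : ∀ x ∈ Icc (0 : ℝ) 1, HasDerivWithinAt φ (φ' x) (Icc 0 1) x)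
    (hl : ∀ x ∈ Icc (0 : ℝ) 1, ∀ y ∈ Icc (0 : ℝ) 1, |φ' x - φ' y| ≤ l * |x - y|) :
    LipschitzSmooth l φ := by
  refine ⟨fun x hx => (h x hx).differentiableWithinAt, fun x hx y hy => ?_⟩
  have hu := uniqueDiffOn_Icc (zero_lt_one' ℝ)
  rw [(h x hx).derivWithin (hu x hx), (h y hy).derivWithin (hu y hy)]
  exact hl x hx y hy

lemma LipschitzSmooth.id {l : ℝ} (hl : 0 ≤ l) : LipschitzSmooth l (fun w => w) :=
  .of_hasDerivWithinAt (φ' := fun _ => 1) (fun x _ => hasDerivWithinAt_id x _)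
    (fun x _ y _ => by rw [sub_self, abs_zero]; positivity)

lemma LipschitzSmooth.mono {l l' : ℝ} (h : LipschitzSmooth l φ) (hl : l ≤ l') :
    LipschitzSmooth l' φ :=
  ⟨h.1, fun x hx y hy => (h.2 x hx y hy).trans
    (mul_le_mul_of_nonneg_right hl (abs_nonneg _))⟩

lemma LipschitzSmooth.mix {l : ℝ} (hφ : LipschitzSmooth l φ) (hψ : LipschitzSmooth l ψ) {α : ℝ}
    (h0 : 0 < α) (h1 : α ≤ 1) : LipschitzSmooth l (fun x => α * φ x + (1 - α) * ψ x) := by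
  refine .of_hasDerivWithinAt
    (φ' := fun x => α * derivWithin φ (Icc 0 1) x + (1 - α) * derivWithin ψ (Icc 0 1) x)
    (fun x hx => ((hφ.1 x hx).hasDerivWithinAt.const_mul α).add
      ((hψ.1 x hx).hasDerivWithinAt.const_mul (1 - α))) fun x hx y hy => ?_
  have h1' : 0 ≤ 1 - α := sub_nonneg.2 h1
  have e1 := mul_le_mul_of_nonneg_left (hφ.2 x hx y hy) h0.le
  have e2 := mul_le_mul_of_nonneg_left (hψ.2 x hx y hy) h1'
  rw [show ∀ a b c d : ℝ, α * a + (1 - α) * b - (α * c + (1 - α) * d)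
    = α * (a - c) + (1 - α) * (b - d) by intros; ring]
  refine (abs_add_le _ _).trans ?_
  rw [abs_mul, abs_mul, abs_of_pos h0, abs_of_nonneg h1']
  linarith

lemma IsCDF.mem_Icc (hφ : IsCDF φ) {x : ℝ} (hx : x ∈ Icc (0 : ℝ) 1) : φ x ∈ Icc (0 : ℝ) 1 := by
  have h0 := hφ.2.1.monotoneOn ⟨le_rfl, zero_le_one⟩ hx hx.1
  have h1 := hφ.2.1.monotoneOn hx ⟨zero_le_one, le_rfl⟩ hx.2
  rw [hφ.2.2.1] at h0
  rw [hφ.2.2.2] at h1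
  exact ⟨h0, h1⟩

lemma supDist_le {C : ℝ} (h : ∀ w ∈ Icc (0 : ℝ) 1, |φ w - ψ w| ≤ C) : supDist φ ψ ≤ C :=
  haveI : Nonempty (Icc (0 : ℝ) 1) := ⟨⟨0, le_rfl, zero_le_one⟩⟩
  ciSup_le fun w => h w w.2

lemma IsCDF.le_supDist (hφ : IsCDF φ) (hψ : IsCDF ψ) {w : ℝ} (hw : w ∈ Icc (0 : ℝ) 1) :
    |φ w - ψ w| ≤ supDist φ ψ := by
  refine le_ciSup (f := fun w : Icc (0 : ℝ) 1 => |φ w - ψ w|) ⟨1, ?_⟩ ⟨w, hw⟩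
  rintro _ ⟨⟨x, hx⟩, rfl⟩
  have h1 := hφ.mem_Icc hx
  have h2 := hψ.mem_Icc hx
  exact abs_le.2 ⟨by linarith [h1.1, h2.2], by linarith [h1.2, h2.1]⟩

lemma IsCDF.supDist_nonneg (hφ : IsCDF φ) (hψ : IsCDF ψ) : 0 ≤ supDist φ ψ :=
  (abs_nonneg _).trans (hφ.le_supDist hψ (w := 0) ⟨le_rfl, zero_le_one⟩)

end CDF

/-! ### Sampled weights: existence, mesh bounds and stability. -/

section Weights

variable {φ : ℝ → ℝ} {N : ℕ}

lemma IsCDF.weights_spec (hφ : IsCDF φ) {n : ℕ} (hn : n ≤ N) :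
    weights N φ n ∈ Icc (0 : ℝ) 1 ∧ φ (weights N φ n) = (n : ℝ) / N := by
  have hmem : ((n : ℝ) / N) ∈ φ '' Icc 0 1 := by
    have := intermediate_value_Icc (zero_le_one' ℝ) hφ.1
    rw [hφ.2.2.1, hφ.2.2.2] at this
    refine this ⟨by positivity, div_le_one_of_le₀ (by exact_mod_cast hn) (by positivity)⟩
  exact ⟨Function.invFunOn_mem hmem, Function.invFunOn_eq hmem⟩

lemma IsCDF.isKnots (hφ : IsCDF φ) (hN : 1 ≤ N) : IsKnots N (weights N φ) := by
  have hN' : (0 : ℝ) < N := by exact_mod_cast hN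
  refine ⟨hN, ?_, ?_, fun n hn => ?_⟩
  · obtain ⟨h1, h2⟩ := hφ.weights_spec (N := N) (Nat.zero_le N)
    refine hφ.2.1.injOn h1 ⟨le_rfl, zero_le_one⟩ ?_
    rw [h2, hφ.2.2.1]; simp
  · obtain ⟨h1, h2⟩ := hφ.weights_spec (N := N) le_rfl
    refine hφ.2.1.injOn h1 ⟨zero_le_one, le_rfl⟩ ?_
    rw [h2, hφ.2.2.2, div_self hN'.ne']
  · obtain ⟨h1, h2⟩ := hφ.weights_spec hn.le
    obtain ⟨h3, h4⟩ := hφ.weights_spec (n := n + 1) hn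
    refine (hφ.2.1.lt_iff_lt h1 h3).1 ?_
    rw [h2, h4]
    push_cast
    gcongr
    linarith

lemma weights_id {n : ℕ} (hn : n ≤ N) : weights N (fun w => w) n = (n : ℝ) / N :=
  (IsCDF.id.weights_spec hn).2

lemma IncrBounds.mesh_le {m M : ℝ} (hb : IncrBounds m M φ) (hφ : IsCDF φ) (hN : 1 ≤ N) {n : ℕ}
    (hn : n < N) :
    m * mesh (weights N φ) n ≤ 1 / N ∧ 1 / N ≤ M * mesh (weights N φ) n := by
  obtain ⟨h1, h2⟩ := hφ.weights_spec hn.le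
  obtain ⟨h3, h4⟩ := hφ.weights_spec (n := n + 1) hn
  have := hb _ h1 _ h3 ((hφ.isKnots hN).lt n hn).le
  rw [h2, h4] at this
  have e : ((n + 1 : ℕ) : ℝ) / N - n / N = 1 / N := by push_cast; ring
  rwa [e] at this

lemma IncrBounds.mul_abs_sub_le {m M : ℝ} (hb : IncrBounds m M φ) {a b : ℝ}
    (ha : a ∈ Icc (0 : ℝ) 1) (hb' : b ∈ Icc (0 : ℝ) 1) : m * |a - b| ≤ |φ a - φ b| := by
  rcases le_total a b with h | h
  · rw [abs_sub_comm, abs_of_nonneg (sub_nonneg.2 h), abs_sub_comm]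
    exact (hb a ha b hb' h).1.trans (le_abs_self _)
  · rw [abs_of_nonneg (sub_nonneg.2 h)]
    exact (hb b hb' a ha h).1.trans (le_abs_self _)

/-- The weights move by at most the change of the distribution function. -/
lemma IncrBounds.mul_abs_weights_sub_le {m M : ℝ} {ψ : ℝ → ℝ} (hb : IncrBounds m M ψ)
    (hφ : IsCDF φ) (hψ : IsCDF ψ) {n : ℕ} (hn : n ≤ N) :
    m * |weights N ψ n - weights N φ n| ≤
      |ψ (weights N φ n) - φ (weights N φ n)| := by
  obtain ⟨h1, h2⟩ := hφ.weights_spec hn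
  obtain ⟨h3, h4⟩ := hψ.weights_spec hn
  refine (hb.mul_abs_sub_le h3 h1).trans ?_
  rw [h4, h2, abs_sub_comm]

end Weights

/-! ### Chords against arc length. -/

section Curve

/-- A `C^{1,1}` curve in the plane with arc length `s`, speed in `[c, V]`, `L`-Lipschitz velocity and
chords bounded below by `c` times the parameter difference. -/
structure RegularCurve (F F' : ℝ → Vec 2) (s : ℝ → ℝ) (c V L : ℝ) : Prop where
  c_pos : 0 < c
  deriv : ∀ w ∈ Icc (0 : ℝ) 1, HasDerivWithinAt F (F' w) (Icc 0 1) w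
  lip : ∀ a ∈ Icc (0 : ℝ) 1, ∀ b ∈ Icc (0 : ℝ) 1, ‖F' a - F' b‖ ≤ L * |a - b|
  chord : ∀ a ∈ Icc (0 : ℝ) 1, ∀ b ∈ Icc (0 : ℝ) 1, a ≤ b → c * (b - a) ≤ ‖F b - F a‖
  le_speed : ∀ w ∈ Icc (0 : ℝ) 1, c ≤ ‖F' w‖
  speed_le : ∀ w ∈ Icc (0 : ℝ) 1, ‖F' w‖ ≤ V
  arc_deriv : ∀ w ∈ Icc (0 : ℝ) 1, HasDerivWithinAt s ‖F' w‖ (Icc 0 1) w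
  arc_zero : s 0 = 0

namespace RegularCurve

variable {F F' : ℝ → Vec 2} {s : ℝ → ℝ} {c V L : ℝ}

lemma L_nonneg (h : RegularCurve F F' s c V L) : 0 ≤ L := by
  have := (norm_nonneg _).trans (h.lip 0 ⟨le_rfl, zero_le_one⟩ 1 ⟨zero_le_one, le_rfl⟩)
  simpa using this

lemma c_le_V (h : RegularCurve F F' s c V L) : c ≤ V :=
  (h.le_speed 0 ⟨le_rfl, zero_le_one⟩).trans (h.speed_le 0 ⟨le_rfl, zero_le_one⟩)

lemma arc_bounds (h : RegularCurve F F' s c V L) {a b : ℝ} (ha : a ∈ Icc (0 : ℝ) 1)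
    (hb : b ∈ Icc (0 : ℝ) 1) (hab : a ≤ b) : c * (b - a) ≤ s b - s a ∧ s b - s a ≤ V * (b - a) :=
  have hsub : Icc a b ⊆ Icc 0 1 := Icc_subset_Icc ha.1 hb.2
  ⟨le_sub_of_le_deriv h.arc_deriv ha hb hab fun r hr => h.le_speed r (hsub hr),
    sub_le_of_deriv_le h.arc_deriv ha hb hab fun r hr => h.speed_le r (hsub hr)⟩

lemma arc_one_bounds (h : RegularCurve F F' s c V L) : c ≤ s 1 ∧ s 1 ≤ V := by
  have := h.arc_bounds ⟨le_rfl, zero_le_one⟩ ⟨zero_le_one, le_rfl⟩ zero_le_one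
  rw [h.arc_zero] at this
  simpa using this

lemma hasDerivWithinAt_inner (h : RegularCurve F F' s c V L) (e : Vec 2) :
    ∀ w ∈ Icc (0 : ℝ) 1,
      HasDerivWithinAt (fun w => inner ℝ e (F w)) (inner ℝ e (F' w)) (Icc 0 1) w := by
  intro w hw
  exact ((innerSL ℝ e).hasFDerivAt.comp_hasDerivWithinAt w (h.deriv w hw))

/-- Project onto the chord `e`: by Cauchy–Schwarz `‖e‖ s - ⟨e, F⟩` is nondecreasing, and dividing
its increment by `‖e‖` gives the claim. -/
lemma chord_le_arc (h : RegularCurve F F' s c V L) {a b : ℝ} (ha : a ∈ Icc (0 : ℝ) 1)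
    (hb : b ∈ Icc (0 : ℝ) 1) (hab : a ≤ b) : ‖F b - F a‖ ≤ s b - s a := by
  by_cases h0 : ‖F b - F a‖ = 0
  · rw [h0]
    exact (mul_nonneg h.c_pos.le (sub_nonneg.2 hab)).trans (h.arc_bounds ha hb hab).1
  have hpos : 0 < ‖F b - F a‖ := lt_of_le_of_ne (norm_nonneg _) (Ne.symm h0)
  set e := F b - F a with he
  have := le_of_deriv_nonneg (f := fun w => ‖e‖ * s w - inner ℝ e (F w))
    (f' := fun w => ‖e‖ * ‖F' w‖ - inner ℝ e (F' w))
    (fun w hw => ((h.arc_deriv w hw).const_mul ‖e‖).sub (h.hasDerivWithinAt_inner e w hw))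
    ha hb hab (fun r hr => sub_nonneg.2 (real_inner_le_norm _ _))
  have e1 : inner ℝ e (F b) - inner ℝ e (F a) = ‖e‖ * ‖e‖ := by
    rw [← inner_sub_right, ← he, real_inner_self_eq_norm_mul_norm]
  nlinarith

/-- Project onto the initial velocity `e`. The integrand `‖e‖‖F' r‖ - ⟨e, F' r⟩` is at most `‖e - F'
r‖² / 2`, which is quadratic in the step, so the gap is cubic. Summed over `N` segments it gives the
`N⁻²` accuracy. -/
lemma arc_le_chord_add (h : RegularCurve F F' s c V L) {a b : ℝ} (ha : a ∈ Icc (0 : ℝ) 1)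
    (hb : b ∈ Icc (0 : ℝ) 1) (hab : a ≤ b) :
    s b - s a ≤ ‖F b - F a‖ + L ^ 2 / (2 * c) * (b - a) ^ 3 := by
  have hsub : Icc a b ⊆ Icc 0 1 := Icc_subset_Icc ha.1 hb.2
  set e := F' a with he
  have hc := h.c_pos
  have hce : c ≤ ‖e‖ := h.le_speed a ha
  have hepos : 0 < ‖e‖ := hc.trans_le hce
  have hL := h.L_nonneg
  have := sub_le_of_deriv_le (f := fun w => ‖e‖ * s w - inner ℝ e (F w))
    (f' := fun w => ‖e‖ * ‖F' w‖ - inner ℝ e (F' w)) (C := (L * (b - a)) ^ 2 / 2)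
    (fun w hw => ((h.arc_deriv w hw).const_mul ‖e‖).sub (h.hasDerivWithinAt_inner e w hw))
    ha hb hab (fun r hr => by
      have h1 : ‖e - F' r‖ ≤ L * (b - a) := by
        refine (h.lip a ha r (hsub hr)).trans (mul_le_mul_of_nonneg_left ?_ hL)
        rw [abs_sub_comm, abs_of_nonneg (sub_nonneg.2 hr.1)]; linarith [hr.2]
      have h2 := norm_sub_sq_real e (F' r)
      have h3 : ‖e - F' r‖ ^ 2 ≤ (L * (b - a)) ^ 2 := by gcongr
      nlinarith [sq_nonneg (‖e‖ - ‖F' r‖)])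
  have e1 : inner ℝ e (F b) - inner ℝ e (F a) ≤ ‖e‖ * ‖F b - F a‖ := by
    rw [← inner_sub_right]; exact real_inner_le_norm _ _
  have e2 : ‖e‖ * (s b - s a - ‖F b - F a‖) ≤ ‖e‖ * (L ^ 2 / (2 * c) * (b - a) ^ 3) := by
    have h4 : (L * (b - a)) ^ 2 / 2 * (b - a) = c * (L ^ 2 / (2 * c) * (b - a) ^ 3) := by
      field_simp
    have h5 : 0 ≤ L ^ 2 / (2 * c) * (b - a) ^ 3 := by positivity
    have h6 := mul_le_mul_of_nonneg_right hce h5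
    linarith
  linarith [le_of_mul_le_mul_left e2 hepos]

/-- Subtracting the linear motion with velocity `F' r` leaves a curve with speed at most `L (b -
a)`. The point `r` is free in the interval, so a secant can be compared with the speed anywhere on
its piece. -/
lemma abs_chord_sub_le (h : RegularCurve F F' s c V L) {a b r : ℝ} (ha : a ∈ Icc (0 : ℝ) 1)
    (hb : b ∈ Icc (0 : ℝ) 1) (hab : a ≤ b) (hr : r ∈ Icc a b) :
    |‖F b - F a‖ - ‖F' r‖ * (b - a)| ≤ L * (b - a) ^ 2 := by
  have hsub : Icc a b ⊆ Icc 0 1 := Icc_subset_Icc ha.1 hb.2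
  have hL := h.L_nonneg
  have hba : 0 ≤ b - a := sub_nonneg.2 hab
  have key : ‖F b - F a - (b - a) • F' r‖ ≤ L * (b - a) * (b - a) := by
    have := Convex.norm_image_sub_le_of_norm_hasDerivWithin_le (𝕜 := ℝ)
      (f := fun w => F w - w • F' r) (f' := fun w => F' w - (1 : ℝ) • F' r) (C := L * (b - a))
      (s := Icc a b) (x := a) (y := b)
      (fun w hw => ((h.deriv w (hsub hw)).mono hsub).sub ((hasDerivWithinAt_id w _).smul_const _))
      (fun w hw => by
        rw [one_smul]
        refine (h.lip w (hsub hw) r (hsub hr)).trans (mul_le_mul_of_nonneg_left ?_ hL)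
        exact abs_sub_le_of_le_of_le hw.1 hw.2 hr.1 hr.2)
      (convex_Icc a b) ⟨le_rfl, hab⟩ ⟨hab, le_rfl⟩
    rw [Real.norm_of_nonneg hba] at this
    have e0 : F b - F a - (b - a) • F' r = F b - b • F' r - (F a - a • F' r) := by
      rw [sub_smul]; abel
    rw [e0]; exact this
  have e : ‖F' r‖ * (b - a) = ‖(b - a) • F' r‖ := by
    rw [norm_smul, Real.norm_of_nonneg hba, mul_comm]
  rw [e]
  refine (abs_norm_sub_norm_le _ _).trans (key.trans (le_of_eq (by ring)))

end RegularCurve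

end Curve

/-! ### Rebuilding a CDF from sampled points. -/

/-- Cumulative chord length of a sequence of points. -/
noncomputable def cumChord (z : ℕ → Vec 2) (n : ℕ) : ℝ := ∑ k ∈ Finset.range n, ‖z (k + 1) - z k‖

/-- The PCHIP interpolant divided by its value at `1`. -/
noncomputable def normPchip (N : ℕ) (w y : ℕ → ℝ) (x : ℝ) : ℝ := pchip N w y x / pchip N w y 1

lemma secant_cumChord (w : ℕ → ℝ) (z : ℕ → Vec 2) (n : ℕ) :
    secant w (cumChord z) n = ‖z (n + 1) - z n‖ / mesh w n := by
  simp [secant, cumChord, Finset.sum_range_succ]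

section NormPchip

variable {N : ℕ} {w y : ℕ → ℝ}

lemma pchip_zero (hw : IsKnots N w) (hy : y 0 = 0) : pchip N w y 0 = 0 := by
  have := pchip_knot (y := y) hw (Nat.zero_le N)
  rwa [hw.zero, hy] at this

lemma pchip_one (hw : IsKnots N w) : pchip N w y 1 = y N := by
  have := pchip_knot (y := y) hw (le_refl N)
  rwa [hw.one] at this

lemma hasDerivWithinAt_normPchip (hw : IsKnots N w) : ∀ x ∈ Icc (0 : ℝ) 1,
    HasDerivWithinAt (normPchip N w y) (pchipDeriv N w y x / pchip N w y 1) (Icc 0 1) x :=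
  fun x hx => (hasDerivWithinAt_pchip hw x hx).div_const _

lemma isCDF_normPchip (hw : IsKnots N w) (hy : y 0 = 0) (hyN : 0 < y N)
    (hδ : ∀ n < N, 0 < secant w y n) : IsCDF (normPchip N w y) := by
  have h1 : 0 < pchip N w y 1 := by rwa [pchip_one hw]
  refine ⟨fun x hx => (hasDerivWithinAt_normPchip hw x hx).continuousWithinAt, ?_, ?_, ?_⟩
  · exact fun a ha b hb hab => div_lt_div_of_pos_right (strictMonoOn_pchip hw hδ ha hb hab) h1
  · rw [normPchip, pchip_zero hw hy, zero_div]
  · rw [normPchip, div_self h1.ne']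

lemma incrBounds_normPchip (hw : IsKnots N w) {m M Z : ℝ} (hZ : pchip N w y 1 = Z) (hZ0 : 0 < Z)
    (h : ∀ n < N, ∀ x ∈ Icc (w n) (w (n + 1)), pchipDeriv N w y x ∈ Icc (m * Z) (M * Z)) :
    IncrBounds m M (normPchip N w y) := by
  have h' : ∀ x ∈ Icc (0 : ℝ) 1, m ≤ pchipDeriv N w y x / pchip N w y 1 ∧
      pchipDeriv N w y x / pchip N w y 1 ≤ M := by
    intro x hx
    obtain ⟨n, hn, hx⟩ := hw.exists_piece hx
    rw [hZ]
    exact ⟨(le_div_iff₀ hZ0).2 (h n hn x hx).1, (div_le_iff₀ hZ0).2 (h n hn x hx).2⟩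
  intro a ha b hb hab
  have hsub : Icc a b ⊆ Icc 0 1 := Icc_subset_Icc ha.1 hb.2
  exact ⟨le_sub_of_le_deriv (hasDerivWithinAt_normPchip hw) ha hb hab fun r hr => (h' r (hsub hr)).1,
    sub_le_of_deriv_le (hasDerivWithinAt_normPchip hw) ha hb hab fun r hr => (h' r (hsub hr)).2⟩

lemma lipschitzSmooth_normPchip (hw : IsKnots N w) {l Z : ℝ} (hZ : Z ≤ pchip N w y 1) (hZ0 : 0 < Z)
    (h : ∀ n < N, 4 * (|pchipSlope N w y n - secant w y n|
      + |pchipSlope N w y (n + 1) - secant w y n|) / mesh w n ≤ l) (hl : 0 ≤ l) :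
    LipschitzSmooth (l / Z) (normPchip N w y) := by
  refine .of_hasDerivWithinAt (hasDerivWithinAt_normPchip hw) fun a ha b hb => ?_
  have hpos : 0 < pchip N w y 1 := hZ0.trans_le hZ
  rw [← sub_div, abs_div, abs_of_pos hpos, div_le_iff₀ hpos]
  refine (abs_pchipDeriv_sub_le hw h a ha b hb).trans ?_
  have : l ≤ l / Z * pchip N w y 1 := by
    rw [div_mul_eq_mul_div, le_div_iff₀ hZ0]; gcongr
  calc l * |a - b| ≤ (l / Z * pchip N w y 1) * |a - b| := by gcongr
    _ = _ := by ring

end NormPchip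

namespace RegularCurve

variable {F F' : ℝ → Vec 2} {s : ℝ → ℝ} {c V L : ℝ} {N : ℕ} {w : ℕ → ℝ} {z : ℕ → Vec 2}

/-- Rebuilding from exact points on any knots. -/
lemma rebuild_coarse (h : RegularCurve F F' s c V L) (hw : IsKnots N w) {M : ℝ}
    (hM : ∀ n < N, 1 / N ≤ M * mesh w n) (hz : ∀ n ≤ N, z n = F (w n)) :
    IsCDF (normPchip N w (cumChord z)) ∧ IncrBounds 0 (4 * V / c) (normPchip N w (cumChord z)) ∧
    LipschitzSmooth (16 * V * (N * M) / c) (normPchip N w (cumChord z)) := by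
  have hc := h.c_pos
  have hV : 0 < V := hc.trans_le h.c_le_V
  have hN : (0 : ℝ) < N := by exact_mod_cast hw.pos
  have hsec : ∀ n < N, c ≤ secant w (cumChord z) n ∧ secant w (cumChord z) n ≤ V := by
    intro n hn
    have hm := hw.mesh_pos hn
    rw [secant_cumChord, hz n hn.le, hz (n + 1) hn, le_div_iff₀ hm, div_le_iff₀ hm]
    have h1 := hw.mem_Icc hn.le
    have h2 := hw.mem_Icc (n := n + 1) hn
    have h3 := (hw.lt n hn).le
    exact ⟨h.chord _ h1 _ h2 h3, (h.chord_le_arc h1 h2 h3).trans (h.arc_bounds h1 h2 h3).2⟩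
  have hpos : ∀ n < N, 0 < secant w (cumChord z) n := fun n hn => hc.trans_le (hsec n hn).1
  have hYN : c ≤ cumChord z N := by
    have : ∑ k ∈ Finset.range N, c * (w (k + 1) - w k) ≤ cumChord z N := by
      refine Finset.sum_le_sum fun k hk => ?_
      have hk := Finset.mem_range.1 hk
      have := (hsec k hk).1
      rwa [secant_cumChord, le_div_iff₀ (hw.mesh_pos hk)] at this
    rwa [← Finset.mul_sum, Finset.sum_range_sub, hw.zero, hw.one, sub_zero, mul_one] at this
  have hY1 : c ≤ pchip N w (cumChord z) 1 := by rwa [pchip_one hw]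
  refine ⟨isCDF_normPchip hw (by simp [cumChord]) (hc.trans_le hYN) hpos, ?_, ?_⟩
  · refine incrBounds_normPchip hw rfl (hc.trans_le hY1) fun n hn x hx => ?_
    rw [(pchip_eq_on_piece hw hn hx).2, zero_mul]
    obtain ⟨p0, p1⟩ := pchipSlope_mem hw hpos hn
    obtain ⟨q0, q1⟩ := hermiteSlope_nonneg_le (hw.mesh_pos hn) hx (hpos n hn) p0 p1
    refine ⟨q0, ?_⟩
    calc _ ≤ 3 * secant w (cumChord z) n := q1
      _ ≤ 4 * V := by linarith [(hsec n hn).2]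
      _ = 4 * V / c * c := by field_simp
      _ ≤ _ := by gcongr
  · have hM0 : 0 < M := by
      have h1 := hM 0 hw.pos
      have h2 : 0 < M * mesh w 0 := lt_of_lt_of_le (by positivity) h1
      exact pos_of_mul_pos_left h2 (hw.mesh_pos hw.pos).le
    -- Neighbouring secants need not be close here, so slopes deviate from secants by up to `2 V`.
    -- Dividing by a mesh width of at least `1 / (N M)` brings a factor `N` into the constant.
    refine lipschitzSmooth_normPchip hw hY1 hc (fun n hn => ?_) (by positivity)
    have hm := hw.mesh_pos hn
    obtain ⟨p0, p1⟩ := pchipSlope_mem hw hpos hn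
    have a0 : |pchipSlope N w (cumChord z) n - secant w (cumChord z) n| ≤ 2 * V :=
      abs_le.2 ⟨by linarith [p0.1, (hsec n hn).2], by linarith [p0.2, (hsec n hn).2]⟩
    have a1 : |pchipSlope N w (cumChord z) (n + 1) - secant w (cumChord z) n| ≤ 2 * V :=
      abs_le.2 ⟨by linarith [p1.1, (hsec n hn).2], by linarith [p1.2, (hsec n hn).2]⟩
    rw [div_le_iff₀ hm]
    have hNM : 1 ≤ N * M * mesh w n := by
      have := hM n hn
      rwa [div_le_iff₀ hN, mul_comm, ← mul_assoc] at this
    calc _ ≤ 16 * V * 1 := by linarith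
      _ ≤ 16 * V * (N * M * mesh w n) := by gcongr
      _ = _ := by ring

/-- Rebuilding from points with error `ε` on a fine mesh. -/
lemma rebuild_fine (h : RegularCurve F F' s c V L) (hw : IsKnots N w) {m M ε ρ : ℝ}
    (hmV : m = c / (4 * V)) (hMV : M = 4 * V / c)
    (hm : ∀ n < N, m * mesh w n ≤ 1 / N) (hM : ∀ n < N, 1 / N ≤ M * mesh w n)
    (hz : ∀ n ≤ N, ‖z n - F (w n)‖ ≤ ε)
    (hρ : ρ = L / (m * N) + 2 * ε * (N * M)) (hρc : ρ ≤ c / 16) :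
    IsCDF (normPchip N w (cumChord z)) ∧ IncrBounds m M (normPchip N w (cumChord z)) ∧
    LipschitzSmooth (32 * M / c * (L / m + 2 * M * ((N : ℝ) ^ 2 * ε)))
      (normPchip N w (cumChord z)) ∧
    ∀ x ∈ Icc (0 : ℝ) 1, |normPchip N w (cumChord z) x - s x / s 1| ≤
      4 / c * ((L ^ 2 / (2 * c) / m ^ 3 + 5 * L / m ^ 2) / (N : ℝ) ^ 2
        + (2 + 10 * M / m) * (N * ε)) := by
  have hc := h.c_pos
  have hV : 0 < V := hc.trans_le h.c_le_V
  have hL := h.L_nonneg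
  have hN : (0 : ℝ) < N := by exact_mod_cast hw.pos
  have hm0 : 0 < m := by rw [hmV]; positivity
  have hM0 : 0 < M := by rw [hMV]; positivity
  have hε : 0 ≤ ε := (norm_nonneg _).trans (hz 0 (Nat.zero_le _))
  have hρ0 : 0 ≤ ρ := by rw [hρ]; positivity
  have hmesh : ∀ n < N, mesh w n ≤ 1 / (m * N) := fun n hn => by
    rw [le_div_iff₀ (by positivity)]
    have := hm n hn
    rw [le_div_iff₀ hN] at this
    linarith
  have hmesh' : ∀ n < N, 1 ≤ N * M * mesh w n := fun n hn => by
    have := hM n hn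
    rw [div_le_iff₀ hN] at this
    linarith
  have hchord : ∀ n < N, |‖z (n + 1) - z n‖ - ‖F (w (n + 1)) - F (w n)‖| ≤ 2 * ε := by
    intro n hn
    refine (abs_norm_sub_norm_le _ _).trans ?_
    have e : z (n + 1) - z n - (F (w (n + 1)) - F (w n))
        = (z (n + 1) - F (w (n + 1))) - (z n - F (w n)) := by abel
    rw [e]
    refine (norm_sub_le _ _).trans ?_
    linarith [hz n hn.le, hz (n + 1) hn]
  -- secants are close to the speed
  have hsec : ∀ n < N, ∀ r ∈ Icc (w n) (w (n + 1)),
      |secant w (cumChord z) n - ‖F' r‖| ≤ ρ := by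
    intro n hn r hr
    have hmp := hw.mesh_pos hn
    have h1 := h.abs_chord_sub_le (hw.mem_Icc hn.le) (hw.mem_Icc (n := n + 1) hn) (hw.lt n hn).le hr
    have h2 : |‖z (n + 1) - z n‖ - ‖F' r‖ * mesh w n| ≤ L * mesh w n ^ 2 + 2 * ε := by
      refine (abs_sub_le _ _ _).trans (add_comm (2 * ε) _ ▸ add_le_add (hchord n hn) h1)
    have e : secant w (cumChord z) n - ‖F' r‖ = (‖z (n + 1) - z n‖ - ‖F' r‖ * mesh w n) / mesh w n := by
      rw [secant_cumChord]; field_simp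
    rw [e, abs_div, abs_of_pos hmp, div_le_iff₀ hmp]
    refine h2.trans ?_
    rw [hρ, add_mul]
    refine add_le_add ?_ ?_
    · have := mul_le_mul_of_nonneg_left (hmesh n hn) (mul_nonneg hL hmp.le)
      calc L * mesh w n ^ 2 = L * mesh w n * mesh w n := by ring
        _ ≤ _ := this
        _ = _ := by ring
    · calc 2 * ε = 2 * ε * 1 := by ring
        _ ≤ 2 * ε * (N * M * mesh w n) := by gcongr; exact hmesh' n hn
        _ = _ := by ring
  have hmem : ∀ n < N, w n ∈ Icc (w n) (w (n + 1)) := fun n hn => ⟨le_rfl, (hw.lt n hn).le⟩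
  have hsecge : ∀ n < N, c - ρ ≤ secant w (cumChord z) n := fun n hn => by
    have h1 := (abs_le.1 (hsec n hn _ (hmem n hn))).1
    have h2 := h.le_speed _ (hw.mem_Icc hn.le)
    linarith
  have hpos : ∀ n < N, 0 < secant w (cumChord z) n := fun n hn => by
    linarith [hsecge n hn]
  -- Neighbouring secants are both within `ρ` of the speed at their common knot, hence within `2ρ`
  -- of each other; `ρ ≤ c / 16` gives `2ρ ≤ c - ρ`, the lower bound on the secants that end-slope
  -- clipping needs.
  have hslope : ∀ n < N, |pchipSlope N w (cumChord z) n - secant w (cumChord z) n| ≤ 2 * ρ ∧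
      |pchipSlope N w (cumChord z) (n + 1) - secant w (cumChord z) n| ≤ 2 * ρ := by
    intro n hn
    refine abs_pchipSlope_sub_le hw hpos (by linarith) (fun k hk => by linarith [hsecge k hk]) ?_ hn
    intro k hk
    have h1 := hsec k (by omega) (w (k + 1)) ⟨(hw.lt k (by omega)).le, le_rfl⟩
    have h2 := hsec (k + 1) hk (w (k + 1)) (hmem _ hk)
    rw [abs_sub_comm] at h2
    linarith [abs_sub_le (secant w (cumChord z) k) ‖F' (w (k + 1))‖ (secant w (cumChord z) (k + 1))]
  -- The 5 is `1 + 2 + 2`: secant against speed, plus the two end-slope deviations.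
  have hderiv : ∀ n < N, ∀ x ∈ Icc (w n) (w (n + 1)),
      |pchipDeriv N w (cumChord z) x - ‖F' x‖| ≤ 5 * ρ := by
    intro n hn x hx
    rw [(pchip_eq_on_piece hw hn hx).2]
    have h1 := abs_hermiteSlope_sub_secant_le (N := N) (y := cumChord z) (hw.mesh_pos hn) hx
    have h2 := hsec n hn x hx
    linarith [abs_sub_le (hermiteSlope N w (cumChord z) n x) (secant w (cumChord z) n) ‖F' x‖,
      (hslope n hn).1, (hslope n hn).2]
  have hderiv' : ∀ x ∈ Icc (0 : ℝ) 1, |pchipDeriv N w (cumChord z) x - ‖F' x‖| ≤ 5 * ρ := by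
    intro x hx
    obtain ⟨n, hn, hx⟩ := hw.exists_piece hx
    exact hderiv n hn x hx
  have hdiff : ∀ a ∈ Icc (0 : ℝ) 1, ∀ b ∈ Icc (0 : ℝ) 1, a ≤ b →
      |(pchip N w (cumChord z) b - s b) - (pchip N w (cumChord z) a - s a)| ≤ 5 * ρ * (b - a) := by
    intro a ha b hb hab
    exact abs_sub_le_of_abs_deriv_le (f := fun x => pchip N w (cumChord z) x - s x)
      (fun x hx => (hasDerivWithinAt_pchip hw x hx).sub (h.arc_deriv x hx)) ha hb hab
      fun r hr => hderiv' r (Icc_subset_Icc ha.1 hb.2 hr)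
  have hy0 : cumChord z 0 = 0 := by simp [cumChord]
  obtain ⟨hs1, hs2⟩ := h.arc_one_bounds
  have hZ : |pchip N w (cumChord z) 1 - s 1| ≤ 5 * ρ := by
    have := hdiff 0 ⟨le_rfl, zero_le_one⟩ 1 ⟨zero_le_one, le_rfl⟩ zero_le_one
    rwa [pchip_zero hw hy0, h.arc_zero, sub_zero, sub_zero, sub_zero, mul_one] at this
  have hZ' := abs_le.1 hZ
  set Z := pchip N w (cumChord z) 1 with hZdef
  have hZlow : c / 2 ≤ Z := by linarith
  have hZ0 : 0 < Z := by linarith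
  refine ⟨isCDF_normPchip hw hy0 (by rw [← pchip_one (y := cumChord z) hw]; exact hZ0) hpos, ?_, ?_, ?_⟩
  -- As `5ρ ≤ 5c/16`, both the derivative and its integral `Z` lie in `[c/2, 2V]`. The quotients of
  -- these ends are `m = c/(4V)` and `M = 4V/c`, so the class assumed of the previous iterate is
  -- recovered.
  · refine incrBounds_normPchip hw rfl hZ0 fun n hn x hx => ?_
    have h1 := abs_le.1 (hderiv n hn x hx)
    have hx' : x ∈ Icc (0 : ℝ) 1 :=
      ⟨(hw.mem_Icc hn.le).1.trans hx.1, hx.2.trans (hw.mem_Icc (n := n + 1) hn).2⟩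
    have h2 := h.le_speed x hx'
    have h3 := h.speed_le x hx'
    rw [← hZdef]
    constructor
    · calc m * Z ≤ m * (2 * V) := by gcongr; linarith
        _ = c / 2 := by rw [hmV]; field_simp; norm_num
        _ ≤ _ := by linarith
    · calc _ ≤ 2 * V := by linarith
        _ = M * (c / 2) := by rw [hMV]; field_simp; norm_num
        _ ≤ _ := by gcongr
  · have hc2 : 0 < c / 2 := half_pos hc
    have := lipschitzSmooth_normPchip (y := cumChord z) (l := 16 * ρ * (N * M)) hw hZlow hc2
      (fun n hn => ?_) (by positivity)
    · convert this using 1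
      rw [hρ]; field_simp
      ring
    · rw [div_le_iff₀ (hw.mesh_pos hn)]
      calc _ ≤ 16 * ρ * 1 := by linarith [(hslope n hn).1, (hslope n hn).2]
        _ ≤ 16 * ρ * (N * M * mesh w n) := by gcongr; exact hmesh' n hn
        _ = _ := by ring
  · -- accuracy
    set Q := L ^ 2 / (2 * c) with hQ
    -- Each segment adds a cubic arc-chord gap and the error of its two end points.
    have hknot : ∀ n ≤ N, |cumChord z n - s (w n)| ≤ n * (Q / (m * N) ^ 3 + 2 * ε) := by
      intro n
      induction n with
      | zero => intro _; rw [hy0, hw.zero, h.arc_zero]; simp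
      | succ k ih =>
        intro hk
        have h1 := ih (by omega)
        have hk' : k < N := hk
        have h2 := hchord k hk'
        have hw1 := hw.mem_Icc hk'.le
        have hw2 := hw.mem_Icc (n := k + 1) hk
        have h3 := h.chord_le_arc hw1 hw2 (hw.lt k hk').le
        have h4 := h.arc_le_chord_add hw1 hw2 (hw.lt k hk').le
        have h5 : Q * (w (k + 1) - w k) ^ 3 ≤ Q / (m * N) ^ 3 := by
          have h6 : (w (k + 1) - w k) ^ 3 ≤ (1 / (m * N)) ^ 3 :=
            pow_le_pow_left₀ (hw.mesh_pos hk').le (hmesh k hk') 3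
          calc _ ≤ Q * (1 / (m * N)) ^ 3 := by gcongr
            _ = _ := by field_simp
        have e : cumChord z (k + 1) = cumChord z k + ‖z (k + 1) - z k‖ := by
          simp [cumChord, Finset.sum_range_succ]
        rw [← hQ] at h4
        rw [e]
        push_cast
        have a1 := abs_le.1 h1
        have a2 := abs_le.1 h2
        refine abs_le.2 ⟨by linarith, by linarith⟩
    set E := (Q / m ^ 3 + 5 * L / m ^ 2) / (N : ℝ) ^ 2 + (2 + 10 * M / m) * (N * ε) with hE
    -- Start from the left knot of the piece: the derivative error `5ρ` acts over a length at most
    -- `1/(m N)`, so interpolation costs only `O(N⁻²) + O(ε)` beyond the knot error.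
    have hEx : ∀ x ∈ Icc (0 : ℝ) 1, |pchip N w (cumChord z) x - s x| ≤ E := by
      intro x hx
      obtain ⟨n, hn, hxn⟩ := hw.exists_piece hx
      have h1 := hdiff (w n) (hw.mem_Icc hn.le) x hx hxn.1
      rw [pchip_knot hw hn.le] at h1
      have h2 := hknot n hn.le
      have h3 : x - w n ≤ 1 / (m * N) := by
        refine le_trans ?_ (hmesh n hn)
        simp only [mesh]; linarith [hxn.2]
      have h4 : 5 * ρ * (x - w n) ≤ 5 * ρ * (1 / (m * N)) := by gcongr
      have h5 : (n : ℝ) * (Q / (m * N) ^ 3 + 2 * ε) ≤ N * (Q / (m * N) ^ 3 + 2 * ε) := by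
        gcongr
      have h6 : N * (Q / (m * N) ^ 3 + 2 * ε) + 5 * ρ * (1 / (m * N)) ≤ E := by
        have e1 : N * (Q / (m * N) ^ 3 + 2 * ε) + 5 * ρ * (1 / (m * N))
            = (Q / m ^ 3 + 5 * L / m ^ 2) / (N : ℝ) ^ 2 + 2 * (N * ε) + 10 * M / m * ε := by
          rw [hρ]; field_simp; ring
        have e2 : ε ≤ N * ε := by
          have : (1 : ℝ) ≤ N := by exact_mod_cast hw.pos
          nlinarith
        have e3 : 10 * M / m * ε ≤ 10 * M / m * (N * ε) := by gcongr
        rw [e1, hE]; linarith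
      have a1 := abs_le.1 h1
      have a2 := abs_le.1 h2
      refine abs_le.2 ⟨by linarith, by linarith⟩
    intro x hx
    have h1 := hEx x hx
    have h2 := hEx 1 ⟨zero_le_one, le_rfl⟩
    rw [← hZdef] at h2
    have hs0 : 0 < s 1 := hc.trans_le hs1
    have hsx := h.arc_bounds ⟨le_rfl, zero_le_one⟩ hx hx.1
    have hsx' := h.arc_bounds hx ⟨zero_le_one, le_rfl⟩ hx.2
    rw [h.arc_zero, sub_zero, sub_zero] at hsx
    have hsx0 : 0 ≤ s x := (mul_nonneg hc.le hx.1).trans hsx.1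
    have hsx1 : s x ≤ s 1 := by
      have := mul_nonneg hc.le (sub_nonneg.2 hx.2)
      linarith [hsx'.1]
    have hr0 : 0 ≤ s x / s 1 := by positivity
    have hr1 : s x / s 1 ≤ 1 := (div_le_one hs0).2 hsx1
    -- Normalization at most doubles the error `E`, since the second error carries the factor `s x /
    -- s 1 ≤ 1`; dividing by `Z ≥ c/2` gives `4 E / c`.
    have e : normPchip N w (cumChord z) x - s x / s 1
        = ((pchip N w (cumChord z) x - s x) - s x / s 1 * (Z - s 1)) / Z := by
      rw [normPchip, ← hZdef]; field_simp; ring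
    rw [e, abs_div, abs_of_pos hZ0, div_le_iff₀ hZ0]
    have h3 : |s x / s 1 * (Z - s 1)| ≤ E := by
      rw [abs_mul, abs_of_nonneg hr0]
      exact (mul_le_of_le_one_left (abs_nonneg _) hr1).trans h2
    calc _ ≤ 2 * E := by
          refine (abs_sub _ _).trans ?_
          linarith
      _ = 4 / c * E * (c / 2) := by field_simp; ring
      _ ≤ 4 / c * E * Z := by gcongr

end RegularCurve

namespace RegularCurve

variable {F F' : ℝ → Vec 2} {s : ℝ → ℝ} {c V L : ℝ}

lemma isCDF_arc (h : RegularCurve F F' s c V L) : IsCDF (fun w => s w / s 1) := by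
  have hs0 : 0 < s 1 := h.c_pos.trans_le h.arc_one_bounds.1
  refine ⟨fun x hx => ((h.arc_deriv x hx).div_const _).continuousWithinAt, ?_, ?_, ?_⟩
  · intro a ha b hb hab
    have := (h.arc_bounds ha hb hab.le).1
    have h2 := mul_pos h.c_pos (sub_pos.2 hab)
    exact div_lt_div_of_pos_right (by linarith) hs0
  · simp [h.arc_zero]
  · exact div_self hs0.ne'

lemma lipschitzSmooth_arc (h : RegularCurve F F' s c V L) :
    LipschitzSmooth (L / c) (fun w => s w / s 1) := by
  have hs0 : 0 < s 1 := h.c_pos.trans_le h.arc_one_bounds.1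
  have hc := h.c_pos
  have hL := h.L_nonneg
  refine .of_hasDerivWithinAt (fun x hx => (h.arc_deriv x hx).div_const _) fun x hx y hy => ?_
  rw [← sub_div, abs_div, abs_of_pos hs0, div_le_iff₀ hs0]
  refine ((abs_norm_sub_norm_le _ _).trans (h.lip x hx y hy)).trans ?_
  calc L * |x - y| = L / c * |x - y| * c := by field_simp
    _ ≤ _ := by gcongr; exact h.arc_one_bounds.1

end RegularCurve

/-! ### The outer iteration: invariance of the class of smooth CDFs. -/

/-- The regularity of the solution path of `P` on which the analysis of SURF rests. -/
structure PathRegular {U : Type*} {d p q : ℕ} (P : Problem U d p q) (F' : ℝ → Vec 2)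
    (c V L Lx Lf r : ℝ) : Prop where
  curve : RegularCurve (fPF P) F' (arcLength P) c V L
  Lx_nonneg : 0 ≤ Lx
  lip_path : ∀ a ∈ Icc (0 : ℝ) 1, ∀ b ∈ Icc (0 : ℝ) 1,
    ‖xstar P a - xstar P b‖ ≤ Lx * |a - b|
  Lf_pos : 0 < Lf
  r_pos : 0 < r
  lip_obj : ∀ w ∈ Icc (0 : ℝ) 1, ∀ u, ‖P.g u - xstar P w‖ ≤ r →
    ‖hvec P u - fPF P w‖ ≤ Lf * ‖P.g u - xstar P w‖

section Iteration

variable {U : Type*} {d p q : ℕ} {P : Problem U d p q} {F' : ℝ → Vec 2} {c V L Lx Lf r : ℝ}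

/-- A distribution function with difference quotients in `[m, M]` and `l`-Lipschitz derivative. -/
def IsSmoothCDF (m M l : ℝ) (φ : ℝ → ℝ) : Prop :=
  IsCDF φ ∧ IncrBounds m M φ ∧ LipschitzSmooth l φ

lemma IsSmoothCDF.id {m M l : ℝ} (hm : m ≤ 1) (hM : 1 ≤ M) (hl : 0 ≤ l) :
    IsSmoothCDF m M l (fun w => w) :=
  ⟨IsCDF.id, IncrBounds.id hm hM, LipschitzSmooth.id hl⟩

lemma IsSmoothCDF.mix {m M l α : ℝ} {φ ψ : ℝ → ℝ} (hφ : IsSmoothCDF m M l φ)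
    (hψ : IsSmoothCDF m M l ψ) (h0 : 0 < α) (h1 : α ≤ 1) :
    IsSmoothCDF m M l (fun x => α * φ x + (1 - α) * ψ x) :=
  ⟨hφ.1.mix hψ.1 h0 h1, hφ.2.1.mix hψ.2.1 h0 h1, hφ.2.2.mix hψ.2.2 h0 h1⟩

lemma rebuilt_eq_normPchip (N : ℕ) (w : ℕ → ℝ) (u : ℕ → U) :
    rebuilt P N w u = normPchip N w (cumChord fun n => hvec P (u n)) := rfl

lemma surfCDF_succ (S : ℝ → U → U) (N : ℕ) (α : ℝ) (u₀ : ℕ → U) (t : ℕ) :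
    surfCDF P S N α u₀ (t + 1) =
      fun x => α * surfRebuilt P S N α u₀ t x + (1 - α) * surfCDF P S N α u₀ t x := rfl

lemma surfPoint_eq (S : ℝ → U → U) (N : ℕ) (α : ℝ) (u₀ : ℕ → U) (t n : ℕ) :
    surfPoint P S N α u₀ t n =
      S (surfWeight P S N α u₀ t n) ((surf P S N α u₀ t).2 n) := rfl

/-- The class contains the identity, because `m ≤ 1 ≤ M`, and is convex. Hence only the rebuilding
step has to preserve it. -/
lemma isSmoothCDF_surf {S : ℝ → U → U} {N : ℕ} {α : ℝ} {u₀ : ℕ → U} {m M l : ℝ}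
    (hm : m ≤ 1) (hM : 1 ≤ M) (hl : 0 ≤ l) (h0 : 0 < α) (h1 : α ≤ 1)
    (h : ∀ t, IsSmoothCDF m M l (surfCDF P S N α u₀ t) →
      IsSmoothCDF m M l (surfRebuilt P S N α u₀ t)) (t : ℕ) :
    IsSmoothCDF m M l (surfCDF P S N α u₀ t) := by
  induction t with
  | zero => exact .id hm hM hl
  | succ t ih => rw [surfCDF_succ]; exact (h t ih).mix ih h0 h1

namespace PathRegular

/-- The mesh-independent part of the smoothness constant. -/
noncomputable def smoothConst (c V L Lx Lf : ℝ) : ℝ :=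
  32 * (4 * V / c) / c * (L / (c / (4 * V)) + 2 * (4 * V / c) * ((1 + Lx) * Lf))

/-- The discretization constant. -/
noncomputable def discConst (c V L : ℝ) : ℝ :=
  4 / c * (L ^ 2 / (2 * c) / (c / (4 * V)) ^ 3 + 5 * L / (c / (4 * V)) ^ 2)

/-- The sensitivity of the rebuilt distribution function to the inner error. -/
noncomputable def noiseConst (c V Lf : ℝ) : ℝ :=
  4 / c * (2 + 10 * (4 * V / c) / (c / (4 * V))) * Lf

variable (h : PathRegular P F' c V L Lx Lf r)

include h in
lemma V_pos : 0 < V := h.curve.c_pos.trans_le h.curve.c_le_V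

include h in
lemma lower_le_one : c / (4 * V) ≤ 1 := by
  have := h.curve.c_le_V
  have hV := h.V_pos
  rw [div_le_one (by positivity)]; linarith

include h in
lemma one_le_upper : 1 ≤ 4 * V / c := by
  have := h.curve.c_le_V
  have hV := h.V_pos
  rw [le_div_iff₀ h.curve.c_pos]; linarith

include h in
lemma smoothConst_nonneg : 0 ≤ smoothConst c V L Lx Lf := by
  have hV := h.V_pos
  have hc := h.curve.c_pos
  have hL := h.curve.L_nonneg
  have hLx := h.Lx_nonneg
  have hLf := h.Lf_pos
  unfold smoothConst; positivity

include h in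
lemma discConst_nonneg : 0 ≤ discConst c V L := by
  have hV := h.V_pos
  have hc := h.curve.c_pos
  have hL := h.curve.L_nonneg
  unfold discConst; positivity

include h in
lemma noiseConst_pos : 0 < noiseConst c V Lf := by
  have hV := h.V_pos
  have hc := h.curve.c_pos
  have hLf := h.Lf_pos
  unfold noiseConst; positivity

include h in
lemma isCDF_cdf : IsCDF (cdf P) := h.curve.isCDF_arc

include h in
/-- One rebuilding step from points with inner error at most `e`. -/
lemma rebuild {N : ℕ} (hN1 : 1 ≤ N) (hN : 32 * L / (c / (4 * V) * c) ≤ N) {φ : ℝ → ℝ}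
    (hφ : IsCDF φ) (hb : IncrBounds (c / (4 * V)) (4 * V / c) φ) {u : ℕ → U} {e : ℝ}
    (hu : ∀ n ≤ N, ‖P.g (u n) - xstar P (weights N φ n)‖ ≤ e) (her : e ≤ r)
    (heN : 64 * (4 * V / c) / c * (Lf * (N * e)) ≤ 1) {β : ℝ}
    (heβ : e ≤ (1 + Lx) * β) :
    IsSmoothCDF (c / (4 * V)) (4 * V / c)
      (smoothConst c V L Lx Lf * max 1 ((N : ℝ) ^ 2 * β)) (rebuilt P N (weights N φ) u) ∧
    ∀ x ∈ Icc (0 : ℝ) 1, |rebuilt P N (weights N φ) u x - cdf P x| ≤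
      discConst c V L / (N : ℝ) ^ 2 + noiseConst c V Lf * (N * e) := by
  have hV := h.V_pos
  have hc := h.curve.c_pos
  have hL := h.curve.L_nonneg
  have hLf := h.Lf_pos
  have hLx := h.Lx_nonneg
  have hN' : (0 : ℝ) < N := by exact_mod_cast hN1
  rw [rebuilt_eq_normPchip]
  have hm0 : 0 < c / (4 * V) := by positivity
  have hM0 : 0 < 4 * V / c := by positivity
  generalize hm : c / (4 * V) = m at *
  generalize hM : 4 * V / c = M at *
  obtain ⟨h1, h2, h3, h4⟩ := h.curve.rebuild_fine (hφ.isKnots hN1) (ε := Lf * e)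
    (z := fun n => hvec P (u n)) hm.symm hM.symm
    (fun n hn => (hb.mesh_le hφ hN1 hn).1) (fun n hn => (hb.mesh_le hφ hN1 hn).2)
    (fun n hn => (h.lip_obj _ (hφ.weights_spec hn).1 _ ((hu n hn).trans her)).trans
      (mul_le_mul_of_nonneg_left (hu n hn) hLf.le)) rfl (by
      -- The lower bound on `N` and the smallness of `N e` each supply half of `ρ ≤ c / 16`.
      have e1 : L / (m * N) ≤ c / 32 := by
        rw [div_le_iff₀ (by positivity)] at hN ⊢
        linarith
      have e2 : 2 * (Lf * e) * (N * M) ≤ c / 32 := by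
        have : 64 * M / c * (Lf * (N * e)) = (2 * (Lf * e) * (N * M)) * (32 / c) := by
          field_simp; ring
        rw [this] at heN
        calc _ = (2 * (Lf * e) * (N * M)) * (32 / c) * (c / 32) := by field_simp
          _ ≤ 1 * (c / 32) := by gcongr
          _ = _ := one_mul _
      linarith)
  refine ⟨⟨h1, h2, h3.mono ?_⟩, fun x hx => ?_⟩
  · simp only [smoothConst, hm, hM]
    have hmax1 : (1 : ℝ) ≤ max 1 ((N : ℝ) ^ 2 * β) := le_max_left _ _
    have hmax2 : (N : ℝ) ^ 2 * β ≤ max 1 ((N : ℝ) ^ 2 * β) := le_max_right _ _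
    generalize max 1 ((N : ℝ) ^ 2 * β) = μ at hmax1 hmax2
    rw [mul_assoc (32 * M / c)]
    refine mul_le_mul_of_nonneg_left ?_ (by positivity)
    rw [add_mul]
    refine add_le_add (le_mul_of_one_le_right (by positivity) hmax1) ?_
    rw [mul_assoc (2 * M)]
    refine mul_le_mul_of_nonneg_left ?_ (by positivity)
    calc (N : ℝ) ^ 2 * (Lf * e) ≤ N ^ 2 * (Lf * ((1 + Lx) * β)) := by gcongr
      _ = (1 + Lx) * Lf * (N ^ 2 * β) := by ring
      _ ≤ _ := by gcongr
  · refine (h4 x hx).trans (le_of_eq ?_)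
    simp only [discConst, noiseConst, hm, hM]
    ring

include h in
/-- With an exact solver the iterates are uniformly smooth for every number of segments. -/
lemma exact_solver {S : ℝ → U → U} (hS : IsExactSolver P S) {l N₀ : ℝ}
    (hN₀ : 32 * L / (c / (4 * V) * c) ≤ N₀)
    (hl : 16 * V * (N₀ * (4 * V / c)) / c + smoothConst c V L Lx Lf ≤ l)
    {N : ℕ} (hN1 : 1 ≤ N) (u₀ : ℕ → U) {α : ℝ} (h0 : 0 < α) (h1 : α ≤ 1) (t : ℕ) :
    IsCDF (surfCDF P S N α u₀ t) ∧ LipschitzSmooth l (surfCDF P S N α u₀ t) ∧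
    IsCDF (surfRebuilt P S N α u₀ t) ∧ LipschitzSmooth l (surfRebuilt P S N α u₀ t) := by
  have hV := h.V_pos
  have hc := h.curve.c_pos
  have hL := h.curve.L_nonneg
  have hN' : (0 : ℝ) < N := by exact_mod_cast hN1
  have hN₀' : 0 ≤ N₀ := le_trans (by positivity) hN₀
  have hs := h.smoothConst_nonneg
  have hl1 : 0 ≤ 16 * V * (N₀ * (4 * V / c)) / c := by positivity
  have hl0 : 0 ≤ l := by linarith
  have hex : ∀ t, IsCDF (surfCDF P S N α u₀ t) → ∀ n ≤ N,
      P.g (surfPoint P S N α u₀ t n) = xstar P (surfWeight P S N α u₀ t n) :=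
    fun t ht n hn => hS _ (ht.weights_spec hn).1 _
  suffices H : ∃ m M, m ≤ 1 ∧ 1 ≤ M ∧ ∀ t, IsSmoothCDF m M l (surfCDF P S N α u₀ t) →
      IsSmoothCDF m M l (surfRebuilt P S N α u₀ t) by
    obtain ⟨m, M, hm, hM, H⟩ := H
    have h3 := isSmoothCDF_surf hm hM hl0 h0 h1 H t
    have h4 := H t h3
    exact ⟨h3.1, h3.2.2, h4.1, h4.2.2⟩
  -- On a fine mesh the class `[c/(4V), 4V/c]` is invariant. On a coarse one only the lower bound
  -- `0` is kept, which suffices because smoothness uses just the upper bound, and `N < N₀` bounds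
  -- the factor `N`.
  by_cases hcase : N₀ ≤ N
  · refine ⟨_, _, h.lower_le_one, h.one_le_upper, fun t ht => ?_⟩
    have h5 := (h.rebuild hN1 (hN₀.trans hcase) ht.1 ht.2.1 (u := surfPoint P S N α u₀ t) (e := 0)
      (β := 0) (fun n hn => by rw [hex t ht.1 n hn]; simp [surfWeight]) h.r_pos.le (by simp)
      (by simp)).1
    refine ⟨h5.1, h5.2.1, h5.2.2.mono ?_⟩
    rw [mul_zero, max_eq_left zero_le_one]
    linarith
  · refine ⟨0, _, zero_le_one, h.one_le_upper, fun t ht => ?_⟩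
    have h5 := h.curve.rebuild_coarse (ht.1.isKnots hN1) (M := 4 * V / c)
      (z := fun n => hvec P (surfPoint P S N α u₀ t n))
      (fun n hn => (ht.2.1.mesh_le ht.1 hN1 hn).2) (fun n hn => by
        have h6 := h.lip_obj _ (ht.1.weights_spec hn).1 (surfPoint P S N α u₀ t n)
          (by rw [hex t ht.1 n hn]; simp [surfWeight, h.r_pos.le])
        rw [hex t ht.1 n hn] at h6
        rw [surfWeight, sub_self, norm_zero, mul_zero] at h6
        exact sub_eq_zero.1 (norm_le_zero_iff.1 h6))
    refine ⟨h5.1, h5.2.1, h5.2.2.mono ?_⟩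
    have : 16 * V * (N * (4 * V / c)) / c ≤ 16 * V * (N₀ * (4 * V / c)) / c := by
      have := (not_le.1 hcase).le
      gcongr
    linarith

section Inexact

variable {S : ℝ → U → U} {η D α : ℝ} {N : ℕ} {u₀ : ℕ → U}

/-- The smallness of `N D η` that the analysis of an inexact solver needs. -/
noncomputable def noiseBudget (c V Lx Lf r : ℝ) : ℝ :=
  1 / (8 + (1 + Lx) + (1 + Lx) / r + 64 * (4 * V / c) / c * (Lf * (1 + Lx))
    + 8 * noiseConst c V Lf * Lx / (c / (4 * V)))

-- The budget is the reciprocal of a sum with one nonnegative term per demand: contraction factor at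
-- most `1/8`, boundedness of the warm starts, staying within the radius `r`, smallness of `ρ`, and
-- weak feedback from the moving weights.
include h in
lemma noiseBudget_spec : 0 < noiseBudget c V Lx Lf r ∧ ∀ x, 0 ≤ x → x ≤ noiseBudget c V Lx Lf r →
    8 * x ≤ 1 ∧ (1 + Lx) * x ≤ 1 ∧ (1 + Lx) * x ≤ r ∧
    64 * (4 * V / c) / c * (Lf * ((1 + Lx) * x)) ≤ 1 ∧
    8 * noiseConst c V Lf * Lx / (c / (4 * V)) * x ≤ 1 := by
  have hV := h.V_pos
  have hc := h.curve.c_pos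
  have hLf := h.Lf_pos
  have hLx := h.Lx_nonneg
  have hr := h.r_pos
  have hn := h.noiseConst_pos
  have t1 : 0 ≤ (1 + Lx) / r := by positivity
  have t2 : 0 ≤ 64 * (4 * V / c) / c * (Lf * (1 + Lx)) := by positivity
  have t3 : 0 ≤ 8 * noiseConst c V Lf * Lx / (c / (4 * V)) := by positivity
  unfold noiseBudget
  refine ⟨by positivity, fun x hx0 hx => ?_⟩
  rw [le_div_iff₀ (by positivity)] at hx
  generalize noiseConst c V Lf = nc at *
  generalize ht3 : 8 * nc * Lx / (c / (4 * V)) = q3 at *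
  have e2 : 64 * (4 * V / c) / c * (Lf * ((1 + Lx) * x))
    = 64 * (4 * V / c) / c * (Lf * (1 + Lx)) * x := by ring
  rw [e2]
  generalize 64 * (4 * V / c) / c * (Lf * (1 + Lx)) = q2 at *
  have a1 := mul_nonneg hx0 t1
  have a2 := mul_nonneg hx0 t2
  have a3 := mul_nonneg hx0 t3
  have a4 := mul_nonneg hx0 hLx
  have e1 : (1 + Lx) * x = x * ((1 + Lx) / r) * r := by field_simp
  refine ⟨by linarith, by linarith, ?_, by linarith, by linarith⟩
  rw [e1]
  exact mul_le_of_le_one_left hr.le (by linarith)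

include h in
/-- The iterates with an inexact solver stay smooth distribution functions, and the starting points
of the inner solver stay at bounded distance from the path. -/
lemma inexact_solver
    (hS : ∀ w ∈ Icc (0 : ℝ) 1, ∀ u, ‖P.g (S w u) - xstar P w‖ ≤ η * ‖P.g u - xstar P w‖)
    (hη : 0 ≤ η) (hD : 1 ≤ D) (hN1 : 1 ≤ N) (hN : 32 * L / (c / (4 * V) * c) ≤ N)
    (hu₀ : ∀ n ≤ N, ‖P.g (u₀ n) - xstar P ((n : ℝ) / N)‖ ≤ D)
    (hbud : N * (D * η) ≤ noiseBudget c V Lx Lf r)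
    {l : ℝ} (hl : smoothConst c V L Lx Lf * max 1 ((N : ℝ) ^ 2 * (D * η)) ≤ l)
    (h0 : 0 < α) (h1 : α ≤ 1) (t : ℕ) :
    IsSmoothCDF (c / (4 * V)) (4 * V / c) l (surfCDF P S N α u₀ t) ∧
    IsSmoothCDF (c / (4 * V)) (4 * V / c) l (surfRebuilt P S N α u₀ t) ∧
    (∀ n ≤ N, ‖P.g (surfPoint P S N α u₀ t n) - xstar P (surfWeight P S N α u₀ t n)‖
      ≤ (1 + Lx) * (D * η)) ∧
    ∀ e, (∀ n ≤ N, ‖P.g (surfPoint P S N α u₀ t n) - xstar P (surfWeight P S N α u₀ t n)‖ ≤ e) →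
      e ≤ (1 + Lx) * (D * η) → ∀ x ∈ Icc (0 : ℝ) 1,
        |surfRebuilt P S N α u₀ t x - cdf P x| ≤
          discConst c V L / (N : ℝ) ^ 2 + noiseConst c V Lf * (N * e) := by
  have hV := h.V_pos
  have hc := h.curve.c_pos
  have hLx := h.Lx_nonneg
  have hLf := h.Lf_pos
  have hDη : 0 ≤ D * η := by positivity
  have hN' : (1 : ℝ) ≤ N := by exact_mod_cast hN1
  have hDηN : D * η ≤ N * (D * η) := le_mul_of_one_le_left hDη hN'
  obtain ⟨-, hspec⟩ := h.noiseBudget_spec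
  obtain ⟨-, -, -, b4, -⟩ := hspec _ (by positivity) hbud
  obtain ⟨-, b2, b3, -, -⟩ := hspec _ hDη (hDηN.trans hbud)
  have hs := h.smoothConst_nonneg
  have hl0 : 0 ≤ l := le_trans (by positivity) hl
  -- the rebuilding step
  have step : ∀ t, IsSmoothCDF (c / (4 * V)) (4 * V / c) l (surfCDF P S N α u₀ t) →
      ∀ e, (∀ n ≤ N,
        ‖P.g (surfPoint P S N α u₀ t n) - xstar P (surfWeight P S N α u₀ t n)‖ ≤ e) →
      e ≤ (1 + Lx) * (D * η) →
      IsSmoothCDF (c / (4 * V)) (4 * V / c) l (surfRebuilt P S N α u₀ t) ∧ ∀ x ∈ Icc (0 : ℝ) 1,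
        |surfRebuilt P S N α u₀ t x - cdf P x| ≤
          discConst c V L / (N : ℝ) ^ 2 + noiseConst c V Lf * (N * e) := by
    intro t ht e he hele
    have h5 := h.rebuild hN1 hN ht.1 ht.2.1 he (hele.trans b3) (le_trans (by
      have : N * e ≤ (1 + Lx) * (N * (D * η)) := by
        calc N * e ≤ N * ((1 + Lx) * (D * η)) := by gcongr
          _ = _ := by ring
      gcongr) b4) hele
    exact ⟨⟨h5.1.1, h5.1.2.1, h5.1.2.2.mono hl⟩, h5.2⟩
  have err : ∀ t, IsSmoothCDF (c / (4 * V)) (4 * V / c) l (surfCDF P S N α u₀ t) →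
      (∀ n ≤ N, ‖P.g ((surf P S N α u₀ t).2 n) - xstar P (surfWeight P S N α u₀ t n)‖
        ≤ (1 + Lx) * D) → ∀ n ≤ N,
        ‖P.g (surfPoint P S N α u₀ t n) - xstar P (surfWeight P S N α u₀ t n)‖
          ≤ (1 + Lx) * (D * η) := by
    intro t ht hst n hn
    rw [surfPoint_eq]
    refine (hS _ (ht.1.weights_spec hn).1 _).trans ?_
    calc _ ≤ η * ((1 + Lx) * D) := by gcongr; exact hst n hn
      _ = _ := by ring
  -- After a solve the distance to the old target is at most `(1 + Lx) D η ≤ 1`, and the target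
  -- moves by at most `Lx` because both weights lie in `[0,1]`. The total `1 + Lx` is at most `(1 +
  -- Lx) D` as `1 ≤ D`, so warm-start distances do not accumulate.
  have inv : ∀ t, IsSmoothCDF (c / (4 * V)) (4 * V / c) l (surfCDF P S N α u₀ t) ∧
      ∀ n ≤ N, ‖P.g ((surf P S N α u₀ t).2 n) - xstar P (surfWeight P S N α u₀ t n)‖
        ≤ (1 + Lx) * D := by
    intro t
    induction t with
    | zero =>
      refine ⟨.id h.lower_le_one h.one_le_upper hl0, fun n hn => ?_⟩
      have : surfWeight P S N α u₀ 0 n = (n : ℝ) / N := weights_id hn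
      rw [this]
      refine (hu₀ n hn).trans ?_
      nlinarith
    | succ t ih =>
      obtain ⟨ih1, ih2⟩ := ih
      have he := err t ih1 ih2
      have h6 : IsSmoothCDF (c / (4 * V)) (4 * V / c) l (surfCDF P S N α u₀ (t + 1)) := by
        rw [surfCDF_succ]; exact ((step t ih1 _ he le_rfl).1).mix ih1 h0 h1
      refine ⟨h6, fun n hn => ?_⟩
      have hw1 := (ih1.1.weights_spec hn).1
      have hw2 := (h6.1.weights_spec hn).1
      have h7 : ‖xstar P (surfWeight P S N α u₀ t n) - xstar P (surfWeight P S N α u₀ (t + 1) n)‖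
          ≤ Lx * 1 := by
        refine (h.lip_path _ hw1 _ hw2).trans (mul_le_mul_of_nonneg_left ?_ hLx)
        exact abs_le.2 ⟨by linarith [hw1.1, hw2.2], by linarith [hw1.2, hw2.1]⟩
      have h8 : ‖P.g ((surf P S N α u₀ (t + 1)).2 n) - xstar P (surfWeight P S N α u₀ t n)‖
          ≤ (1 + Lx) * (D * η) := he n hn
      refine (norm_sub_le_norm_sub_add_norm_sub _ _ _).trans ((add_le_add h8 h7).trans ?_)
      nlinarith
  obtain ⟨i1, i2⟩ := inv t
  exact ⟨i1, (step t i1 _ (err t i1 i2) le_rfl).1, err t i1 i2, fun e he hele => (step t i1 e he hele).2⟩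

end Inexact

end PathRegular

end Iteration

/-! ### Coupled contraction of CDF error and inner error. -/

section Contraction

variable {U : Type*} {d p q : ℕ} {P : Problem U d p q} {F' : ℝ → Vec 2} {c V L Lx Lf r : ℝ}
variable {S : ℝ → U → U} {η D α : ℝ} {N : ℕ} {u₀ : ℕ → U}

lemma le_innerError (t : ℕ) {n : ℕ} (hn : n ≤ N) :
    ‖P.g (surfPoint P S N α u₀ t n) - xstar P (surfWeight P S N α u₀ t n)‖
      ≤ innerError P S N α u₀ t :=
  Finset.le_sup' (fun n => ‖P.g (surfPoint P S N α u₀ t n) - xstar P (surfWeight P S N α u₀ t n)‖)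
    (Finset.mem_range.2 (Nat.lt_succ_of_le hn))

lemma innerError_le {t : ℕ} {C : ℝ}
    (h : ∀ n ≤ N, ‖P.g (surfPoint P S N α u₀ t n) - xstar P (surfWeight P S N α u₀ t n)‖ ≤ C) :
    innerError P S N α u₀ t ≤ C :=
  Finset.sup'_le _ _ fun n hn => h n (Nat.le_of_lt_succ (Finset.mem_range.1 hn))

lemma innerError_nonneg (t : ℕ) : 0 ≤ innerError P S N α u₀ t :=
  (norm_nonneg _).trans (le_innerError t (Nat.zero_le _))

/-- Arithmetic of the coupled error recursion. -/
lemma coupled_contraction {E E' e e' R b C κ : ℝ} (hE : 0 ≤ E) (he : 0 ≤ e) (hb : 0 ≤ b)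
    (hC : 0 ≤ C) (hκ : 0 ≤ κ) (h0 : 0 < α) (h1 : α ≤ 1 / 2) (hη : 8 * η ≤ 1)
    (hCκ : 4 * (C * κ) ≤ 1) (hR : R ≤ b + C / 2 * e) (hE' : E' ≤ α * R + (1 - α) * E)
    (he' : e' ≤ η * e + κ * (α * (R + E))) :
    E' + C * e' ≤ (1 - α / 4) * (E + C * e) + α * (2 * b) := by
  -- The coefficient of `E` becomes at most `1 - α + α/4`, that of `C e` at most `α/2 + 1/8 + α/8`,
  -- and that of `b` at most `5α/4`.
  have h2 : C * e' ≤ C * (η * e + κ * (α * (R + E))) := mul_le_mul_of_nonneg_left he' hC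
  have hnn : 0 ≤ α * (b + C / 2 * e + E) := by positivity
  have h3 : C * κ * (α * (R + E)) ≤ 1 / 4 * (α * (b + C / 2 * e + E)) := by
    calc _ ≤ C * κ * (α * (b + C / 2 * e + E)) := by gcongr
      _ ≤ _ := mul_le_mul_of_nonneg_right (by linarith) hnn
  have h4 : α * R ≤ α * (b + C / 2 * e) := mul_le_mul_of_nonneg_left hR h0.le
  have h5 : η * (C * e) ≤ 1 / 8 * (C * e) :=
    mul_le_mul_of_nonneg_right (by linarith) (mul_nonneg hC he)
  have h6 : α * (C * e) ≤ 1 / 2 * (C * e) := mul_le_mul_of_nonneg_right h1 (mul_nonneg hC he)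
  have h7 : 0 ≤ α * b := mul_nonneg h0.le hb
  have h9 : 0 ≤ C * e := mul_nonneg hC he
  linarith

/-- The weight `C = 2 * noiseConst * N` makes the inner error enter the rebuilding error as `(C/2)
e`. The defect of each step is `α` times twice the discretization error; summed with ratio `1 - α/4`
it yields the factor 8, independently of `α`. -/
lemma PathRegular.combinedError_le (h : PathRegular P F' c V L Lx Lf r)
    (hS : ∀ w ∈ Icc (0 : ℝ) 1, ∀ u, ‖P.g (S w u) - xstar P w‖ ≤ η * ‖P.g u - xstar P w‖)
    (hη : 0 ≤ η) (hD : 1 ≤ D) (hN1 : 1 ≤ N) (hN : 32 * L / (c / (4 * V) * c) ≤ N)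
    (hu₀ : ∀ n ≤ N, ‖P.g (u₀ n) - xstar P ((n : ℝ) / N)‖ ≤ D)
    (hbud : N * (D * η) ≤ noiseBudget c V Lx Lf r) (h0 : 0 < α) (h1 : α ≤ 1 / 2) (t : ℕ) :
    combinedError P (2 * noiseConst c V Lf * N) S N α u₀ t ≤
      (1 - α / 4) ^ t * combinedError P (2 * noiseConst c V Lf * N) S N α u₀ 0
        + 8 * discConst c V L / (N : ℝ) ^ 2 := by
  have hV := h.V_pos
  have hc := h.curve.c_pos
  have hLx := h.Lx_nonneg
  have hC1 := h.noiseConst_pos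
  have hB1 := h.discConst_nonneg
  have hN' : (1 : ℝ) ≤ N := by exact_mod_cast hN1
  have hm0 : 0 < c / (4 * V) := by positivity
  obtain ⟨-, hspec⟩ := h.noiseBudget_spec
  have hηN : N * η ≤ N * (D * η) := by gcongr; exact le_mul_of_one_le_left hη hD
  obtain ⟨-, -, -, -, b5⟩ := hspec _ (by positivity) (hηN.trans hbud)
  obtain ⟨b1, -, -, -, -⟩ := hspec _ hη ((le_mul_of_one_le_left hη hN').trans (hηN.trans hbud))
  have main := h.inexact_solver hS hη hD hN1 hN hu₀ hbud le_rfl h0 (h1.trans (by norm_num))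
  have step : ∀ t, combinedError P (2 * noiseConst c V Lf * N) S N α u₀ (t + 1) ≤
      (1 - α / 4) * combinedError P (2 * noiseConst c V Lf * N) S N α u₀ t
        + α * (2 * (discConst c V L / (N : ℝ) ^ 2)) := by
    intro t
    obtain ⟨hφ, -, herr, hacc⟩ := main t
    obtain ⟨hφ', -, -, -⟩ := main (t + 1)
    have hpt : ∀ n ≤ N, ‖P.g (surfPoint P S N α u₀ t n) - xstar P (surfWeight P S N α u₀ t n)‖
        ≤ innerError P S N α u₀ t := fun n hn => le_innerError t hn
    -- the inner error is within the range in which the rebuilding estimate holds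
    have hin : innerError P S N α u₀ t ≤ (1 + Lx) * (D * η) := innerError_le herr
    have hR := hacc _ hpt hin
    refine coupled_contraction (R := discConst c V L / (N : ℝ) ^ 2
      + noiseConst c V Lf * (N * innerError P S N α u₀ t)) (κ := η * Lx / (c / (4 * V)))
      (hφ.1.supDist_nonneg h.isCDF_cdf) (innerError_nonneg t) (by positivity) (by positivity)
      (by positivity) h0 h1 b1 ?_ (le_of_eq (by ring)) ?_ ?_
    · refine le_trans (le_of_eq ?_) b5
      field_simp
      ring
    · refine supDist_le fun x hx => ?_
      rw [surfCDF_succ]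
      have e : α * surfRebuilt P S N α u₀ t x + (1 - α) * surfCDF P S N α u₀ t x - cdf P x
          = α * (surfRebuilt P S N α u₀ t x - cdf P x)
            + (1 - α) * (surfCDF P S N α u₀ t x - cdf P x) := by ring
      have hα' : 0 ≤ 1 - α := by linarith
      rw [e]
      refine (abs_add_le _ _).trans ?_
      rw [abs_mul, abs_mul, abs_of_pos h0, abs_of_nonneg hα']
      exact add_le_add (mul_le_mul_of_nonneg_left (hR x hx) h0.le)
        (mul_le_mul_of_nonneg_left (hφ.1.le_supDist h.isCDF_cdf hx) hα')
    · refine innerError_le fun n hn => ?_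
      have hw1 := (hφ.1.weights_spec hn).1
      have hw2 := (hφ'.1.weights_spec hn).1
      -- Old and new weights sit at the same level `n/N`, so their distance is controlled by the
      -- change of the CDF at the old weight. That change is `α` times rebuilt minus current, and is
      -- estimated through the limit `cdf P`.
      have hmove : c / (4 * V) *
          |surfWeight P S N α u₀ (t + 1) n - surfWeight P S N α u₀ t n| ≤
          α * (discConst c V L / (N : ℝ) ^ 2
            + noiseConst c V Lf * (N * innerError P S N α u₀ t)
            + supDist (surfCDF P S N α u₀ t) (cdf P)) := by
        refine (hφ'.2.1.mul_abs_weights_sub_le hφ.1 hφ'.1 hn).trans ?_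
        rw [surfCDF_succ]
        have e : ∀ a b c : ℝ, α * a + (1 - α) * b - b = α * ((a - c) - (b - c)) := by
          intros; ring
        dsimp only
        rw [e _ _ (cdf P (weights N (surfCDF P S N α u₀ t) n)), abs_mul, abs_of_pos h0]
        refine mul_le_mul_of_nonneg_left ((abs_sub _ _).trans ?_) h0.le
        exact add_le_add (hR _ hw1) (hφ.1.le_supDist h.isCDF_cdf hw1)
      have hlip := h.lip_path _ hw1 _ hw2
      rw [abs_sub_comm] at hlip
      rw [surfPoint_eq]
      refine (hS _ hw2 _).trans ?_
      have e1 : ‖P.g (surfPoint P S N α u₀ t n) - xstar P (surfWeight P S N α u₀ (t + 1) n)‖ ≤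
          innerError P S N α u₀ t + Lx * (α * (discConst c V L / (N : ℝ) ^ 2
            + noiseConst c V Lf * (N * innerError P S N α u₀ t)
            + supDist (surfCDF P S N α u₀ t) (cdf P)) / (c / (4 * V))) := by
        refine (norm_sub_le_norm_sub_add_norm_sub _ _ _).trans (add_le_add (hpt n hn) ?_)
        refine hlip.trans (mul_le_mul_of_nonneg_left ?_ hLx)
        rw [le_div_iff₀ hm0, mul_comm]
        exact hmove
      calc _ ≤ η * (innerError P S N α u₀ t + Lx * (α * (discConst c V L / (N : ℝ) ^ 2
            + noiseConst c V Lf * (N * innerError P S N α u₀ t)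
            + supDist (surfCDF P S N α u₀ t) (cdf P)) / (c / (4 * V)))) := by
            exact mul_le_mul_of_nonneg_left e1 hη
        _ = _ := by ring
  induction t with
  | zero =>
    rw [pow_zero, one_mul]
    have : 0 ≤ 8 * discConst c V L / (N : ℝ) ^ 2 := by positivity
    linarith
  | succ t ih =>
    refine (step t).trans ?_
    have hα' : 0 ≤ 1 - α / 4 := by linarith
    have h2 := mul_le_mul_of_nonneg_left ih hα'
    rw [pow_succ (1 - α / 4) t]
    have e : 8 * discConst c V L / (N : ℝ) ^ 2 = 8 * (discConst c V L / (N : ℝ) ^ 2) := by ring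
    rw [e] at h2 ⊢
    linarith

end Contraction

/-! ### Number of solver steps that meets the budget. -/

section Budget

/-- In logarithms the demand is `log G + log N ≤ K (-log ρ)`. Since `N β ≥ 2`, `log (N β)` is at
least `log 2`, so the additive constants can be absorbed into a multiple of it. -/
lemma linear_budget {A ρ D s β cη : ℝ} (hA : 0 < A) (hρ0 : 0 < ρ) (hρ1 : ρ < 1) (hD : 1 ≤ D)
    (hs : 0 < s) (hβ : 0 < β) (hcη : 0 < cη) : ∃ cK : ℝ, 0 < cK ∧
      ∀ η : ℕ → ℝ, (∀ K, η K ≤ A * ρ ^ K) → ∀ N : ℕ, 1 ≤ N → 2 ≤ N * β →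
        ∀ K : ℕ, cK * Real.log (N * β) ≤ K → D * η K ≤ cη * s / N := by
  have hl2 : 0 < Real.log 2 := Real.log_pos one_lt_two
  have hlρ : 0 < -Real.log ρ := neg_pos.2 (Real.log_neg hρ0 hρ1)
  set G := D * A / (cη * s) with hG
  have hG0 : 0 < G := by positivity
  refine ⟨(1 + (|Real.log G| + |Real.log β|) / Real.log 2) / (-Real.log ρ), by positivity, ?_⟩
  intro η hη N hN1 hN K hK
  have hN0 : (0 : ℝ) < N := by exact_mod_cast hN1
  have hlog : Real.log (N * β) = Real.log N + Real.log β := Real.log_mul hN0.ne' hβ.ne'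
  have h1 : Real.log G + Real.log N ≤ K * (-Real.log ρ) := by
    rw [div_mul_eq_mul_div, div_le_iff₀ hlρ] at hK
    refine le_trans ?_ hK
    have h2 : |Real.log G| + |Real.log β| ≤
        (|Real.log G| + |Real.log β|) / Real.log 2 * Real.log (N * β) := by
      rw [div_mul_eq_mul_div, le_div_iff₀ hl2]; gcongr
    have h3 := le_abs_self (Real.log G)
    have h4 := neg_abs_le (Real.log β)
    linarith
  have h5 : G * N * ρ ^ K ≤ 1 := by
    have hpos : 0 < G * N * ρ ^ K := by positivity
    rw [← Real.log_nonpos_iff hpos.le, Real.log_mul (by positivity) (by positivity),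
      Real.log_mul hG0.ne' hN0.ne', Real.log_pow]
    linarith
  calc D * η K ≤ D * (A * ρ ^ K) := by gcongr; exact hη K
    _ = (G * N * ρ ^ K) * (cη * s / N) := by rw [hG]; field_simp
    _ ≤ 1 * (cη * s / N) := by gcongr
    _ = _ := one_mul _

lemma sublinear_budget {A r D s cη : ℝ} (hA : 0 < A) (hr : 0 < r) (hD : 1 ≤ D)
    (hs : 0 < s) (hcη : 0 < cη) : ∃ cK : ℝ, 0 < cK ∧
      ∀ η : ℕ → ℝ, (∀ K : ℕ, 1 ≤ K → η K ≤ A * (K : ℝ) ^ (-r)) → ∀ N : ℕ, 1 ≤ N →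
        ∀ K : ℕ, cK * ((N : ℝ) / s) ^ (1 / r) ≤ K → D * η K ≤ cη * s / N := by
  refine ⟨(D * A / cη) ^ (1 / r), by positivity, ?_⟩
  intro η hη N hN1 K hK
  rw [← Real.mul_rpow (by positivity) (by positivity)] at hK
  have hbase : 0 < D * A / cη * (N / s) := by positivity
  have hK0 : (0 : ℝ) < K := lt_of_lt_of_le (by positivity) hK
  have hK1 : 1 ≤ K := by exact_mod_cast hK0
  have h1 : D * A / cη * (N / s) ≤ (K : ℝ) ^ r := by
    have := Real.rpow_le_rpow (by positivity) hK hr.le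
    rwa [← Real.rpow_mul hbase.le, one_div_mul_cancel hr.ne', Real.rpow_one] at this
  calc D * η K ≤ D * (A * (K : ℝ) ^ (-r)) := by gcongr; exact hη K hK1
    _ = D * A / (K : ℝ) ^ r := by rw [Real.rpow_neg hK0.le]; field_simp
    _ ≤ D * A / (D * A / cη * (N / s)) := by gcongr
    _ = _ := by field_simp

end Budget

/-! ### Differentiability of a path of KKT points. -/

section SaddlePath

variable {E K : Type*} [NormedAddCommGroup E] [NormedSpace ℝ E] [Fintype K]

/-- The KKT operator with Hessian `H` and constraint gradients `a`. -/
noncomputable def kktMap (H : E →L[ℝ] E →L[ℝ] ℝ) (a : K → E →L[ℝ] ℝ) :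
    E × (K → ℝ) →ₗ[ℝ] (E →L[ℝ] ℝ) × (K → ℝ) where
  toFun z := (H z.1 + ∑ k, z.2 k • a k, fun k => a k z.1)
  map_add' y z := by
    ext <;> simp [add_smul, Finset.sum_add_distrib]
    ring
  map_smul' t z := by
    ext <;> simp [Finset.mul_sum, mul_assoc]

/-- For a kernel element, evaluating the first component at `y` kills the constraint terms and
leaves `H y y = 0`. So `y = 0`, and independence removes the multiplier. -/
lemma kktMap_injective {H : E →L[ℝ] E →L[ℝ] ℝ} {a : K → E →L[ℝ] ℝ}
    (hH : ∀ y, (∀ k, a k y = 0) → y ≠ 0 → 0 < H y y)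
    (ha : ∀ l : K → ℝ, ∑ k, l k • a k = 0 → l = 0) : Function.Injective (kktMap H a) := by
  rw [← LinearMap.ker_eq_bot, LinearMap.ker_eq_bot']
  rintro ⟨y, l⟩ hz
  have h1 : H y + ∑ k, l k • a k = 0 := congrArg Prod.fst hz
  have h2 : ∀ k, a k y = 0 := fun k => congrFun (congrArg Prod.snd hz) k
  have h3 : H y y = 0 := by
    have := congrArg (fun φ : E →L[ℝ] ℝ => φ y) h1
    simpa [h2] using this
  have hy : y = 0 := by
    by_contra hy
    exact absurd h3 (hH y h2 hy).ne'
  subst hy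
  rw [map_zero, zero_add] at h1
  rw [ha l h1]; rfl

lemma kktMap_surjective [FiniteDimensional ℝ E] {H : E →L[ℝ] E →L[ℝ] ℝ} {a : K → E →L[ℝ] ℝ}
    (h : Function.Injective (kktMap H a)) : Function.Surjective (kktMap H a) := by
  have e : Module.finrank ℝ (E →L[ℝ] ℝ) = Module.finrank ℝ E := by
    rw [← (LinearMap.toContinuousLinearMap (𝕜 := ℝ) (E := E) (F' := ℝ)).finrank_eq]
    exact Subspace.dual_finrank_eq
  refine (LinearMap.injective_iff_surjective_of_finrank_eq_finrank ?_).1 h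
  rw [Module.finrank_prod, Module.finrank_prod, e]

/-- A continuous family of injective linear maps over `[0,1]` is uniformly bounded below. -/
lemma exists_uniform_lower_bound {Z Z' : Type*} [NormedAddCommGroup Z] [NormedSpace ℝ Z]
    [FiniteDimensional ℝ Z] [NormedAddCommGroup Z'] [NormedSpace ℝ Z'] {A : ℝ → Z →ₗ[ℝ] Z'}
    (hc : ContinuousOn (fun t : ℝ × Z => A t.1 t.2) (Icc 0 1 ×ˢ Metric.sphere 0 1))
    (hinj : ∀ w ∈ Icc (0 : ℝ) 1, Function.Injective (A w)) :
    ∃ κ : ℝ, 0 < κ ∧ ∀ w ∈ Icc (0 : ℝ) 1, ∀ z, κ * ‖z‖ ≤ ‖A w z‖ := by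
  have := FiniteDimensional.proper_real Z
  have hT : IsCompact (Icc (0 : ℝ) 1 ×ˢ Metric.sphere (0 : Z) 1) :=
    isCompact_Icc.prod (isCompact_sphere 0 1)
  have hunit : ∀ z : Z, z ≠ 0 → ‖z‖⁻¹ • z ∈ Metric.sphere (0 : Z) 1 := fun z hz => by
    simp [norm_smul, norm_ne_zero_iff.2 hz]
  -- The sphere is empty only when `Z` is trivial, in which case any constant works.
  by_cases hne : (Icc (0 : ℝ) 1 ×ˢ Metric.sphere (0 : Z) 1).Nonempty
  · obtain ⟨⟨w₀, z₀⟩, ⟨hw₀, hz₀⟩, hmin⟩ := hT.exists_isMinOn hne hc.norm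
    rw [isMinOn_iff] at hmin
    have hz₀' : z₀ ≠ 0 := by
      rintro rfl
      simp at hz₀
    refine ⟨‖A w₀ z₀‖, norm_pos_iff.2 fun hcon => hz₀' (hinj w₀ hw₀ (hcon.trans (map_zero _).symm)),
      fun w hw z => ?_⟩
    by_cases hz : z = 0
    · simp [hz]
    have h1 : ‖A w₀ z₀‖ ≤ ‖A w (‖z‖⁻¹ • z)‖ := hmin (w, ‖z‖⁻¹ • z) ⟨hw, hunit z hz⟩
    rwa [map_smul, norm_smul, norm_inv, norm_norm, inv_mul_eq_div,
      le_div_iff₀ (norm_pos_iff.2 hz)] at h1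
  · refine ⟨1, one_pos, fun w hw z => ?_⟩
    by_cases hz : z = 0
    · simp [hz]
    · exact absurd ⟨(w, ‖z‖⁻¹ • z), hw, hunit z hz⟩ hne

/-- A solution path of parametrized KKT systems with gradients `g₀`, `g₁` of the two objectives,
constraints `b k` with gradients `a k`, multipliers `ν` and Hessians `H`. -/
structure SaddlePath (x : ℝ → E) (ν : ℝ → K → ℝ) (g₀ g₁ : E → E →L[ℝ] ℝ) (b : K → E → ℝ)
    (a : K → E → E →L[ℝ] ℝ) (H : ℝ → E →L[ℝ] E →L[ℝ] ℝ) (Lx Lg La LH G : ℝ) : Prop where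
  stationary : ∀ w ∈ Icc (0 : ℝ) 1,
    w • g₀ (x w) + (1 - w) • g₁ (x w) + ∑ k, ν w k • a k (x w) = 0
  hessian : ∀ w ∈ Icc (0 : ℝ) 1,
    HasFDerivAt (fun y => w • g₀ y + (1 - w) • g₁ y + ∑ k, ν w k • a k y) (H w) (x w)
  active : ∀ w ∈ Icc (0 : ℝ) 1, ∀ k, b k (x w) = 0
  jac : ∀ w ∈ Icc (0 : ℝ) 1, ∀ k, HasFDerivAt (b k) (a k (x w)) (x w)
  posDef : ∀ w ∈ Icc (0 : ℝ) 1, ∀ y, (∀ k, a k (x w) y = 0) → y ≠ 0 → 0 < H w y y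
  indep : ∀ w ∈ Icc (0 : ℝ) 1, ∀ l : K → ℝ, ∑ k, l k • a k (x w) = 0 → l = 0
  lip_x : ∀ w ∈ Icc (0 : ℝ) 1, ∀ w' ∈ Icc (0 : ℝ) 1, ‖x w - x w'‖ ≤ Lx * |w - w'|
  lip_g₀ : ∀ w ∈ Icc (0 : ℝ) 1, ∀ w' ∈ Icc (0 : ℝ) 1, ‖g₀ (x w) - g₀ (x w')‖ ≤ Lg * |w - w'|
  lip_g₁ : ∀ w ∈ Icc (0 : ℝ) 1, ∀ w' ∈ Icc (0 : ℝ) 1, ‖g₁ (x w) - g₁ (x w')‖ ≤ Lg * |w - w'|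
  lip_a : ∀ w ∈ Icc (0 : ℝ) 1, ∀ w' ∈ Icc (0 : ℝ) 1, ∀ k,
    ‖a k (x w) - a k (x w')‖ ≤ La * |w - w'|
  La_nonneg : 0 ≤ La
  lip_H : ∀ w ∈ Icc (0 : ℝ) 1, ∀ w' ∈ Icc (0 : ℝ) 1, ‖H w - H w'‖ ≤ LH * |w - w'|
  bound_g₀ : ∀ w ∈ Icc (0 : ℝ) 1, ‖g₀ (x w)‖ ≤ G
  bound_g₁ : ∀ w ∈ Icc (0 : ℝ) 1, ‖g₁ (x w)‖ ≤ G

lemma continuousOn_of_lip {F : Type*} [SeminormedAddCommGroup F] {f : ℝ → F} {L : ℝ}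
    (h : ∀ w ∈ Icc (0 : ℝ) 1, ∀ w' ∈ Icc (0 : ℝ) 1, ‖f w - f w'‖ ≤ L * |w - w'|) :
    ContinuousOn f (Icc 0 1) := by
  have : LipschitzOnWith (Real.toNNReal L) f (Icc 0 1) := by
    refine LipschitzOnWith.of_dist_le_mul fun w hw w' hw' => ?_
    rw [dist_eq_norm, Real.dist_eq]
    exact (h w hw w' hw').trans
      (mul_le_mul_of_nonneg_right (Real.le_coe_toNNReal L) (abs_nonneg _))
  exact this.continuousOn

lemma norm_sum_smul_le {F : Type*} [SeminormedAddCommGroup F] [NormedSpace ℝ F] (l : K → ℝ)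
    (v : K → F) {C : ℝ} (hv : ∀ k, ‖v k‖ ≤ C) : ‖∑ k, l k • v k‖ ≤ Fintype.card K * (‖l‖ * C) := by
  refine (norm_sum_le _ _).trans ?_
  rw [← nsmul_eq_mul, ← Finset.card_univ]
  refine Finset.sum_le_card_nsmul _ _ _ fun k _ => ?_
  rw [norm_smul]
  exact mul_le_mul (norm_le_pi_norm l k) (hv k) (norm_nonneg _) (norm_nonneg _)

lemma sum_sub_smul {F : Type*} [AddCommGroup F] [Module ℝ F] (l l' : K → ℝ) (v : K → F) :
    ∑ k, (l - l') k • v k = ∑ k, l k • v k - ∑ k, l' k • v k := by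
  simp only [Pi.sub_apply, sub_smul, Finset.sum_sub_distrib]

lemma sum_smul_sub {F : Type*} [AddCommGroup F] [Module ℝ F] (l : K → ℝ) (v v' : K → F) :
    ∑ k, l k • (v k - v' k) = ∑ k, l k • v k - ∑ k, l k • v' k := by
  simp only [smul_sub, Finset.sum_sub_distrib]

lemma sum_smul_smul {F : Type*} [AddCommGroup F] [Module ℝ F] (t : ℝ) (l : K → ℝ) (v : K → F) :
    ∑ k, (t • l) k • v k = t • ∑ k, l k • v k := by
  simp only [Pi.smul_apply, Finset.smul_sum, smul_assoc]

namespace SaddlePath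

variable [FiniteDimensional ℝ E] {x : ℝ → E} {ν : ℝ → K → ℝ} {g₀ g₁ : E → E →L[ℝ] ℝ} {b : K → E → ℝ}
  {a : K → E → E →L[ℝ] ℝ} {H : ℝ → E →L[ℝ] E →L[ℝ] ℝ} {Lx Lg La LH G : ℝ}

omit [FiniteDimensional ℝ E] in
lemma injective (h : SaddlePath x ν g₀ g₁ b a H Lx Lg La LH G) {w : ℝ} (hw : w ∈ Icc (0 : ℝ) 1) :
    Function.Injective (kktMap (H w) fun k => a k (x w)) :=
  kktMap_injective (h.posDef w hw) (h.indep w hw)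

omit [FiniteDimensional ℝ E] in
lemma continuousOn_kktMap (h : SaddlePath x ν g₀ g₁ b a H Lx Lg La LH G) :
    ContinuousOn (fun t : ℝ × (E × (K → ℝ)) => kktMap (H t.1) (fun k => a k (x t.1)) t.2)
      (Icc 0 1 ×ˢ Metric.sphere 0 1) := by
  have hHc : ContinuousOn H (Icc 0 1) :=
    continuousOn_of_lip (F := E →L[ℝ] E →L[ℝ] ℝ) h.lip_H
  have hac : ∀ k, ContinuousOn (fun w => a k (x w)) (Icc 0 1) := fun k =>
    continuousOn_of_lip fun w hw w' hw' => h.lip_a w hw w' hw' k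
  generalize hT : (Icc 0 1 ×ˢ Metric.sphere 0 1 : Set (ℝ × (E × (K → ℝ)))) = T
  have hmaps : MapsTo (fun t : ℝ × (E × (K → ℝ)) => t.1) T (Icc 0 1) := by
    rw [← hT]; exact fun t ht => ht.1
  have hz1 : ContinuousOn (fun t : ℝ × (E × (K → ℝ)) => t.2.1) T :=
    (continuous_fst.comp continuous_snd).continuousOn
  have hz2 : ∀ k, ContinuousOn (fun t : ℝ × (E × (K → ℝ)) => t.2.2 k) T := fun k =>
    ((continuous_apply k).comp (continuous_snd.comp continuous_snd)).continuousOn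
  refine ContinuousOn.prodMk ?_ ?_
  · refine ((hHc.comp continuousOn_fst hmaps).clm_apply hz1).add
      (continuousOn_finsetSum _ fun k _ => ?_)
    exact (hz2 k).smul ((hac k).comp continuousOn_fst hmaps)
  · exact continuousOn_pi.2 fun k => ((hac k).comp continuousOn_fst hmaps).clm_apply hz1

/-- The KKT operators are bounded below uniformly along the path. -/
lemma exists_lower_bound (h : SaddlePath x ν g₀ g₁ b a H Lx Lg La LH G) :
    ∃ κ : ℝ, 0 < κ ∧ ∀ w ∈ Icc (0 : ℝ) 1, ∀ z : E × (K → ℝ),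
      κ * ‖z‖ ≤ ‖kktMap (H w) (fun k => a k (x w)) z‖ :=
  exists_uniform_lower_bound h.continuousOn_kktMap fun _ hw => h.injective hw

/-- On vectors `(0, l)` the KKT bound is a uniform version of LICQ. Applied to `ν w`, it bounds the
multipliers; applied to `ν w - ν w'`, with the two stationarity equations subtracted, it leaves only
increments of the data. -/
lemma exists_lip_multiplier (h : SaddlePath x ν g₀ g₁ b a H Lx Lg La LH G) :
    ∃ Lν : ℝ, 0 ≤ Lν ∧ ∀ w ∈ Icc (0 : ℝ) 1, ∀ w' ∈ Icc (0 : ℝ) 1, ‖ν w - ν w'‖ ≤ Lν * |w - w'| := by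
  obtain ⟨κ, hκ, hlow⟩ := h.exists_lower_bound
  have hlow' : ∀ w ∈ Icc (0 : ℝ) 1, ∀ l : K → ℝ, κ * ‖l‖ ≤ ‖∑ k, l k • a k (x w)‖ := by
    intro w hw l
    have := hlow w hw (0, l)
    have e : kktMap (H w) (fun k => a k (x w)) (0, l) = (∑ k, l k • a k (x w), 0) := by
      ext <;> simp [kktMap]
    rw [e, Prod.norm_def, Prod.norm_def, norm_zero, norm_zero, max_eq_right (norm_nonneg _),
      max_eq_left (norm_nonneg _)] at this
    exact this
  have hLa := h.La_nonneg
  have hG : 0 ≤ G := (norm_nonneg _).trans (h.bound_g₀ 0 ⟨le_rfl, zero_le_one⟩)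
  have hLg : 0 ≤ Lg := by
    have := (norm_nonneg _).trans (h.lip_g₀ 0 ⟨le_rfl, zero_le_one⟩ 1 ⟨zero_le_one, le_rfl⟩)
    simpa using this
  have hbd : ∀ w ∈ Icc (0 : ℝ) 1, ‖ν w‖ ≤ 2 * G / κ := by
    intro w hw
    rw [le_div_iff₀ hκ, mul_comm]
    refine (hlow' w hw _).trans ?_
    rw [eq_neg_of_add_eq_zero_right (h.stationary w hw), norm_neg]
    refine (norm_add_le _ _).trans ?_
    rw [norm_smul, norm_smul, Real.norm_of_nonneg hw.1, Real.norm_of_nonneg (sub_nonneg.2 hw.2)]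
    have h1 := mul_le_mul hw.2 (h.bound_g₀ w hw) (norm_nonneg _) zero_le_one
    have h2 := mul_le_mul (sub_le_self 1 hw.1) (h.bound_g₁ w hw) (norm_nonneg _) zero_le_one
    linarith
  refine ⟨(2 * G + 2 * Lg + Fintype.card K * (2 * G / κ * La)) / κ, by positivity,
    fun w hw w' hw' => ?_⟩
  rw [div_mul_eq_mul_div, le_div_iff₀ hκ, mul_comm]
  refine (hlow' w hw _).trans ?_
  have e : ∑ k, (ν w - ν w') k • a k (x w) = -((w - w') • (g₀ (x w') - g₁ (x w'))
      + (w • (g₀ (x w) - g₀ (x w')) + (1 - w) • (g₁ (x w) - g₁ (x w')))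
      + ∑ k, ν w' k • (a k (x w) - a k (x w'))) := by
    have h1 := h.stationary w hw
    have h2 := h.stationary w' hw'
    have e1 : ∑ k, (ν w - ν w') k • a k (x w)
        = ∑ k, ν w k • a k (x w) - ∑ k, ν w' k • a k (x w) := sum_sub_smul _ _ _
    have e2 : ∑ k, ν w' k • (a k (x w) - a k (x w'))
        = ∑ k, ν w' k • a k (x w) - ∑ k, ν w' k • a k (x w') := sum_smul_sub _ _ _
    rw [e1, e2, eq_neg_of_add_eq_zero_right h1, eq_neg_of_add_eq_zero_right h2]
    module
  rw [e, norm_neg]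
  refine (norm_add₃_le).trans ?_
  have b1 : ‖(w - w') • (g₀ (x w') - g₁ (x w'))‖ ≤ 2 * G * |w - w'| := by
    rw [norm_smul, Real.norm_eq_abs, mul_comm]
    refine mul_le_mul_of_nonneg_right ((norm_sub_le _ _).trans ?_) (abs_nonneg _)
    linarith [h.bound_g₀ w' hw', h.bound_g₁ w' hw']
  have b2 : ‖w • (g₀ (x w) - g₀ (x w')) + (1 - w) • (g₁ (x w) - g₁ (x w'))‖
      ≤ 2 * Lg * |w - w'| := by
    refine (norm_add_le _ _).trans ?_
    rw [norm_smul, norm_smul, Real.norm_of_nonneg hw.1, Real.norm_of_nonneg (sub_nonneg.2 hw.2)]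
    have h1 := mul_le_mul hw.2 (h.lip_g₀ w hw w' hw') (norm_nonneg _) zero_le_one
    have h2 := mul_le_mul (sub_le_self 1 hw.1) (h.lip_g₁ w hw w' hw') (norm_nonneg _) zero_le_one
    linarith
  have b3 : ‖∑ k, ν w' k • (a k (x w) - a k (x w'))‖ ≤
      Fintype.card K * (2 * G / κ * La) * |w - w'| := by
    refine (norm_sum_smul_le _ _ (h.lip_a w hw w' hw')).trans ?_
    calc _ ≤ Fintype.card K * (2 * G / κ * (La * |w - w'|)) := by gcongr; exact hbd w' hw'
      _ = _ := by ring
  linarith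

/-- The solution path is differentiable with Lipschitz derivative, which solves the linearized KKT
system. -/
theorem exists_deriv (h : SaddlePath x ν g₀ g₁ b a H Lx Lg La LH G) :
    ∃ (x' : ℝ → E) (l : ℝ → K → ℝ) (C : ℝ),
      (∀ w ∈ Icc (0 : ℝ) 1, HasDerivWithinAt x (x' w) (Icc 0 1) w) ∧
      (∀ w ∈ Icc (0 : ℝ) 1,
        H w (x' w) + ∑ k, l w k • a k (x w) = -(g₀ (x w) - g₁ (x w))) ∧
      (∀ w ∈ Icc (0 : ℝ) 1, ∀ k, a k (x w) (x' w) = 0) ∧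
      (∀ w ∈ Icc (0 : ℝ) 1, ∀ w' ∈ Icc (0 : ℝ) 1, ‖x' w - x' w'‖ ≤ C * |w - w'|) := by
  obtain ⟨κ, hκ, hlow⟩ := h.exists_lower_bound
  obtain ⟨Lν, hLν, hν⟩ := h.exists_lip_multiplier
  have hLa := h.La_nonneg
  have hG : 0 ≤ G := (norm_nonneg _).trans (h.bound_g₀ 0 ⟨le_rfl, zero_le_one⟩)
  have hLg : 0 ≤ Lg := by
    have := (norm_nonneg _).trans (h.lip_g₀ 0 ⟨le_rfl, zero_le_one⟩ 1 ⟨zero_le_one, le_rfl⟩)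
    simpa using this
  have hLH : 0 ≤ LH := by
    have := (norm_nonneg (H 0 - H 1)).trans (h.lip_H 0 ⟨le_rfl, zero_le_one⟩ 1 ⟨zero_le_one, le_rfl⟩)
    simpa using this
  have hex : ∀ w, ∃ z : E × (K → ℝ), w ∈ Icc (0 : ℝ) 1 →
      kktMap (H w) (fun k => a k (x w)) z = (-(g₀ (x w) - g₁ (x w)), 0) := by
    intro w
    by_cases hw : w ∈ Icc (0 : ℝ) 1
    · obtain ⟨z, hz⟩ := kktMap_surjective (h.injective hw) (-(g₀ (x w) - g₁ (x w)), 0)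
      exact ⟨z, fun _ => hz⟩
    · exact ⟨0, fun hw' => absurd hw' hw⟩
  choose z hz using hex
  have hz1 : ∀ w ∈ Icc (0 : ℝ) 1,
      H w (z w).1 + ∑ k, (z w).2 k • a k (x w) = -(g₀ (x w) - g₁ (x w)) :=
    fun w hw => congrArg Prod.fst (hz w hw)
  have hz2 : ∀ w ∈ Icc (0 : ℝ) 1, ∀ k, a k (x w) (z w).1 = 0 :=
    fun w hw k => congrFun (congrArg Prod.snd (hz w hw)) k
  have hzb : ∀ w ∈ Icc (0 : ℝ) 1, ‖z w‖ ≤ 2 * G / κ := by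
    intro w hw
    rw [le_div_iff₀ hκ, mul_comm]
    refine (hlow w hw _).trans ?_
    rw [hz w hw, Prod.norm_def, norm_zero, max_eq_left (norm_nonneg _), norm_neg]
    refine (norm_sub_le _ _).trans ?_
    linarith [h.bound_g₀ w hw, h.bound_g₁ w hw]
  refine ⟨fun w => (z w).1, fun w => (z w).2,
    (2 * Lg + (LH + Fintype.card K * La + La) * (2 * G / κ)) / κ, fun w hw => ?_, hz1, hz2,
    fun w hw w' hw' => ?_⟩
  · -- differentiability
    rw [hasDerivWithinAt_iff_isLittleO]
    have hxc : Tendsto x (𝓝[Icc 0 1] w) (𝓝 (x w)) := continuousOn_of_lip h.lip_x w hw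
    have hmem : ∀ᶠ w' in 𝓝[Icc 0 1] w, w' ∈ Icc (0 : ℝ) 1 := self_mem_nhdsWithin
    have hxO : (fun w' => x w' - x w) =O[𝓝[Icc 0 1] w] fun w' => w' - w := by
      refine Asymptotics.IsBigO.of_bound Lx ?_
      filter_upwards [hmem] with w' hw'
      exact h.lip_x w' hw' w hw
    -- Because `x` is Lipschitz, Taylor remainders in `x w' - x w` are little-o of `w' - w`.
    have o1 := (((h.hessian w hw).isLittleO).comp_tendsto hxc).trans_isBigO hxO
    have o2 := fun k => (((h.jac w hw k).isLittleO).comp_tendsto hxc).trans_isBigO hxO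
    have o3 : (fun w' : ℝ => (2 * Lg + Fintype.card K * (Lν * La)) * (w' - w) ^ 2)
        =o[𝓝[Icc 0 1] w] fun w' => w' - w := by
      refine Asymptotics.IsLittleO.const_mul_left ?_ _
      have h0 : Tendsto (fun w' : ℝ => w' - w) (𝓝[Icc 0 1] w) (𝓝 0) := by
        have : Tendsto (fun w' : ℝ => w' - w) (𝓝 w) (𝓝 (w - w)) := tendsto_id.sub_const w
        rw [sub_self] at this
        exact this.mono_left nhdsWithin_le_nhds
      have h1 := ((Asymptotics.isLittleO_one_iff ℝ).2 h0).mul_isBigO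
        (Asymptotics.isBigO_refl (fun w' : ℝ => w' - w) (𝓝[Icc 0 1] w))
      simpa [sq] using h1
    have o4 := ((o1.norm_left).add o3).add (Asymptotics.IsLittleO.sum
      (s := (Finset.univ : Finset K)) fun k _ => (o2 k).norm_left)
    refine Asymptotics.IsBigO.trans_isLittleO (Asymptotics.IsBigO.of_bound κ⁻¹ ?_) o4
    filter_upwards [hmem] with w' hw'
    rw [inv_mul_eq_div, le_div_iff₀ hκ, mul_comm]
    set δ := w' - w with hδ
    -- `Δ` is the true increment of point and multiplier minus the linear prediction. Its image
    -- under the KKT operator at `w` consists of Taylor remainders and products of two increments,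
    -- so the lower bound `κ` shows that `Δ` is little-o.
    set Δ : E × (K → ℝ) := (x w' - x w - δ • (z w).1, ν w' - ν w - δ • (z w).2) with hΔ
    have hle : ‖x w' - x w - δ • (z w).1‖ ≤ ‖Δ‖ := norm_fst_le Δ
    refine (mul_le_mul_of_nonneg_left hle hκ.le).trans ((hlow w hw Δ).trans ?_)
    simp only [Function.comp_def]
    have hnn : 0 ≤ (2 * Lg + Fintype.card K * (Lν * La)) * δ ^ 2 := by positivity
    rw [Finset.sum_apply, Real.norm_of_nonneg (add_nonneg (add_nonneg (norm_nonneg _) hnn)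
      (Finset.sum_nonneg fun k _ => norm_nonneg _)), Prod.norm_def]
    set Λ : E → E →L[ℝ] ℝ := fun y => w • g₀ y + (1 - w) • g₁ y + ∑ k, ν w k • a k y with hΛ
    have e1 : (kktMap (H w) (fun k => a k (x w)) Δ).1 = -((Λ (x w') - Λ (x w) - H w (x w' - x w))
        + δ • ((g₀ (x w') - g₀ (x w)) - (g₁ (x w') - g₁ (x w)))
        + ∑ k, (ν w' - ν w) k • (a k (x w') - a k (x w))) := by
      have s1 := hz1 w hw
      have s2 := h.stationary w hw
      have s3 := h.stationary w' hw'
      have e2 : (kktMap (H w) (fun k => a k (x w)) Δ).1 = H w (x w' - x w)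
          + (∑ k, ν w' k • a k (x w) - ∑ k, ν w k • a k (x w))
          - δ • (H w (z w).1 + ∑ k, (z w).2 k • a k (x w)) := by
        have t1 : ∑ k, (ν w' - ν w - δ • (z w).2) k • a k (x w) =
            ∑ k, ν w' k • a k (x w) - ∑ k, ν w k • a k (x w)
              - δ • ∑ k, (z w).2 k • a k (x w) := by
          have q1 := sum_sub_smul (ν w' - ν w) (δ • (z w).2) (fun k => a k (x w))
          have q2 := sum_sub_smul (ν w') (ν w) (fun k => a k (x w))
          have q3 := sum_smul_smul δ (z w).2 (fun k => a k (x w))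
          rw [q1, q2, q3]
        show H w (x w' - x w - δ • (z w).1) + ∑ k, (ν w' - ν w - δ • (z w).2) k • a k (x w) = _
        rw [t1, map_sub (H w) (x w' - x w), map_smul (H w)]
        module
      have e3 : ∑ k, (ν w' - ν w) k • (a k (x w') - a k (x w)) =
          ∑ k, ν w' k • a k (x w') - ∑ k, ν w' k • a k (x w) - ∑ k, ν w k • a k (x w')
          + ∑ k, ν w k • a k (x w) := by
        have t1 := sum_smul_sub (ν w' - ν w) (fun k => a k (x w')) (fun k => a k (x w))
        have t2 := sum_sub_smul (ν w') (ν w) (fun k => a k (x w'))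
        have t3 := sum_sub_smul (ν w') (ν w) (fun k => a k (x w))
        rw [t1, t2, t3]
        abel
      have e4 : Λ (x w) = 0 := s2
      rw [e2, e3, e4, s1, eq_neg_of_add_eq_zero_right s3]
      simp only [hΛ]
      rw [hδ]
      module
    have e2 : ∀ k, (kktMap (H w) (fun k => a k (x w)) Δ).2 k
        = -(b k (x w') - b k (x w) - a k (x w) (x w' - x w)) := by
      intro k
      show a k (x w) (x w' - x w - δ • (z w).1) = _
      rw [map_sub, map_smul, hz2 w hw k, h.active w hw k, h.active w' hw' k]
      simp
    refine max_le ?_ ?_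
    · rw [e1, norm_neg]
      refine (norm_add₃_le).trans ?_
      have b2 : ‖δ • ((g₀ (x w') - g₀ (x w)) - (g₁ (x w') - g₁ (x w)))‖ ≤ 2 * Lg * δ ^ 2 := by
        rw [norm_smul, Real.norm_eq_abs, ← sq_abs δ]
        have := (norm_sub_le (g₀ (x w') - g₀ (x w)) (g₁ (x w') - g₁ (x w))).trans
          (add_le_add (h.lip_g₀ w' hw' w hw) (h.lip_g₁ w' hw' w hw))
        calc _ ≤ |δ| * (Lg * |δ| + Lg * |δ|) := by gcongr
          _ = _ := by ring
      have b3 : ‖∑ k, (ν w' - ν w) k • (a k (x w') - a k (x w))‖ ≤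
          Fintype.card K * (Lν * La) * δ ^ 2 := by
        refine (norm_sum_smul_le _ _ (h.lip_a w' hw' w hw)).trans ?_
        calc _ ≤ Fintype.card K * ((Lν * |δ|) * (La * |δ|)) := by
              gcongr; exact hν w' hw' w hw
          _ = Fintype.card K * (Lν * La) * |δ| ^ 2 := by ring
          _ = _ := by rw [sq_abs]
      have b4 : 0 ≤ ∑ k, ‖b k (x w') - b k (x w) - a k (x w) (x w' - x w)‖ :=
        Finset.sum_nonneg fun k _ => norm_nonneg _
      linarith
    · refine (pi_norm_le_iff_of_nonneg (by positivity)).2 fun k => ?_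
      rw [e2 k, norm_neg]
      have := Finset.single_le_sum
        (f := fun k => ‖b k (x w') - b k (x w) - a k (x w) (x w' - x w)‖)
        (fun k _ => norm_nonneg _) (Finset.mem_univ k)
      have b1 : 0 ≤ ‖Λ (x w') - Λ (x w) - H w (x w' - x w)‖
          + (2 * Lg + Fintype.card K * (Lν * La)) * δ ^ 2 := add_nonneg (norm_nonneg _) hnn
      linarith
  -- Lipschitz derivative: the KKT operator at `w` sends `z w - z w'` to the change of the
  -- right-hand side minus the change of the operator applied to the bounded vector `z w'`.
  · rw [div_mul_eq_mul_div, le_div_iff₀ hκ, mul_comm]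
    have hle : ‖(z w).1 - (z w').1‖ ≤ ‖z w - z w'‖ := norm_fst_le (z w - z w')
    refine (mul_le_mul_of_nonneg_left hle hκ.le).trans ((hlow w hw _).trans ?_)
    rw [map_sub, hz w hw]
    have hb := hzb w' hw'
    have hb1 : ‖(z w').1‖ ≤ 2 * G / κ := (norm_fst_le _).trans hb
    have hb2 : ‖(z w').2‖ ≤ 2 * G / κ := (norm_snd_le _).trans hb
    rw [Prod.norm_def]
    refine max_le ?_ ?_
    · have e : (((-(g₀ (x w) - g₁ (x w)), 0) : (E →L[ℝ] ℝ) × (K → ℝ))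
          - kktMap (H w) (fun k => a k (x w)) (z w')).1
          = -((g₀ (x w) - g₀ (x w')) - (g₁ (x w) - g₁ (x w')))
            - ((H w - H w') (z w').1 + ∑ k, (z w').2 k • (a k (x w) - a k (x w'))) := by
        have s1 := hz1 w' hw'
        have s2 : g₁ (x w') = H w' (z w').1 + ∑ k, (z w').2 k • a k (x w') + g₀ (x w') := by
          rw [s1]; abel
        show -(g₀ (x w) - g₁ (x w)) - (H w (z w').1 + ∑ k, (z w').2 k • a k (x w)) = _
        have t1 := sum_smul_sub (z w').2 (fun k => a k (x w)) (fun k => a k (x w'))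
        rw [t1, sub_apply, s2]
        abel
      rw [e]
      refine (norm_sub_le _ _).trans ?_
      rw [norm_neg]
      have c1 := (norm_sub_le (g₀ (x w) - g₀ (x w')) (g₁ (x w) - g₁ (x w'))).trans
        (add_le_add (h.lip_g₀ w hw w' hw') (h.lip_g₁ w hw w' hw'))
      have c2 : ‖(H w - H w') (z w').1‖ ≤ LH * |w - w'| * (2 * G / κ) :=
        ((H w - H w').le_opNorm _).trans (by gcongr; exact h.lip_H w hw w' hw')
      have c3 : ‖∑ k, (z w').2 k • (a k (x w) - a k (x w'))‖ ≤
          Fintype.card K * La * (2 * G / κ) * |w - w'| := by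
        refine (norm_sum_smul_le _ _ (h.lip_a w hw w' hw')).trans ?_
        calc _ ≤ Fintype.card K * ((2 * G / κ) * (La * |w - w'|)) := by gcongr
          _ = _ := by ring
      have c4 := norm_add_le ((H w - H w') (z w').1) (∑ k, (z w').2 k • (a k (x w) - a k (x w')))
      have c5 : 0 ≤ La * (2 * G / κ) * |w - w'| := by positivity
      linarith
    · refine (pi_norm_le_iff_of_nonneg (by positivity)).2 fun k => ?_
      have e : (((-(g₀ (x w) - g₁ (x w)), 0) : (E →L[ℝ] ℝ) × (K → ℝ))
          - kktMap (H w) (fun k => a k (x w)) (z w')).2 k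
          = -((a k (x w) - a k (x w')) (z w').1) := by
        show (0 : ℝ) - a k (x w) (z w').1 = _
        rw [sub_apply, hz2 w' hw' k]; ring
      rw [e, norm_neg]
      have c1 : ‖(a k (x w) - a k (x w')) (z w').1‖ ≤ La * |w - w'| * (2 * G / κ) :=
        ((a k (x w) - a k (x w')).le_opNorm _).trans
          (by gcongr; exact h.lip_a w hw w' hw' k)
      have c2 : 0 ≤ (2 * Lg + (LH + Fintype.card K * La) * (2 * G / κ)) * |w - w'| := by positivity
      linarith

end SaddlePath

end SaddlePath

/-! ### First- and second-order consequences of strong convexity. -/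

section ConvexCalculus

variable {E : Type*} [NormedAddCommGroup E] [NormedSpace ℝ E]

lemma tendsto_line_slope {f : E → ℝ} {f' : E →L[ℝ] ℝ} {x : E} (hf : HasFDerivAt f f' x) (u : E) :
    Tendsto (fun t : ℝ => t⁻¹ * (f (x + t • u) - f x)) (𝓝[>] 0) (𝓝 (f' u)) := by
  have h1 : HasDerivAt (fun t : ℝ => f (x + t • u)) (f' u) 0 := hf.hasLineDerivAt u
  have h2 := (hasDerivWithinAt_iff_tendsto_slope' self_notMem_Ioi).1 (h1.hasDerivWithinAt (s := Ioi 0))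
  exact h2.congr fun t => by simp [slope_def_field, div_eq_inv_mul]

lemma nonneg_of_eventually_le {f : E → ℝ} {f' : E →L[ℝ] ℝ} {x u : E} (hf : HasFDerivAt f f' x)
    (h : ∀ᶠ t : ℝ in 𝓝[>] 0, f x ≤ f (x + t • u)) : 0 ≤ f' u := by
  refine ge_of_tendsto (tendsto_line_slope hf u) ?_
  filter_upwards [h, self_mem_nhdsWithin] with t ht ht0
  exact mul_nonneg (inv_nonneg.2 (le_of_lt ht0)) (sub_nonneg.2 ht)

lemma eventually_lt_of_neg {f : E → ℝ} {f' : E →L[ℝ] ℝ} {x u : E} (hf : HasFDerivAt f f' x)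
    (h : f' u < 0) : ∀ᶠ t : ℝ in 𝓝[>] 0, f (x + t • u) < f x := by
  filter_upwards [(tendsto_line_slope hf u).eventually_lt_const h, self_mem_nhdsWithin] with t ht ht0
  have h1 : 0 < t⁻¹ := inv_pos.2 ht0
  by_contra hcon
  exact absurd ht (not_lt.2 (mul_nonneg h1.le (sub_nonneg.2 (not_lt.1 hcon))))

/-- First-order characterization of strong convexity. -/
lemma StrongConvexOn.first_order {s : Set E} {μ : ℝ} {f : E → ℝ} (hf : StrongConvexOn s μ f) {x y : E}
    (hx : x ∈ s) (hy : y ∈ s) {f' : E →L[ℝ] ℝ} (hd : HasFDerivAt f f' x) :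
    f' (y - x) + μ / 2 * ‖y - x‖ ^ 2 ≤ f y - f x := by
  have h1 := tendsto_line_slope hd (y - x)
  have h2 : Tendsto (fun t : ℝ => f y - f x - (1 - t) * (μ / 2 * ‖y - x‖ ^ 2)) (𝓝[>] 0)
      (𝓝 (f y - f x - (1 - 0) * (μ / 2 * ‖y - x‖ ^ 2))) := by
    refine Tendsto.mono_left ?_ nhdsWithin_le_nhds
    exact Continuous.tendsto (by fun_prop) 0
  have h3 := le_of_tendsto_of_tendsto h1 h2 ?_
  · linarith
  · have hlt : ∀ᶠ t : ℝ in 𝓝[>] 0, t < 1 :=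
      (eventually_lt_nhds one_pos).filter_mono nhdsWithin_le_nhds
    filter_upwards [self_mem_nhdsWithin, hlt] with t ht ht1
    have ht : 0 < t := ht
    have h4 := hf.2 hx hy (sub_nonneg.2 ht1.le) ht.le (by ring)
    have e : (1 - t) • x + t • y = x + t • (y - x) := by
      rw [sub_smul, one_smul, smul_sub]; abel
    rw [e, norm_sub_rev] at h4
    simp only [smul_eq_mul] at h4
    rw [inv_mul_eq_div, div_le_iff₀ ht]
    linarith

lemma StrongConvexOn.strong_monotone {s : Set E} {μ : ℝ} {f : E → ℝ} (hf : StrongConvexOn s μ f)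
    {x y : E} (hx : x ∈ s) (hy : y ∈ s) {fx fy : E →L[ℝ] ℝ} (hdx : HasFDerivAt f fx x)
    (hdy : HasFDerivAt f fy y) : μ * ‖y - x‖ ^ 2 ≤ fy (y - x) - fx (y - x) := by
  have h1 := hf.first_order hx hy hdx
  have h2 := hf.first_order hy hx hdy
  rw [← neg_sub y x, map_neg, norm_neg] at h2
  linarith

/-- Second-order characterization of strong convexity in feasible directions. -/
lemma StrongConvexOn.second_order {s : Set E} {μ : ℝ} {f : E → ℝ} (hf : StrongConvexOn s μ f)
    {x u : E} (hx : x ∈ s) (hu : ∀ᶠ t : ℝ in 𝓝[>] 0, x + t • u ∈ s) {f' : E → E →L[ℝ] ℝ}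
    (hd : ∀ y ∈ s, HasFDerivAt f (f' y) y) {H : E →L[ℝ] E →L[ℝ] ℝ} (hH : HasFDerivAt f' H x) :
    μ * ‖u‖ ^ 2 ≤ H u u := by
  have h1 : HasFDerivAt (fun y => f' y u) ((ContinuousLinearMap.apply ℝ ℝ u).comp H) x :=
    (ContinuousLinearMap.apply ℝ ℝ u).hasFDerivAt.comp x hH
  refine ge_of_tendsto (tendsto_line_slope h1 u) ?_
  filter_upwards [hu, self_mem_nhdsWithin] with t ht ht0
  have ht0 : 0 < t := ht0
  have h2 := hf.strong_monotone hx ht (hd x hx) (hd _ ht)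
  rw [add_sub_cancel_left, map_smul, map_smul, norm_smul, Real.norm_of_nonneg ht0.le] at h2
  simp only [smul_eq_mul] at h2
  rw [inv_mul_eq_div, le_div_iff₀ ht0]
  have : t * (μ * ‖u‖ ^ 2 * t) ≤ t * (f' (x + t • u) u - f' x u) := by
    calc _ = μ * (t * ‖u‖) ^ 2 := by ring
      _ ≤ _ := by linarith
  exact le_of_mul_le_mul_left this ht0

/-- A differentiable strongly convex function on a closed set attains its minimum. -/
lemma StrongConvexOn.exists_isMinOn [FiniteDimensional ℝ E] {s : Set E} {μ : ℝ} {f : E → ℝ}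
    (hf : StrongConvexOn s μ f) (hμ : 0 < μ) (hs : IsClosed s) (hne : s.Nonempty)
    (hd : ∀ x ∈ s, DifferentiableAt ℝ f x) : ∃ x ∈ s, IsMinOn f s x := by
  have := FiniteDimensional.proper_real E
  obtain ⟨x₀, hx₀⟩ := hne
  refine ContinuousOn.exists_isMinOn' (fun x hx => (hd x hx).continuousAt.continuousWithinAt) hs hx₀ ?_
  -- Beyond this radius the quadratic term dominates the linear one, so `f` is at least `f x₀`.
  have hfar : ∀ᶠ y in cocompact E, 2 * ‖fderiv ℝ f x₀‖ / μ ≤ ‖y - x₀‖ := by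
    have h1 := tendsto_norm_cocompact_atTop (E := E)
    filter_upwards [h1.eventually_ge_atTop (2 * ‖fderiv ℝ f x₀‖ / μ + ‖x₀‖)] with y hy
    linarith [norm_sub_norm_le y x₀]
  rw [eventually_inf_principal]
  filter_upwards [hfar] with y hy hys
  have h2 := hf.first_order hx₀ hys (hd x₀ hx₀).hasFDerivAt
  have h3 := (abs_le.1 ((fderiv ℝ f x₀).le_opNorm (y - x₀))).1
  rw [div_le_iff₀ hμ] at hy
  nlinarith [norm_nonneg (y - x₀)]

end ConvexCalculus

lemma norm_gradient_sub {E : Type*} [NormedAddCommGroup E] [InnerProductSpace ℝ E] [CompleteSpace E]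
    (f : E → ℝ) (x y : E) : ‖gradient f x - gradient f y‖ = ‖fderiv ℝ f x - fderiv ℝ f y‖ := by
  rw [gradient, gradient, ← map_sub, LinearIsometryEquiv.norm_map]

/-! ### Scalarized minimizers: existence, Pareto optimality, Lipschitz dependence. -/

section Regular

variable {U : Type*} {d p q : ℕ}

/-- The assumptions on a problem apart from those along the solution path, with explicit constants. -/
structure RegularProblem (P : Problem U d p q) (O 𝒦 : Set (Vec d)) (μ l lc : ℝ)
    (a : Fin q → Vec d →L[ℝ] ℝ) (β : Fin q → ℝ) : Prop where
  nonempty : P.X.Nonempty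
  g_mem : ∀ u, P.g u ∈ P.X
  g_surj : ∀ x ∈ P.X, ∃ u, P.g u = x
  obj : ∀ m u, P.h m u = P.f m (P.g u)
  isOpen : IsOpen O
  subset : P.X ⊆ O
  smooth : ∀ m, ContDiffOn ℝ 2 (P.f m) O
  μ_pos : 0 < μ
  strong : ∀ m, StrongConvexOn P.X μ (P.f m)
  compact : IsCompact 𝒦
  compact_subset : 𝒦 ⊆ P.X
  pareto : P.g '' paretoSet P ⊆ 𝒦
  lip_fderiv : ∀ m, ∀ x ∈ 𝒦, ∀ y ∈ 𝒦, ‖fderiv ℝ (P.f m) x - fderiv ℝ (P.f m) y‖ ≤ l * ‖x - y‖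
  l_nonneg : 0 ≤ l
  feasible : P.X = {x | (∀ i, P.c₁ i x ≤ 0) ∧ ∀ j, P.c₂ j x = 0}
  convex_c₁ : ∀ i, ConvexOn ℝ univ (P.c₁ i)
  diff_c₁ : ∀ i, Differentiable ℝ (P.c₁ i)
  diff2_c₁ : ∀ i, Differentiable ℝ (fderiv ℝ (P.c₁ i))
  lip_c₁ : ∀ i x y, ‖fderiv ℝ (P.c₁ i) x - fderiv ℝ (P.c₁ i) y‖ ≤ lc * ‖x - y‖
  lc_nonneg : 0 ≤ lc
  affine_c₂ : ∀ j x, P.c₂ j x = a j x + β j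

lemma exists_regularProblem [Nonempty U] {P : Problem U d p q} (hA1 : HiddenRegular P)
    (hA2 : ConstraintRegular P) : ∃ O 𝒦 μ l lc a β, RegularProblem P O 𝒦 μ l lc a β := by
  obtain ⟨hbij, hobj, ⟨O, hO, hXO, hsm⟩, ⟨μ, hμ, hstr⟩, 𝒦, l, hK, hKX, hpar, hlip⟩ := hA1
  obtain ⟨hX, hc1, hc2, -⟩ := hA2
  choose hconv hdiff hdiff2 lc hlc using hc1
  choose a β hab using hc2
  refine ⟨O, 𝒦, μ, l, ∑ i, (lc i : ℝ), a, β, ?_, fun u => hbij.mapsTo (mem_univ u), ?_, hobj, hO, hXO,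
    hsm, hμ, hstr, hK, hKX, hpar, ?_, l.2, hX, hconv, hdiff, hdiff2, ?_,
    Finset.sum_nonneg fun i _ => (lc i).2, hab⟩
  · exact ⟨P.g (Classical.arbitrary U), hbij.mapsTo (mem_univ _)⟩
  · intro x hx
    obtain ⟨u, -, hu⟩ := hbij.surjOn hx
    exact ⟨u, hu⟩
  · intro m x hx y hy
    have := (hlip m).dist_le_mul x hx y hy
    rwa [dist_eq_norm, dist_eq_norm, norm_gradient_sub] at this
  · intro i x y
    have := (hlc i).dist_le_mul x y
    rw [dist_eq_norm, dist_eq_norm, norm_gradient_sub] at this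
    refine this.trans (mul_le_mul_of_nonneg_right ?_ (norm_nonneg _))
    exact Finset.single_le_sum (f := fun i => (lc i : ℝ)) (fun i _ => (lc i).2) (Finset.mem_univ i)

namespace RegularProblem

variable {P : Problem U d p q} {O 𝒦 : Set (Vec d)} {μ l lc : ℝ} {a : Fin q → Vec d →L[ℝ] ℝ}
  {β : Fin q → ℝ} (h : RegularProblem P O 𝒦 μ l lc a β)

include h

lemma isClosed : IsClosed P.X := by
  have e : P.X = (⋂ i, {x | P.c₁ i x ≤ 0}) ∩ ⋂ j, {x | P.c₂ j x = 0} := by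
    rw [h.feasible]; ext x; simp
  rw [e]
  refine (isClosed_iInter fun i => isClosed_le (h.diff_c₁ i).continuous continuous_const).inter
    (isClosed_iInter fun j => isClosed_eq ?_ continuous_const)
  rw [funext (h.affine_c₂ j)]
  fun_prop

lemma contDiffAt (m : Fin 2) {x : Vec d} (hx : x ∈ O) : ContDiffAt ℝ 2 (P.f m) x :=
  (h.smooth m).contDiffAt (h.isOpen.mem_nhds hx)

lemma hasFDerivAt_f (m : Fin 2) {x : Vec d} (hx : x ∈ O) :
    HasFDerivAt (P.f m) (fderiv ℝ (P.f m) x) x :=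
  ((h.contDiffAt m hx).differentiableAt (by norm_num)).hasFDerivAt

lemma differentiableAt_fderiv_f (m : Fin 2) {x : Vec d} (hx : x ∈ O) :
    DifferentiableAt ℝ (fderiv ℝ (P.f m)) x :=
  ((h.contDiffAt m hx).fderiv_right (m := 1) (by norm_num)).differentiableAt (by norm_num)

lemma hasFDerivAt_LS (w : ℝ) {x : Vec d} (hx : x ∈ O) :
    HasFDerivAt (LS P w) (w • fderiv ℝ (P.f 0) x + (1 - w) • fderiv ℝ (P.f 1) x) x :=
  ((h.hasFDerivAt_f 0 hx).const_mul w).add ((h.hasFDerivAt_f 1 hx).const_mul (1 - w))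

lemma strong_LS {w : ℝ} (hw : w ∈ Icc (0 : ℝ) 1) : StrongConvexOn P.X μ (LS P w) := by
  refine ⟨(h.strong 0).1, fun x hx y hy s t hs ht hst => ?_⟩
  have h0 := mul_le_mul_of_nonneg_left ((h.strong 0).2 hx hy hs ht hst) hw.1
  have h1 := mul_le_mul_of_nonneg_left ((h.strong 1).2 hx hy hs ht hst) (sub_nonneg.2 hw.2)
  simp only [smul_eq_mul, LS] at h0 h1 ⊢
  linarith

lemma exists_isLSMin {w : ℝ} (hw : w ∈ Icc (0 : ℝ) 1) : ∃ x, IsLSMin P w x := by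
  obtain ⟨x, hx, hmin⟩ := (h.strong_LS hw).exists_isMinOn h.μ_pos h.isClosed h.nonempty
    fun x hx => (h.hasFDerivAt_LS w (h.subset hx)).differentiableAt
  exact ⟨x, hx, fun y hy => hmin hy⟩

lemma isLSMin_xstar {w : ℝ} (hw : w ∈ Icc (0 : ℝ) 1) : IsLSMin P w (xstar P w) :=
  Classical.epsilon_spec (h.exists_isLSMin hw)

lemma xstar_mem {w : ℝ} (hw : w ∈ Icc (0 : ℝ) 1) : xstar P w ∈ P.X := (h.isLSMin_xstar hw).1

lemma isLSMin_iff {w : ℝ} (hw : w ∈ Icc (0 : ℝ) 1) (x : Vec d) : IsLSMin P w x ↔ x = xstar P w := by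
  refine ⟨fun hx => ?_, fun hx => hx ▸ h.isLSMin_xstar hw⟩
  have hs := h.isLSMin_xstar hw
  exact ((h.strong_LS hw).strictConvexOn h.μ_pos).eq_of_isMinOn (fun y hy => hx.2 y hy)
    (fun y hy => hs.2 y hy) hx.1 hs.1

/-- A dominating point would also minimize the scalarization, hence coincide with `xstar P w` by
uniqueness, so nothing improves strictly. This covers `w = 0` and `w = 1`, where one weight
vanishes. -/
lemma xstar_mem_compact {w : ℝ} (hw : w ∈ Icc (0 : ℝ) 1) : xstar P w ∈ 𝒦 := by
  obtain ⟨u, hu⟩ := h.g_surj _ (h.xstar_mem hw)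
  refine h.pareto ⟨u, ?_, hu⟩
  rintro ⟨u', hle, m, hlt⟩
  have hu' : IsLSMin P w (P.g u') := by
    refine ⟨h.g_mem u', fun y hy => le_trans ?_ ((h.isLSMin_xstar hw).2 y hy)⟩
    have h0 := mul_le_mul_of_nonneg_left (hle 0) hw.1
    have h1 := mul_le_mul_of_nonneg_left (hle 1) (sub_nonneg.2 hw.2)
    rw [h.obj, h.obj, hu] at h0 h1
    simp only [LS]; linarith
  rw [h.obj, h.obj, hu, (h.isLSMin_iff hw _).1 hu'] at hlt
  exact lt_irrefl _ hlt

/-- Quadratic growth of the scalarized objective at its minimizer. -/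
lemma growth {w : ℝ} (hw : w ∈ Icc (0 : ℝ) 1) {y : Vec d} (hy : y ∈ P.X) :
    μ / 2 * ‖y - xstar P w‖ ^ 2 ≤ LS P w y - LS P w (xstar P w) := by
  have hx := h.isLSMin_xstar hw
  have hd := h.hasFDerivAt_LS w (h.subset hx.1)
  have h1 := (h.strong_LS hw).first_order hx.1 hy hd
  have h2 := nonneg_of_eventually_le (u := y - xstar P w) hd (by
    have hlt : ∀ᶠ t : ℝ in 𝓝[>] 0, t < 1 :=
      (eventually_lt_nhds one_pos).filter_mono nhdsWithin_le_nhds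
    filter_upwards [self_mem_nhdsWithin, hlt] with t ht ht1
    exact hx.2 _ ((h.strong 0).1.add_smul_sub_mem hx.1 hy ⟨le_of_lt ht, ht1.le⟩))
  linarith

lemma exists_bound_fderiv : ∃ G : ℝ, 0 ≤ G ∧ ∀ m, ∀ x ∈ 𝒦, ‖fderiv ℝ (P.f m) x‖ ≤ G := by
  have hc : ∀ m, ∃ G, ∀ x ∈ 𝒦, ‖fderiv ℝ (P.f m) x‖ ≤ G := fun m =>
    h.compact.exists_bound_of_continuousOn fun x hx =>
      (h.differentiableAt_fderiv_f m (h.subset (h.compact_subset hx))).continuousAt.continuousWithinAt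
  choose G hG using hc
  refine ⟨|G 0| + |G 1|, by positivity, fun m x hx => (hG m x hx).trans ?_⟩
  fin_cases m
  · exact (le_abs_self _).trans (le_add_of_nonneg_right (abs_nonneg _))
  · exact (le_abs_self _).trans (le_add_of_nonneg_left (abs_nonneg _))

/-- `𝒦` need not be convex, so the mean value inequality along the segment is unavailable. Convexity
gives a tangent lower bound at each of the two points instead. -/
lemma abs_f_sub_le {G : ℝ} (hG : ∀ m, ∀ x ∈ 𝒦, ‖fderiv ℝ (P.f m) x‖ ≤ G) (m : Fin 2) {x y : Vec d}
    (hx : x ∈ 𝒦) (hy : y ∈ 𝒦) : |P.f m y - P.f m x| ≤ G * ‖y - x‖ := by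
  have key : ∀ x ∈ 𝒦, ∀ y ∈ 𝒦, -(G * ‖y - x‖) ≤ P.f m y - P.f m x := by
    intro x hx y hy
    have h1 := (h.strong m).first_order (h.compact_subset hx) (h.compact_subset hy)
      (h.hasFDerivAt_f m (h.subset (h.compact_subset hx)))
    have h2 := (abs_le.1 ((fderiv ℝ (P.f m) x).le_opNorm (y - x))).1
    have h3 := mul_le_mul_of_nonneg_right (hG m x hx) (norm_nonneg (y - x))
    have h4 : 0 ≤ μ / 2 * ‖y - x‖ ^ 2 := by have := h.μ_pos; positivity
    linarith
  have h1 := key x hx y hy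
  have h2 := key y hy x hx
  rw [norm_sub_rev] at h2
  exact abs_le.2 ⟨h1, by linarith⟩

/-- Add the quadratic growth inequalities at the two minimizers. The scalarized values combine to `w
- w'` times increments of the objectives, which are linear in the distance, and one factor of the
distance cancels. -/
lemma exists_lip_xstar : ∃ Lx : ℝ, 0 ≤ Lx ∧ ∀ w ∈ Icc (0 : ℝ) 1, ∀ w' ∈ Icc (0 : ℝ) 1,
    ‖xstar P w - xstar P w'‖ ≤ Lx * |w - w'| := by
  obtain ⟨G, hG0, hG⟩ := h.exists_bound_fderiv
  have hμ := h.μ_pos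
  refine ⟨2 * G / μ, by positivity, fun w hw w' hw' => ?_⟩
  have hk := h.xstar_mem_compact hw
  have hk' := h.xstar_mem_compact hw'
  have g1 := h.growth hw (h.xstar_mem hw')
  have g2 := h.growth hw' (h.xstar_mem hw)
  have b0 := h.abs_f_sub_le hG 0 hk' hk
  have b1 := h.abs_f_sub_le hG 1 hk' hk
  rw [norm_sub_rev] at g1
  set n := ‖xstar P w - xstar P w'‖ with hn
  have hsum : μ * n ^ 2 ≤ |w - w'| * (2 * G * n) := by
    have e : LS P w (xstar P w') - LS P w (xstar P w)
        + (LS P w' (xstar P w) - LS P w' (xstar P w'))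
        = (w - w') * ((P.f 1 (xstar P w) - P.f 1 (xstar P w'))
          - (P.f 0 (xstar P w) - P.f 0 (xstar P w'))) := by
      simp only [LS]; ring
    have h3 : |(P.f 1 (xstar P w) - P.f 1 (xstar P w')) - (P.f 0 (xstar P w) - P.f 0 (xstar P w'))|
        ≤ 2 * G * n := (abs_sub _ _).trans (by linarith)
    have h4 := (le_abs_self ((w - w') * ((P.f 1 (xstar P w) - P.f 1 (xstar P w'))
          - (P.f 0 (xstar P w) - P.f 0 (xstar P w'))))).trans
      (le_of_eq (abs_mul _ _))
    have h5 := mul_le_mul_of_nonneg_left h3 (abs_nonneg (w - w'))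
    linarith
  rw [div_mul_eq_mul_div, le_div_iff₀ hμ]
  rcases (norm_nonneg (xstar P w - xstar P w')).eq_or_lt with h0 | h0
  · rw [hn, ← h0, zero_mul]; positivity
  · refine le_of_mul_le_mul_right ?_ h0
    rw [← hn]
    linarith

end RegularProblem

end Regular

/-- The Gram operator of the gradients is injective, hence surjective, so a suitable direction
exists in their span. -/
lemma surjective_of_linearIndependent_gradient {E K : Type*} [NormedAddCommGroup E]
    [InnerProductSpace ℝ E] [CompleteSpace E] [Finite K] {c : K → E → ℝ} {x : E}
    (hc : LinearIndependent ℝ fun k => gradient (c k) x) (r : K → ℝ) :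
    ∃ u, ∀ k, fderiv ℝ (c k) x u = r k := by
  have := Fintype.ofFinite K
  let T : (K → ℝ) →ₗ[ℝ] (K → ℝ) := LinearMap.pi fun k =>
    ((fderiv ℝ (c k) x).toLinearMap).comp (Fintype.linearCombination ℝ fun k => gradient (c k) x)
  have hT : Function.Injective T := by
    rw [← LinearMap.ker_eq_bot, LinearMap.ker_eq_bot']
    intro l hl
    have h1 : ∀ k, fderiv ℝ (c k) x (∑ j, l j • gradient (c j) x) = 0 := fun k => congrFun hl k
    have h2 : ∀ k, inner ℝ (gradient (c k) x) (∑ j, l j • gradient (c j) x) = 0 := by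
      intro k
      rw [← h1 k, gradient, InnerProductSpace.toDual_symm_apply]
    have h3 : inner ℝ (∑ j, l j • gradient (c j) x) (∑ j, l j • gradient (c j) x) = (0 : ℝ) := by
      rw [sum_inner]
      refine Finset.sum_eq_zero fun k _ => ?_
      rw [real_inner_smul_left, h2 k, mul_zero]
    exact funext (Fintype.linearIndependent_iff.1 hc l (inner_self_eq_zero.1 h3))
  obtain ⟨l, hl⟩ := (LinearMap.injective_iff_surjective.1 hT) r
  exact ⟨_, fun k => congrFun hl k⟩

/-! ### Active constraints, feasible directions and KKT multipliers. -/

section Constraints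

variable {U : Type*} {d p q : ℕ}

/-- The inequality constraints with indices in `A` together with the equality constraints. -/
def constraintOn (P : Problem U d p q) (A : Set (Fin p)) : A ⊕ Fin q → Vec d → ℝ :=
  Sum.elim (fun i => P.c₁ i) P.c₂

/-- `ActiveIdx P w` varies with `w`, so multipliers at different weights live in different types.
This and the next two lemmas transport data to a fixed index set `A`. -/
lemma licq_on {P : Problem U d p q} {w : ℝ} {A : Set (Fin p)} (hA : activeSet P w = A)
    (hl : LinearIndependent ℝ fun k => gradient (activeConstraint P w k) (xstar P w)) :
    LinearIndependent ℝ fun k => gradient (constraintOn P A k) (xstar P w) := by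
  subst hA; exact hl

lemma mem_ker_jacobian_on {P : Problem U d p q} {w : ℝ} {A : Set (Fin p)} (hA : activeSet P w = A)
    {v : Vec d} (hv : v ∈ LinearMap.ker (jacobian P w)) (k : A ⊕ Fin q) :
    fderiv ℝ (constraintOn P A k) (xstar P w) v = 0 := by
  subst hA; exact congrFun hv k

lemma exists_multiplier_on {P : Problem U d p q} {w : ℝ} {A : Set (Fin p)} [Fintype A]
    (hA : activeSet P w = A) (ν : A ⊕ Fin q → ℝ) (hν : ∀ i, 0 ≤ ν (Sum.inl i)) :
    ∃ ν₀ : ActiveIdx P w → ℝ, (∀ i, 0 ≤ ν₀ (Sum.inl i)) ∧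
      lagrangian P w ν₀ = fun x => LS P w x + ∑ k, ν k * constraintOn P A k x := by
  subst hA
  refine ⟨ν, hν, funext fun x => ?_⟩
  unfold lagrangian
  congr 1
  exact Finset.sum_congr (by ext; simp) fun _ _ => rfl

/-- A direction pointing strictly inside all active inequalities and along the equalities. -/
lemma exists_inner_dir {P : Problem U d p q} {w : ℝ} {A : Set (Fin p)}
    (hl : LinearIndependent ℝ fun k => gradient (constraintOn P A k) (xstar P w)) :
    ∃ v : Vec d, (∀ i : A, fderiv ℝ (constraintOn P A (Sum.inl i)) (xstar P w) v = -1) ∧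
      ∀ j, fderiv ℝ (constraintOn P A (Sum.inr j)) (xstar P w) v = 0 := by
  obtain ⟨v, hv⟩ := surjective_of_linearIndependent_gradient hl (Sum.elim (fun _ => -1) fun _ => 0)
  exact ⟨v, fun i => hv (Sum.inl i), fun j => hv (Sum.inr j)⟩

namespace RegularProblem

variable {P : Problem U d p q} {O 𝒦 : Set (Vec d)} {μ l lc : ℝ} {a : Fin q → Vec d →L[ℝ] ℝ}
  {β : Fin q → ℝ} (h : RegularProblem P O 𝒦 μ l lc a β)

include h

lemma hasFDerivAt_c₂ (j : Fin q) (x : Vec d) : HasFDerivAt (P.c₂ j) (a j) x := by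
  rw [funext (h.affine_c₂ j)]
  exact (a j).hasFDerivAt.add_const _

lemma fderiv_c₂ (j : Fin q) : fderiv ℝ (P.c₂ j) = fun _ => a j :=
  funext fun x => (h.hasFDerivAt_c₂ j x).fderiv

variable {A : Set (Fin p)}

lemma hasFDerivAt_constraintOn (k : A ⊕ Fin q) (x : Vec d) :
    HasFDerivAt (constraintOn P A k) (fderiv ℝ (constraintOn P A k) x) x := by
  rcases k with i | j
  · exact (h.diff_c₁ i x).hasFDerivAt
  · exact (h.hasFDerivAt_c₂ j x).differentiableAt.hasFDerivAt

lemma differentiable_fderiv_constraintOn (k : A ⊕ Fin q) :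
    Differentiable ℝ (fderiv ℝ (constraintOn P A k)) := by
  rcases k with i | j
  · exact h.diff2_c₁ i
  · show Differentiable ℝ (fderiv ℝ (P.c₂ j))
    rw [h.fderiv_c₂ j]; exact differentiable_const _

lemma lip_fderiv_constraintOn (k : A ⊕ Fin q) (x y : Vec d) :
    ‖fderiv ℝ (constraintOn P A k) x - fderiv ℝ (constraintOn P A k) y‖ ≤ lc * ‖x - y‖ := by
  rcases k with i | j
  · exact h.lip_c₁ i x y
  · show ‖fderiv ℝ (P.c₂ j) x - fderiv ℝ (P.c₂ j) y‖ ≤ _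
    rw [h.fderiv_c₂ j, sub_self, norm_zero]
    exact mul_nonneg h.lc_nonneg (norm_nonneg _)

lemma constraintOn_xstar {w : ℝ} (hw : w ∈ Icc (0 : ℝ) 1) (hA : activeSet P w = A)
    (k : A ⊕ Fin q) : constraintOn P A k (xstar P w) = 0 := by
  rcases k with i | j
  · have : (i : Fin p) ∈ activeSet P w := hA ▸ i.2
    exact this
  · have := h.xstar_mem hw
    rw [h.feasible] at this
    exact this.2 j

/-- Strictly feasible linearized directions are feasible. -/
lemma eventually_mem_of_dir {w : ℝ} (hw : w ∈ Icc (0 : ℝ) 1) (hA : activeSet P w = A) {u : Vec d}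
    (h₁ : ∀ i : A, fderiv ℝ (constraintOn P A (Sum.inl i)) (xstar P w) u < 0)
    (h₂ : ∀ j, fderiv ℝ (constraintOn P A (Sum.inr j)) (xstar P w) u = 0) :
    ∀ᶠ t : ℝ in 𝓝[>] 0, xstar P w + t • u ∈ P.X := by
  have hx := h.xstar_mem hw
  rw [h.feasible] at hx ⊢
  have e1 : ∀ i, ∀ᶠ t : ℝ in 𝓝[>] 0, P.c₁ i (xstar P w + t • u) ≤ 0 := by
    intro i
    by_cases hi : i ∈ A
    · have hz : P.c₁ i (xstar P w) = 0 := by rw [← hA] at hi; exact hi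
      filter_upwards [eventually_lt_of_neg (h.diff_c₁ i _).hasFDerivAt (h₁ ⟨i, hi⟩)] with t ht
      exact (ht.trans_eq hz).le
    · have hz : P.c₁ i (xstar P w) < 0 := by
        refine lt_of_le_of_ne (hx.1 i) fun hcon => hi ?_
        rw [← hA]; exact hcon
      have hc : Continuous fun t : ℝ => P.c₁ i (xstar P w + t • u) :=
        (h.diff_c₁ i).continuous.comp (by fun_prop)
      have hz' : P.c₁ i (xstar P w + (0 : ℝ) • u) < 0 := by simpa using hz
      have := (hc.tendsto 0).eventually_lt_const hz'
      exact (this.filter_mono nhdsWithin_le_nhds).mono fun t ht => le_of_lt ht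
  filter_upwards [eventually_all.2 e1] with t ht
  refine ⟨ht, fun j => ?_⟩
  have h3 : a j u = 0 := by
    have := h₂ j
    rwa [show fderiv ℝ (constraintOn P A (Sum.inr j)) (xstar P w) = a j from
      congrFun (h.fderiv_c₂ j) _] at this
  have h4 := hx.2 j
  rw [h.affine_c₂] at h4 ⊢
  rw [map_add, map_smul, h3, smul_zero, add_zero, h4]

variable {w : ℝ}

/-- Adding `ε` times an inner direction makes `u` strictly feasible to first order, so the
minimality of `xstar` applies; then `ε` tends to `0`. -/
lemma dir_nonneg (hw : w ∈ Icc (0 : ℝ) 1) (hA : activeSet P w = A)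
    (hl : LinearIndependent ℝ fun k => gradient (constraintOn P A k) (xstar P w))
    {L' : Vec d →L[ℝ] ℝ} (hL : HasFDerivAt (LS P w) L' (xstar P w)) {u : Vec d}
    (h₁ : ∀ i : A, fderiv ℝ (constraintOn P A (Sum.inl i)) (xstar P w) u ≤ 0)
    (h₂ : ∀ j, fderiv ℝ (constraintOn P A (Sum.inr j)) (xstar P w) u = 0) : 0 ≤ L' u := by
  obtain ⟨v, hv1, hv2⟩ := exists_inner_dir hl
  have key : ∀ ε : ℝ, 0 < ε → 0 ≤ L' u + ε * L' v := by
    intro ε hε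
    have h3 : ∀ᶠ t : ℝ in 𝓝[>] 0, xstar P w + t • (u + ε • v) ∈ P.X := by
      refine h.eventually_mem_of_dir hw hA (fun i => ?_) fun j => ?_
      · rw [map_add, map_smul, hv1 i, smul_eq_mul]; linarith [h₁ i]
      · rw [map_add, map_smul, hv2 j, h₂ j, smul_zero, add_zero]
    have := nonneg_of_eventually_le (u := u + ε • v) hL
      (h3.mono fun t ht => (h.isLSMin_xstar hw).2 _ ht)
    rwa [map_add, map_smul, smul_eq_mul] at this
  have hlim : Tendsto (fun ε : ℝ => L' u + ε * L' v) (𝓝[>] 0) (𝓝 (L' u + 0 * L' v)) :=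
    Tendsto.mono_left (Continuous.tendsto (by fun_prop) 0) nhdsWithin_le_nhds
  rw [zero_mul, add_zero] at hlim
  exact ge_of_tendsto hlim (by filter_upwards [self_mem_nhdsWithin] with ε hε using key ε hε)

/-- Karush–Kuhn–Tucker conditions at `x*_w`. -/
lemma exists_kkt [Fintype A] (hw : w ∈ Icc (0 : ℝ) 1) (hA : activeSet P w = A)
    (hl : LinearIndependent ℝ fun k => gradient (constraintOn P A k) (xstar P w))
    {L' : Vec d →L[ℝ] ℝ} (hL : HasFDerivAt (LS P w) L' (xstar P w)) :
    ∃ ν : A ⊕ Fin q → ℝ, (∀ i, 0 ≤ ν (Sum.inl i)) ∧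
      L' + ∑ k, ν k • fderiv ℝ (constraintOn P A k) (xstar P w) = 0 := by
  classical
  -- Both `y` and `-y` are admissible for `y` in the common kernel, so `L'` vanishes there and is a
  -- combination of the constraint derivatives.
  have hspan : L'.toLinearMap ∈ Submodule.span ℝ
      (range fun k => (fderiv ℝ (constraintOn P A k) (xstar P w)).toLinearMap) := by
    refine mem_span_of_iInf_ker_le_ker fun y hy => ?_
    have hy' : ∀ k, fderiv ℝ (constraintOn P A k) (xstar P w) y = 0 := by
      simpa [Submodule.mem_iInf] using hy
    have h1 := h.dir_nonneg hw hA hl hL (u := y) (fun i => (hy' _).le) fun j => hy' _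
    have h2 := h.dir_nonneg hw hA hl hL (u := -y) (fun i => by rw [map_neg, hy', neg_zero])
      fun j => by rw [map_neg, hy', neg_zero]
    rw [map_neg] at h2
    show L' y = 0
    linarith
  obtain ⟨r, hr⟩ := (Submodule.mem_span_range_iff_exists_fun ℝ).1 hspan
  have hr' : ∀ y, L' y = ∑ k, r k * fderiv ℝ (constraintOn P A k) (xstar P w) y := by
    intro y
    have := congrArg (fun φ : Vec d →ₗ[ℝ] ℝ => φ y) hr
    simpa using this.symm
  refine ⟨fun k => -r k, fun i => ?_, ?_⟩
  -- The sign is tested on a direction that leaves constraint `i` inwards and is tangent to all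
  -- others.
  · obtain ⟨v, hv⟩ := surjective_of_linearIndependent_gradient hl (Pi.single (Sum.inl i) (-1))
    have h1 := h.dir_nonneg hw hA hl hL (u := v)
      (fun i' => by
        rw [hv, Pi.single_apply]; split_ifs <;> norm_num)
      (fun j => by rw [hv, Pi.single_apply]; simp)
    rw [hr' v, Finset.sum_eq_single (Sum.inl i)] at h1
    · rw [hv, Pi.single_eq_same] at h1; linarith
    · intro k _ hk
      rw [hv, Pi.single_eq_of_ne hk, mul_zero]
    · simp
  · ext y
    simp [hr' y]

lemma strong_lagrangian [Fintype A] (hw : w ∈ Icc (0 : ℝ) 1) {ν : A ⊕ Fin q → ℝ}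
    (hν : ∀ i, 0 ≤ ν (Sum.inl i)) :
    StrongConvexOn P.X μ fun x => LS P w x + ∑ k, ν k * constraintOn P A k x := by
  refine ⟨(h.strong 0).1, fun x hx y hy s t hs ht hst => ?_⟩
  have h1 := (h.strong_LS hw).2 hx hy hs ht hst
  have h2 : ∑ k, ν k * constraintOn P A k (s • x + t • y) ≤
      s * ∑ k, ν k * constraintOn P A k x + t * ∑ k, ν k * constraintOn P A k y := by
    rw [Finset.mul_sum, Finset.mul_sum, ← Finset.sum_add_distrib]
    refine Finset.sum_le_sum fun k _ => ?_
    rcases k with i | j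
    · have := mul_le_mul_of_nonneg_left
        ((h.convex_c₁ i).2 (mem_univ x) (mem_univ y) hs ht hst) (hν i)
      simp only [smul_eq_mul] at this
      simp only [constraintOn, Sum.elim_inl]
      linarith
    · simp only [constraintOn, Sum.elim_inr, h.affine_c₂, map_add, map_smul, smul_eq_mul]
      have : t = 1 - s := by linarith
      subst this
      exact le_of_eq (by ring)
  simp only [smul_eq_mul] at h1 ⊢
  linarith

end RegularProblem

end Constraints

lemma norm_vec_two_le (v : Vec 2) : ‖v‖ ≤ |v 0| + |v 1| := by
  rw [EuclideanSpace.norm_eq, Fin.sum_univ_two, Real.norm_eq_abs, Real.norm_eq_abs]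
  refine Real.sqrt_le_iff.2 ⟨by positivity, ?_⟩
  nlinarith [mul_nonneg (abs_nonneg (v 0)) (abs_nonneg (v 1))]

lemma abs_apply_sub_apply_le (v : Vec 2) : |v 1 - v 0| ≤ 2 * ‖v‖ := by
  have h0 := PiLp.norm_apply_le v 0
  have h1 := PiLp.norm_apply_le v 1
  rw [Real.norm_eq_abs] at h0 h1
  exact (abs_sub _ _).trans (by linarith)

/-- The fundamental theorem of calculus with one-sided derivatives at the end points of `[0,1]`. -/
lemma hasDerivWithinAt_integral_Icc {v : ℝ → ℝ} (hv : ContinuousOn v (Icc 0 1)) :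
    ∀ w ∈ Icc (0 : ℝ) 1, HasDerivWithinAt (fun w => ∫ r in (0 : ℝ)..w, v r) (v w) (Icc 0 1) w := by
  intro w hw
  -- Constant extension beyond `[0,1]` gives a globally continuous integrand with the same integral.
  have hc : Continuous (IccExtend (zero_le_one' ℝ) ((Icc 0 1).domRestrict v)) :=
    hv.domRestrict.Icc_extend'
  have he : ∀ r ∈ Icc (0 : ℝ) 1, IccExtend (zero_le_one' ℝ) ((Icc 0 1).domRestrict v) r = v r :=
    fun r hr => IccExtend_of_mem _ _ hr
  have h1 := (hc.integral_hasStrictDerivAt 0 w).hasDerivAt.hasDerivWithinAt (s := Icc 0 1)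
  rw [he w hw] at h1
  have hint : ∀ t ∈ Icc (0 : ℝ) 1, ∫ r in (0 : ℝ)..t, v r =
      ∫ r in (0 : ℝ)..t, IccExtend (zero_le_one' ℝ) ((Icc 0 1).domRestrict v) r := by
    intro t ht
    refine intervalIntegral.integral_congr fun r hr => (he r ?_).symm
    rw [uIcc_of_le ht.1] at hr
    exact ⟨hr.1, hr.2.trans ht.2⟩
  exact h1.congr hint (hint w hw)

/-! ### Regularity of the solution path and of the Pareto front. -/

section Path

variable {U : Type*} {d p q : ℕ} {P : Problem U d p q} {O 𝒦 : Set (Vec d)} {μ l lc : ℝ}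
  {a : Fin q → Vec d →L[ℝ] ℝ} {β : Fin q → ℝ}

/-- The scalarized solutions form a path of KKT points to which `SaddlePath.exists_deriv` applies. -/
lemma RegularProblem.exists_saddlePath (h : RegularProblem P O 𝒦 μ l lc a β)
    (hA2 : ConstraintRegular P) {A : Set (Fin p)} [Fintype A]
    (hA : ∀ w ∈ Icc (0 : ℝ) 1, activeSet P w = A) :
    ∃ (ν : ℝ → A ⊕ Fin q → ℝ) (H : ℝ → Vec d →L[ℝ] Vec d →L[ℝ] ℝ) (Lx Lg La LH G : ℝ),
      SaddlePath (xstar P) ν (fderiv ℝ (P.f 0)) (fderiv ℝ (P.f 1)) (constraintOn P A)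
        (fun k => fderiv ℝ (constraintOn P A k)) H Lx Lg La LH G := by
  obtain ⟨-, -, -, -, hlicq, LH, hLH⟩ := hA2
  obtain ⟨G, -, hG⟩ := h.exists_bound_fderiv
  obtain ⟨Lx, hLx0, hLx⟩ := h.exists_lip_xstar
  have hl : ∀ w ∈ Icc (0 : ℝ) 1,
      LinearIndependent ℝ fun k => gradient (constraintOn P A k) (xstar P w) :=
    fun w hw => licq_on (hA w hw) (hlicq w hw)
  have hO : ∀ w ∈ Icc (0 : ℝ) 1, xstar P w ∈ O := fun w hw => h.subset (h.xstar_mem hw)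
  have hex : ∀ w, ∃ ν : A ⊕ Fin q → ℝ, w ∈ Icc (0 : ℝ) 1 → (∀ i, 0 ≤ ν (Sum.inl i)) ∧
      w • fderiv ℝ (P.f 0) (xstar P w) + (1 - w) • fderiv ℝ (P.f 1) (xstar P w)
        + ∑ k, ν k • fderiv ℝ (constraintOn P A k) (xstar P w) = 0 := by
    intro w
    by_cases hw : w ∈ Icc (0 : ℝ) 1
    · obtain ⟨ν, hν⟩ := h.exists_kkt hw (hA w hw) (hl w hw) (h.hasFDerivAt_LS w (hO w hw))
      exact ⟨ν, fun _ => hν⟩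
    · exact ⟨0, fun hw' => absurd hw' hw⟩
  choose ν hν using hex
  set Lag : ℝ → Vec d → ℝ := fun w x => LS P w x + ∑ k, ν w k * constraintOn P A k x with hLag
  set Λ : ℝ → Vec d → Vec d →L[ℝ] ℝ := fun w y => w • fderiv ℝ (P.f 0) y
    + (1 - w) • fderiv ℝ (P.f 1) y + ∑ k, ν w k • fderiv ℝ (constraintOn P A k) y with hΛ
  have hLagΛ : ∀ w, ∀ y ∈ O, HasFDerivAt (Lag w) (Λ w y) y := fun w y hy =>
    (h.hasFDerivAt_LS w hy).add
      (HasFDerivAt.fun_sum fun k _ => (h.hasFDerivAt_constraintOn k y).const_mul (ν w k))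
  have hΛd : ∀ w, ∀ y ∈ O, DifferentiableAt ℝ (Λ w) y := fun w y hy =>
    (((h.differentiableAt_fderiv_f 0 hy).const_smul w).add
      ((h.differentiableAt_fderiv_f 1 hy).const_smul (1 - w))).add
      (DifferentiableAt.fun_sum fun k _ =>
        (h.differentiable_fderiv_constraintOn k y).const_smul (ν w k))
  have hess : ∀ w, ∀ y ∈ O, fderiv ℝ (fderiv ℝ (Lag w)) y = fderiv ℝ (Λ w) y := by
    intro w y hy
    refine Filter.EventuallyEq.fderiv_eq ?_
    filter_upwards [h.isOpen.mem_nhds hy] with z hz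
    exact (hLagΛ w z hz).fderiv
  refine ⟨ν, fun w => fderiv ℝ (Λ w) (xstar P w), Lx, l * Lx, lc * Lx, LH, G, ?_⟩
  refine ⟨fun w hw => (hν w hw).2, fun w hw => (hΛd w _ (hO w hw)).hasFDerivAt,
    fun w hw k => h.constraintOn_xstar hw (hA w hw) k,
    fun w _ k => h.hasFDerivAt_constraintOn k _, ?_, ?_, hLx, ?_, ?_, ?_,
    mul_nonneg h.lc_nonneg hLx0, ?_, fun w hw => hG 0 _ (h.xstar_mem_compact hw),
    fun w hw => hG 1 _ (h.xstar_mem_compact hw)⟩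
  · -- the Hessian is positive definite on the tangent space
    intro w hw y hy hy0
    obtain ⟨v, hv1, hv2⟩ := exists_inner_dir (hl w hw)
    -- Strong convexity on `P.X` controls the Hessian only in feasible directions, and a tangent `y`
    -- need not be one; `y + ε • v` is, and `ε → 0` recovers `y`.
    have key : ∀ ε : ℝ, 0 < ε → μ * ‖y + ε • v‖ ^ 2 ≤
        fderiv ℝ (Λ w) (xstar P w) (y + ε • v) (y + ε • v) := by
      intro ε hε
      refine (h.strong_lagrangian hw (hν w hw).1).second_order (h.xstar_mem hw) ?_
        (fun z hz => hLagΛ w z (h.subset hz)) (hΛd w _ (hO w hw)).hasFDerivAt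
      refine h.eventually_mem_of_dir hw (hA w hw) (fun i => ?_) fun j => ?_
      · rw [map_add, map_smul, hv1 i, hy, smul_eq_mul]; linarith
      · rw [map_add, map_smul, hv2 j, hy, smul_zero, add_zero]
    have hl1 : Tendsto (fun ε : ℝ => μ * ‖y + ε • v‖ ^ 2) (𝓝[>] 0)
        (𝓝 (μ * ‖y + (0 : ℝ) • v‖ ^ 2)) :=
      Tendsto.mono_left (Continuous.tendsto (by fun_prop) 0) nhdsWithin_le_nhds
    have hl2 : Tendsto (fun ε : ℝ => fderiv ℝ (Λ w) (xstar P w) (y + ε • v) (y + ε • v)) (𝓝[>] 0)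
        (𝓝 (fderiv ℝ (Λ w) (xstar P w) (y + (0 : ℝ) • v) (y + (0 : ℝ) • v))) :=
      Tendsto.mono_left (Continuous.tendsto (by fun_prop) 0) nhdsWithin_le_nhds
    have h3 := le_of_tendsto_of_tendsto hl1 hl2
      (by filter_upwards [self_mem_nhdsWithin] with ε hε using key ε hε)
    rw [zero_smul, add_zero] at h3
    have hμ := h.μ_pos
    exact lt_of_lt_of_le (by positivity) h3
  · -- independence of the constraint gradients
    intro w hw r hr
    refine funext (Fintype.linearIndependent_iff.1 (hl w hw) r ?_)
    have h1 := congrArg (InnerProductSpace.toDual ℝ (Vec d)).symm hr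
    rw [map_sum, map_zero] at h1
    rw [← h1]
    refine Finset.sum_congr rfl fun k _ => ?_
    rw [gradient]
    exact ((InnerProductSpace.toDual ℝ (Vec d)).symm.map_smul (r k) _).symm
  · intro w hw w' hw'
    refine (h.lip_fderiv 0 _ (h.xstar_mem_compact hw) _ (h.xstar_mem_compact hw')).trans ?_
    rw [mul_assoc]
    exact mul_le_mul_of_nonneg_left (hLx w hw w' hw') h.l_nonneg
  · intro w hw w' hw'
    refine (h.lip_fderiv 1 _ (h.xstar_mem_compact hw) _ (h.xstar_mem_compact hw')).trans ?_
    rw [mul_assoc]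
    exact mul_le_mul_of_nonneg_left (hLx w hw w' hw') h.l_nonneg
  · intro w hw w' hw' k
    refine (h.lip_fderiv_constraintOn k _ _).trans ?_
    rw [mul_assoc]
    exact mul_le_mul_of_nonneg_left (hLx w hw w' hw') h.lc_nonneg
  · -- the Hessian is Lipschitz along the path
    have hmult : ∀ w ∈ Icc (0 : ℝ) 1, ∃ ν₀, IsMultiplier P w ν₀ ∧
        lagrangianHessian P w ν₀ = fderiv ℝ (Λ w) (xstar P w) := by
      intro w hw
      obtain ⟨ν₀, hν₀, heq⟩ := exists_multiplier_on (hA w hw) (ν w) (hν w hw).1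
      refine ⟨ν₀, ⟨?_, hν₀⟩, ?_⟩
      · have h1 : HasFDerivAt (lagrangian P w ν₀) (Λ w (xstar P w)) (xstar P w) :=
          heq ▸ hLagΛ w _ (hO w hw)
        have h2 : Λ w (xstar P w) = 0 := (hν w hw).2
        rw [gradient, h1.fderiv, h2, map_zero]
      · rw [lagrangianHessian, heq]
        exact hess w _ (hO w hw)
    intro w hw w' hw'
    obtain ⟨ν₁, hm1, he1⟩ := hmult w hw
    obtain ⟨ν₂, hm2, he2⟩ := hmult w' hw'
    have := hLH w hw w' hw' ν₁ ν₂ hm1 hm2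
    rwa [he1, he2] at this

/-- The objectives are Lipschitz near the solution path. -/
lemma RegularProblem.exists_lip_obj (h : RegularProblem P O 𝒦 μ l lc a β) :
    ∃ Lf r : ℝ, 0 < Lf ∧ 0 < r ∧ ∀ w ∈ Icc (0 : ℝ) 1, ∀ u, ‖P.g u - xstar P w‖ ≤ r →
      ‖hvec P u - fPF P w‖ ≤ Lf * ‖P.g u - xstar P w‖ := by
  -- Solver outputs may leave `𝒦`. A compact thickening inside `O` contains the balls of radius `r`
  -- around the path, which are convex and carry a derivative bound.
  obtain ⟨r, hr, hrO⟩ := h.compact.exists_cthickening_subset_open h.isOpen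
    (h.compact_subset.trans h.subset)
  have hT : IsCompact (Metric.cthickening r 𝒦) := h.compact.cthickening
  have hc : ∀ m, ∃ C, ∀ x ∈ Metric.cthickening r 𝒦, ‖fderiv ℝ (P.f m) x‖ ≤ C := fun m =>
    hT.exists_bound_of_continuousOn fun x hx =>
      (h.differentiableAt_fderiv_f m (hrO hx)).continuousAt.continuousWithinAt
  choose C hC using hc
  refine ⟨|C 0| + |C 1| + 1, r, by positivity, hr, fun w hw u hu => ?_⟩
  have hx := h.xstar_mem_compact hw
  have hball : Metric.closedBall (xstar P w) r ⊆ Metric.cthickening r 𝒦 :=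
    Metric.closedBall_subset_cthickening hx r
  have hm : ∀ m, |P.f m (P.g u) - P.f m (xstar P w)| ≤ |C m| * ‖P.g u - xstar P w‖ := by
    intro m
    have := (convex_closedBall (xstar P w) r).norm_image_sub_le_of_norm_hasFDerivWithin_le
      (f := P.f m) (f' := fun x => fderiv ℝ (P.f m) x) (C := |C m|)
      (x := xstar P w) (y := P.g u)
      (fun x hx => (h.hasFDerivAt_f m (hrO (hball hx))).hasFDerivWithinAt)
      (fun x hx => (hC m x (hball hx)).trans (le_abs_self _))
      (Metric.mem_closedBall_self hr.le) (by rwa [Metric.mem_closedBall, dist_eq_norm])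
    rwa [Real.norm_eq_abs] at this
  refine (norm_vec_two_le _).trans ?_
  have e : ∀ m, (hvec P u - fPF P w) m = P.f m (P.g u) - P.f m (xstar P w) := fun m => by
    rw [← h.obj]; rfl
  rw [e, e]
  have := norm_nonneg (P.g u - xstar P w)
  linarith [hm 0, hm 1]

/-- The solution path of a regular problem. -/
lemma RegularProblem.exists_pathRegular (h : RegularProblem P O 𝒦 μ l lc a β)
    (hA2 : ConstraintRegular P) (hA3 : NonzeroTradeoff P) :
    ∃ (F' : ℝ → Vec 2) (c V L Lx Lf r : ℝ), PathRegular P F' c V L Lx Lf r := by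
  have hA : ∀ w ∈ Icc (0 : ℝ) 1, activeSet P w = activeSet P 0 := fun w hw =>
    hA2.2.2.2.1 w hw 0 ⟨le_rfl, zero_le_one⟩
  let _ : Fintype (activeSet P 0) := Fintype.ofFinite _
  obtain ⟨ν, H, Lx, Lg, La, LH, G, hpath⟩ := h.exists_saddlePath hA2 hA
  obtain ⟨x', r, C, hx', hkkt, htan, hlip⟩ := hpath.exists_deriv
  obtain ⟨Lx, hLx0, hLx⟩ := h.exists_lip_xstar
  obtain ⟨Lf, ρ, hLf, hρ, hobj⟩ := h.exists_lip_obj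
  obtain ⟨c₀, hc₀, htrade⟩ := hA3
  have h01 : (0 : ℝ) ∈ Icc (0 : ℝ) 1 := ⟨le_rfl, zero_le_one⟩
  have hC : 0 ≤ C := by
    have := (norm_nonneg _).trans (hlip 0 h01 1 ⟨zero_le_one, le_rfl⟩)
    simpa using this
  set X := ‖x' 0‖ + C with hX
  have hx'b : ∀ w ∈ Icc (0 : ℝ) 1, ‖x' w‖ ≤ X := by
    intro w hw
    have h1 := hlip w hw 0 h01
    have h2 : C * |w - 0| ≤ C := mul_le_of_le_one_right hC (by
      rw [sub_zero, abs_of_nonneg hw.1]; exact hw.2)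
    have h3 := norm_sub_norm_le (x' w) (x' 0)
    rw [hX]; linarith
  -- derivatives of the objectives along the path
  set D : Fin 2 → ℝ → ℝ := fun m w => fderiv ℝ (P.f m) (xstar P w) (x' w) with hD
  have hDd : ∀ m, ∀ w ∈ Icc (0 : ℝ) 1,
      HasDerivWithinAt (fun w => P.f m (xstar P w)) (D m w) (Icc 0 1) w := fun m w hw =>
    (h.hasFDerivAt_f m (h.subset (h.xstar_mem hw))).comp_hasDerivWithinAt w (hx' w hw)
  set LD := Lg * X + G * C with hLD
  have hDlip : ∀ m, ∀ w ∈ Icc (0 : ℝ) 1, ∀ w' ∈ Icc (0 : ℝ) 1,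
      |D m w - D m w'| ≤ LD * |w - w'| := by
    intro m w hw w' hw'
    have e : D m w - D m w' = (fderiv ℝ (P.f m) (xstar P w) - fderiv ℝ (P.f m) (xstar P w')) (x' w)
        + fderiv ℝ (P.f m) (xstar P w') (x' w - x' w') := by
      rw [map_sub, sub_apply]; simp only [hD]; ring
    have hg : ‖fderiv ℝ (P.f m) (xstar P w) - fderiv ℝ (P.f m) (xstar P w')‖ ≤ Lg * |w - w'| := by
      fin_cases m
      · exact hpath.lip_g₀ w hw w' hw'
      · exact hpath.lip_g₁ w hw w' hw'
    have hb : ‖fderiv ℝ (P.f m) (xstar P w')‖ ≤ G := by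
      fin_cases m
      · exact hpath.bound_g₀ w' hw'
      · exact hpath.bound_g₁ w' hw'
    have h1 := (fderiv ℝ (P.f m) (xstar P w) - fderiv ℝ (P.f m) (xstar P w')).le_of_opNorm_le_of_le
      hg (hx'b w hw)
    have h2 := (fderiv ℝ (P.f m) (xstar P w')).le_of_opNorm_le_of_le hb (hlip w hw w' hw')
    rw [e]
    refine (abs_add_le _ _).trans ?_
    rw [← Real.norm_eq_abs, ← Real.norm_eq_abs]
    refine (add_le_add h1 h2).trans (le_of_eq ?_)
    rw [hLD]; ring
  -- the trade-off speed is positive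
  have hpos : ∀ w ∈ Icc (0 : ℝ) 1, 0 < D 1 w - D 0 w := by
    intro w hw
    have e : D 1 w - D 0 w = H w (x' w) (x' w) := by
      have := congrArg (fun φ : Vec d →L[ℝ] ℝ => φ (x' w)) (hkkt w hw)
      simp [htan w hw] at this
      rw [this]
    rw [e]
    refine hpath.posDef w hw _ (htan w hw) fun hx0 => ?_
    have hk := hkkt w hw
    rw [hx0, map_zero, zero_add] at hk
    -- If `x' w = 0`, the linearized system makes the gradient difference a combination of active
    -- constraint gradients, hence orthogonal to the tangent space.
    have hz : (LinearMap.ker (jacobian P w)).starProjection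
        (gradient (P.f 0) (xstar P w) - gradient (P.f 1) (xstar P w)) = 0 := by
      refine Submodule.eq_starProjection_of_mem_of_inner_eq_zero (zero_mem _) fun v hv => ?_
      have hv' := mem_ker_jacobian_on (hA w hw) hv
      have h1 := congrArg (fun φ : Vec d →L[ℝ] ℝ => φ v) hk
      simp [hv'] at h1
      rw [sub_zero, inner_sub_left, gradient, gradient, InnerProductSpace.toDual_symm_apply,
        InnerProductSpace.toDual_symm_apply]
      linarith
    have := htrade w hw
    rw [hz, norm_zero] at this
    linarith
  have hDc : ∀ m, ContinuousOn (D m) (Icc 0 1) := fun m => continuousOn_of_lip (hDlip m)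
  obtain ⟨w₀, hw₀, hmin⟩ := isCompact_Icc.exists_isMinOn ⟨0, h01⟩ ((hDc 1).sub (hDc 0))
  set c₁ := D 1 w₀ - D 0 w₀ with hc₁
  have hc₁0 : 0 < c₁ := hpos w₀ hw₀
  have hlow : ∀ w ∈ Icc (0 : ℝ) 1, c₁ ≤ D 1 w - D 0 w := fun w hw => hmin hw
  set F' : ℝ → Vec 2 := fun w => WithLp.toLp 2 fun m => D m w with hF'
  have hF : ∀ w ∈ Icc (0 : ℝ) 1, HasDerivWithinAt (fPF P) (F' w) (Icc 0 1) w := by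
    intro w hw
    have h1 : HasDerivWithinAt (fun w (m : Fin 2) => P.f m (xstar P w)) (fun m => D m w) (Icc 0 1) w :=
      hasDerivWithinAt_pi.2 fun m => hDd m w hw
    exact (PiLp.continuousLinearEquiv 2 ℝ fun _ : Fin 2 => ℝ).symm.hasFDerivAt.comp_hasDerivWithinAt
      w h1
  have hF'lip : ∀ w ∈ Icc (0 : ℝ) 1, ∀ w' ∈ Icc (0 : ℝ) 1, ‖F' w - F' w'‖ ≤ 2 * LD * |w - w'| := by
    intro w hw w' hw'
    refine (norm_vec_two_le _).trans ?_
    have h0 := hDlip 0 w hw w' hw'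
    have h1 := hDlip 1 w hw w' hw'
    show |D 0 w - D 0 w'| + |D 1 w - D 1 w'| ≤ _
    linarith
  have hspeed : ∀ w ∈ Icc (0 : ℝ) 1, speed P w = ‖F' w‖ := fun w hw => by
    rw [speed, (hF w hw).derivWithin (uniqueDiffOn_Icc (zero_lt_one' ℝ) w hw)]
  have hspeedc : ContinuousOn (speed P) (Icc 0 1) :=
    (continuousOn_of_lip hF'lip).norm.congr hspeed
  -- The half comes from `|v 1 - v 0| ≤ 2 ‖v‖`. Applied to chords, the growth of `f 1 - f 0` gives a
  -- lower bound valid for every step size, which a bound on the speed alone would not.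
  refine ⟨F', c₁ / 2, 2 * G * X, 2 * LD, Lx, Lf, ρ, ?_, hLx0, hLx, hLf, hρ, hobj⟩
  refine ⟨by linarith, hF, hF'lip, ?_, ?_, ?_, ?_, ?_⟩
  · intro s hs t ht hst
    have h1 := le_sub_of_le_deriv (fun w hw => (hDd 1 w hw).sub (hDd 0 w hw)) hs ht hst
      fun r hr => hlow r (Icc_subset_Icc hs.1 ht.2 hr)
    have h2 := (le_abs_self _).trans (abs_apply_sub_apply_le (fPF P t - fPF P s))
    have e : (fPF P t - fPF P s) 1 - (fPF P t - fPF P s) 0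
        = P.f 1 (xstar P t) - P.f 0 (xstar P t) - (P.f 1 (xstar P s) - P.f 0 (xstar P s)) := by
      show (P.f 1 (xstar P t) - P.f 1 (xstar P s)) - (P.f 0 (xstar P t) - P.f 0 (xstar P s)) = _
      ring
    rw [e] at h2
    have h1' : c₁ * (t - s) ≤
      P.f 1 (xstar P t) - P.f 0 (xstar P t) - (P.f 1 (xstar P s) - P.f 0 (xstar P s)) := h1
    linarith
  · intro w hw
    have h1 := hlow w hw
    have h2 : D 1 w - D 0 w ≤ 2 * ‖F' w‖ :=
      (le_abs_self _).trans (abs_apply_sub_apply_le (F' w))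
    linarith
  · intro w hw
    refine (norm_vec_two_le _).trans ?_
    have h0 : |D 0 w| ≤ G * X :=
      (fderiv ℝ (P.f 0) (xstar P w)).le_of_opNorm_le_of_le (hpath.bound_g₀ w hw) (hx'b w hw)
    have h1 : |D 1 w| ≤ G * X :=
      (fderiv ℝ (P.f 1) (xstar P w)).le_of_opNorm_le_of_le (hpath.bound_g₁ w hw) (hx'b w hw)
    show |D 0 w| + |D 1 w| ≤ _
    linarith
  · intro w hw
    rw [← hspeed w hw]
    exact hasDerivWithinAt_integral_Icc hspeedc w hw
  · exact intervalIntegral.integral_same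

end Path

/-! ### Speed bounds and assembly of the constants. -/

namespace PathRegular

variable {U : Type*} {d p q : ℕ} {P : Problem U d p q} {F' : ℝ → Vec 2} {c V L Lx Lf r : ℝ}

lemma speed_eq (h : PathRegular P F' c V L Lx Lf r) {w : ℝ} (hw : w ∈ Icc (0 : ℝ) 1) :
    speed P w = ‖F' w‖ := by
  rw [speed, (h.curve.deriv w hw).derivWithin (uniqueDiffOn_Icc zero_lt_one w hw)]

lemma continuousOn_speed (h : PathRegular P F' c V L Lx Lf r) :
    ContinuousOn (speed P) (Icc 0 1) := by
  have hF : LipschitzOnWith (Real.toNNReal L) F' (Icc 0 1) :=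
    .of_dist_le_mul fun x hx y hy => by
      rw [Real.coe_toNNReal _ h.curve.L_nonneg, dist_eq_norm, Real.dist_eq]
      exact h.curve.lip x hx y hy
  exact hF.continuousOn.norm.congr fun w hw => h.speed_eq hw

lemma vMin_pos (h : PathRegular P F' c V L Lx Lf r) : 0 < vMin P := by
  refine h.curve.c_pos.trans_le (le_csInf ⟨_, 0, ⟨le_rfl, zero_le_one⟩, rfl⟩ ?_)
  rintro _ ⟨w, hw, rfl⟩
  exact (h.curve.le_speed w hw).trans_eq (h.speed_eq hw).symm

lemma vMax_pos (h : PathRegular P F' c V L Lx Lf r) : 0 < vMax P := by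
  have h0 : (0 : ℝ) ∈ Icc (0 : ℝ) 1 := ⟨le_rfl, zero_le_one⟩
  refine (h.curve.c_pos.trans_le ((h.curve.le_speed 0 h0).trans_eq (h.speed_eq h0).symm)).trans_le
    (le_csSup ⟨V, ?_⟩ ⟨0, h0, rfl⟩)
  rintro _ ⟨w, hw, rfl⟩
  exact (h.speed_eq hw).trans_le (h.curve.speed_le w hw)

end PathRegular

lemma IsKStepSolver.nonneg {U : Type*} {d p q : ℕ} {P : Problem U d p q} {S : ℕ → ℝ → U → U}
    {η : ℕ → ℝ} (hS : IsKStepSolver P S η) (K : ℕ) : 0 ≤ η K :=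
  hS.2.1.le_of_tendsto hS.2.2 K

end SURF

theorem theorem1 {U : Type*} [Nonempty U] {d p q : ℕ} (P : Problem U d p q)
    (hA1 : HiddenRegular P) (hA2 : ConstraintRegular P) (hA3 : NonzeroTradeoff P) :
    -- the objects in the claim are well defined
    (∀ w ∈ Icc (0 : ℝ) 1, ∀ x, IsLSMin P w x ↔ x = xstar P w) ∧
    DifferentiableOn ℝ (fPF P) (Icc 0 1) ∧
    ContinuousOn (speed P) (Icc 0 1) ∧
    0 < vMin P ∧
    ∃ lPhi : ℝ, 0 ≤ lPhi ∧ IsCDF (cdf P) ∧ LipschitzSmooth lPhi (cdf P) ∧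
    -- constants that depend on the problem only
    ∃ lIter cN cη B a b : ℝ, ∃ C : ℕ → ℝ,
      0 < lIter ∧ 0 < cN ∧ 0 < cη ∧ 0 ≤ B ∧
      -- `C(N) = Θ(N)`
      0 < a ∧ (∀ N : ℕ, 1 ≤ N → a * N ≤ C N ∧ C N ≤ b * N) ∧
      -- exact solver: uniform Lipschitz-smoothness
      (∀ S : ℝ → U → U, IsExactSolver P S →
        ∀ N : ℕ, 1 ≤ N → ∀ (u₀ : ℕ → U) (α : ℝ), 0 < α → α ≤ 1 → ∀ t : ℕ,
          IsCDF (surfCDF P S N α u₀ t) ∧ LipschitzSmooth lIter (surfCDF P S N α u₀ t) ∧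
          IsCDF (surfRebuilt P S N α u₀ t) ∧ LipschitzSmooth lIter (surfRebuilt P S N α u₀ t)) ∧
      -- general solver with budget `η_K = O(s(1) / N)`
      (∀ (S : ℕ → ℝ → U → U) (η : ℕ → ℝ), IsKStepSolver P S η →
        ∀ N : ℕ, cN * kappa P lIter lPhi ^ (3 / 2 : ℝ) ≤ N →
        ∀ (D : ℝ) (u₀ : ℕ → U), 1 ≤ D →
          (∀ n ≤ N, ‖P.g (u₀ n) - xstar P ((n : ℝ) / N)‖ ≤ D) →
        ∀ K : ℕ, D * η K ≤ cη * arcLength P 1 / N →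
        ∀ α : ℝ, 0 < α → α ≤ 1 → ∀ t : ℕ,
          IsCDF (surfCDF P (S K) N α u₀ t) ∧
          LipschitzSmooth (lIter * max 1 ((N : ℝ) ^ 2 * (D * η K))) (surfCDF P (S K) N α u₀ t) ∧
          IsCDF (surfRebuilt P (S K) N α u₀ t) ∧
          LipschitzSmooth (lIter * max 1 ((N : ℝ) ^ 2 * (D * η K)))
            (surfRebuilt P (S K) N α u₀ t) ∧
          (α ≤ 1 / 2 → combinedError P (C N) (S K) N α u₀ t
            ≤ (1 - α / 4) ^ t * combinedError P (C N) (S K) N α u₀ 0 + B / (N : ℝ) ^ 2)) ∧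
      -- the budget for linearly convergent solvers
      (∀ A ρ D : ℝ, 0 < A → 0 < ρ → ρ < 1 → 1 ≤ D → ∃ cK : ℝ, 0 < cK ∧
        ∀ η : ℕ → ℝ, (∀ K, η K ≤ A * ρ ^ K) →
        ∀ N : ℕ, cN * kappa P lIter lPhi ^ (3 / 2 : ℝ) ≤ N →
        ∀ K : ℕ, cK * Real.log (N * vMax P / vMin P ^ 2) ≤ K →
          D * η K ≤ cη * arcLength P 1 / N) ∧
      -- the budget for sublinearly convergent solvers
      (∀ A r D : ℝ, 0 < A → 0 < r → 1 ≤ D → ∃ cK : ℝ, 0 < cK ∧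
        ∀ η : ℕ → ℝ, (∀ K : ℕ, 1 ≤ K → η K ≤ A * (K : ℝ) ^ (-r)) →
        ∀ N : ℕ, cN * kappa P lIter lPhi ^ (3 / 2 : ℝ) ≤ N →
        ∀ K : ℕ, cK * ((N : ℝ) / arcLength P 1) ^ (1 / r) ≤ K →
          D * η K ≤ cη * arcLength P 1 / N) := by
  obtain ⟨O, 𝒦, μ, l, lc, a, β, h⟩ := exists_regularProblem hA1 hA2
  obtain ⟨F', c, V, L, Lx, Lf, r, hP⟩ := h.exists_pathRegular hA2 hA3
  have hc := hP.curve.c_pos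
  have hV := hP.V_pos
  have hL := hP.curve.L_nonneg
  have hvm := hP.vMin_pos
  have hvM := hP.vMax_pos
  have hs : 0 < arcLength P 1 := hc.trans_le hP.curve.arc_one_bounds.1
  have hsV : arcLength P 1 ≤ V := hP.curve.arc_one_bounds.2
  have hnc := hP.noiseConst_pos
  have hdc := hP.discConst_nonneg
  have hsc := hP.smoothConst_nonneg
  obtain ⟨hnb, -⟩ := hP.noiseBudget_spec
  refine ⟨fun w hw x => h.isLSMin_iff hw x,
    fun w hw => (hP.curve.deriv w hw).differentiableWithinAt, hP.continuousOn_speed, hvm,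
    L / c, by positivity, hP.isCDF_cdf, hP.curve.lipschitzSmooth_arc, ?_⟩
  set m := 32 * L / (c / (4 * V) * c) with hm
  have hm0 : 0 ≤ m := by positivity
  -- The summands ensure in turn the fine-mesh condition, `N ≥ 1`, and `N * (vMax / vMin²) ≥ 2` for
  -- the logarithmic budget.
  obtain ⟨N₀, hN₀⟩ : ∃ N₀, N₀ = m + 1 + 2 * (vMin P ^ 2 / vMax P) := ⟨_, rfl⟩
  have hq : 0 < vMin P ^ 2 / vMax P := by positivity
  have hN₀m : m ≤ N₀ := by linarith
  have hN₀p : 0 < N₀ := by linarith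
  set lIter := 16 * V * (N₀ * (4 * V / c)) / c + PathRegular.smoothConst c V L Lx Lf with hlI
  have hl0 : 0 < lIter := by positivity
  have hκ : 0 < kappa P lIter (L / c) := by unfold kappa; positivity
  have hκ' : 0 < kappa P lIter (L / c) ^ (3 / 2 : ℝ) := by positivity
  have hβ : 0 < vMax P / vMin P ^ 2 := by positivity
  have hlarge : ∀ N : ℕ, N₀ / kappa P lIter (L / c) ^ (3 / 2 : ℝ) *
      kappa P lIter (L / c) ^ (3 / 2 : ℝ) ≤ N →
      1 ≤ N ∧ m ≤ N ∧ 2 ≤ N * (vMax P / vMin P ^ 2) := by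
    intro N hN
    rw [div_mul_cancel₀ _ hκ'.ne'] at hN
    refine ⟨by exact_mod_cast (by linarith : (1 : ℝ) ≤ N), hN₀m.trans hN, ?_⟩
    have h1 : 2 * (vMin P ^ 2 / vMax P) ≤ N := by linarith
    calc (2 : ℝ) = 2 * (vMin P ^ 2 / vMax P) * (vMax P / vMin P ^ 2) := by field_simp
      _ ≤ _ := by gcongr
  -- Division by `V` turns the budget in `arcLength P 1 ≤ V` into the absolute bound on `N D η`.
  have hcη : 0 < PathRegular.noiseBudget c V Lx Lf r / V := by positivity
  -- `lIter` is fixed without reference to `cN`, so `kappa` is a positive constant of the problem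
  -- and `cN` may be chosen so that `cN * kappa ^ (3/2) = N₀`.
  refine ⟨lIter, N₀ / kappa P lIter (L / c) ^ (3 / 2 : ℝ),
    PathRegular.noiseBudget c V Lx Lf r / V, 8 * PathRegular.discConst c V L,
    2 * PathRegular.noiseConst c V Lf, 2 * PathRegular.noiseConst c V Lf,
    fun N => 2 * PathRegular.noiseConst c V Lf * N, hl0, by positivity, hcη, by positivity,
    by positivity, fun N _ => ⟨le_rfl, le_rfl⟩, ?_, ?_, ?_, ?_⟩
  · intro S hS N hN1 u₀ α h0 h1 t
    exact hP.exact_solver hS hN₀m le_rfl hN1 u₀ h0 h1 t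
  · intro S η hS N hN D u₀ hD hu₀ K hK α h0 h1 t
    obtain ⟨hN1, hNm, -⟩ := hlarge N hN
    have hη := hS.nonneg K
    have hN0 : (0 : ℝ) < N := by exact_mod_cast hN1
    have hbud : N * (D * η K) ≤ PathRegular.noiseBudget c V Lx Lf r := by
      rw [le_div_iff₀ hN0] at hK
      calc N * (D * η K) = D * η K * N := mul_comm _ _
        _ ≤ PathRegular.noiseBudget c V Lx Lf r / V * arcLength P 1 := hK
        _ ≤ PathRegular.noiseBudget c V Lx Lf r / V * V := by gcongr
        _ = _ := div_mul_cancel₀ _ hV.ne'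
    have hsl : PathRegular.smoothConst c V L Lx Lf ≤ lIter := by
      rw [hlI]; exact le_add_of_nonneg_left (by positivity)
    have hl : PathRegular.smoothConst c V L Lx Lf * max 1 ((N : ℝ) ^ 2 * (D * η K)) ≤
        lIter * max 1 ((N : ℝ) ^ 2 * (D * η K)) := by gcongr
    obtain ⟨hφ, hr, -, -⟩ := hP.inexact_solver (hS.1 K) hη hD hN1 hNm hu₀ hbud hl h0 h1 t
    exact ⟨hφ.1, hφ.2.2, hr.1, hr.2.2, fun hα =>
      hP.combinedError_le (hS.1 K) hη hD hN1 hNm hu₀ hbud h0 hα t⟩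
  · intro A ρ D hA hρ0 hρ1 hD
    obtain ⟨cK, hcK, H⟩ := linear_budget hA hρ0 hρ1 hD hs hβ hcη
    refine ⟨cK, hcK, fun η hη N hN K hK => ?_⟩
    obtain ⟨hN1, -, hN2⟩ := hlarge N hN
    exact H η hη N hN1 hN2 K (by rwa [← mul_div_assoc])
  · intro A r' D hA hr hD
    obtain ⟨cK, hcK, H⟩ := sublinear_budget hA hr hD hs hcη
    exact ⟨cK, hcK, fun η hη N hN K hK => H η hη N (hlarge N hN).1 K hK⟩
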